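/- Two graphs $G$ and $H$ are (vertex-)hypomorphic if there is a bijection $\varphi\colon V(G)\to V(H)$ such that the induced subgraphs $G-v$ and $H-\varphi(v)$ are isomorphic for every vertex $v$ of $G$. A graph $G$ is reconstructible if every graph hypomorphic to $G$ is isomorphic to $G$. An embedding $G\hookrightarrow H$ is an injective map $V(G)\to V(H)$ that sends edges of $G$ to edges of $H$, i.e. an isomorphism from $G$ onto a (not necessarily induced) subgraph of $H$. Theorem. There are two hypomorphic infinite trees $T$ and $S$, each of maximum degree exactly $3$, such that there is no embedding $T\hookrightarrow S$ and no embedding $S\hookrightarrow T$; in particular $T\not\cong S$. Consequently each of the following statements is false: (a) (Harary–Schwenk–Scott Conjecture) every infinite locally finite tree is reconstructible; (b) (Nash-Williams) every locally finite connected infinite graph is reconstructible; (c) (Nash-Williams) any two hypomorphic infinite trees are isomorphic; (d) (Halin) if two infinite graphs $G$ and $H$ are hypomorphic, then there exist embeddings $G\hookrightarrow H$ and $H\hookrightarrow G$. -/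

import Mathlib

namespace SimpleGraph

/-- A hypomorphism from `G` to `H`: a bijection `φ` of the vertex sets such that the
vertex-deleted induced subgraphs `G - v` and `H - φ v` are isomorphic for every vertex `v`. -/
def IsHypomorphism {V W : Type*} (G : SimpleGraph V) (H : SimpleGraph W) (φ : V ≃ W) : Prop :=
  ∀ v : V, Nonempty (G.induce {v}ᶜ ≃g H.induce {φ v}ᶜ)

/-- `G` and `H` are (vertex-)hypomorphic. -/
def Hypomorphic {V W : Type*} (G : SimpleGraph V) (H : SimpleGraph W) : Prop :=
  ∃ φ : V ≃ W, G.IsHypomorphism H φ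

/-- `G` is reconstructible if every graph hypomorphic to `G` is isomorphic to `G`. -/
def Reconstructible {V : Type} (G : SimpleGraph V) : Prop :=
  ∀ (W : Type) (H : SimpleGraph W), G.Hypomorphic H → Nonempty (H ≃g G)

/-- Every vertex has finitely many neighbours. -/
def HasFiniteDegrees {V : Type*} (G : SimpleGraph V) : Prop :=
  ∀ v : V, (G.neighborSet v).Finite

/-- The maximum degree of `G` exists and equals `d` (`G` may have infinitely many vertices). -/
def HasMaxDegree {V : Type*} (G : SimpleGraph V) (d : ℕ) : Prop :=
  (∀ v : V, (G.neighborSet v).encard ≤ d) ∧ ∃ v : V, (G.neighborSet v).encard = d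

/-- The Harary–Schwenk–Scott Conjecture: locally finite trees are reconstructible. It is stated
for infinite trees only, since the tree with two vertices is trivially not reconstructible. -/
def HararySchwenkScottConjecture : Prop :=
  ∀ (V : Type) [Infinite V] (G : SimpleGraph V),
    G.IsTree → G.HasFiniteDegrees → G.Reconstructible

/-- Affirmative answer to the question of Nash-Williams: is every locally finite connected
infinite graph reconstructible? -/
def NashWilliamsConnectedQuestion : Prop :=
  ∀ (V : Type) [Infinite V] (G : SimpleGraph V),
    G.Connected → G.HasFiniteDegrees → G.Reconstructible

/-- Affirmative answer to the question of Nash-Williams: if two infinite trees are hypomorphic,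
are they also isomorphic? -/
def NashWilliamsTreeQuestion : Prop :=
  ∀ (V W : Type) [Infinite V] [Infinite W] (G : SimpleGraph V) (H : SimpleGraph W),
    G.IsTree → H.IsTree → G.Hypomorphic H → Nonempty (G ≃g H)

/-- Affirmative answer to the question of Halin: if two infinite graphs `G` and `H` are
hypomorphic, do there exist embeddings of `G` into `H` and of `H` into `G`? -/
def HalinQuestion : Prop :=
  ∀ (V W : Type) [Infinite V] [Infinite W] (G : SimpleGraph V) (H : SimpleGraph W),
    G.Hypomorphic H → G.IsContained H ∧ H.IsContained G

end SimpleGraph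

/-! The two trees are limits of increasing sequences of trees T and S of maximum degree 3. Each
stage carries coloured ports: vertices of degree at most one, at distance at least K from all branch
vertices. Two things are maintained. Neither tree embeds into the other, and for each vertex already
treated there is a promise: a bijection T → S that respects port colours and is an isomorphism away
from that vertex. What is glued onto a port in a later stage depends only on its colour, so promises
survive (`Promise.ext`) and become isomorphisms of vertex-deleted trees in the limit
(`lim_promise`).

One step treats a vertex v of T. Choose a true port a of T far from v, the neighbour u of v towards
a, and a false port s of S. Onto each true port glue a comb that leads to a copy of S, attached at
s. Onto each false port glue the same comb from its other end, leading to a copy of T with the edge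
uv removed: its vertex a is attached at the end of the spine and its vertex v at the tip of a short
tooth. Repeat this at the ports of the copies other than s and a. Now T is joined through the comb
at a to a copy of S, and S through the comb at s to a copy of T. These two configurations differ
only in whether v is joined to u or to the tooth tip. Deleting v in one and the copy of v in the
other makes the extensions isomorphic (`exists_promise`). The tips of two long teeth of each comb
are the new ports.

Non-embeddability rests on `Tight`: if one branch vertex of a tight tree is mapped into a piece
whose exits are far from its branch vertices, then the whole tree is mapped into that piece. By
`embed_cases` an old tree therefore goes into the base, into a copy of S, or gives a non-surjective
embedding into T. All self-embeddings of T and S are onto, because they preserve a finite set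
(`Rigid.surjOn`). This leaves only an embedding of the extension of S that sends S to one of its
copies. It is excluded by `not_into_s`, which compares the combs glued to false ports. The same
localization carries non-embeddability to the limit (`lim_not_isEmb`).

Every step pairs the treated vertex with a vertex that is new at that stage. Treating the vertices
of both trees in turn gives injections in both directions that consist of matching pairs, and a
Schröder–Bernstein argument combines them into a hypomorphism (`exists_hypomorphic_of_good`). -/

open SimpleGraph Function

namespace TreeRecon

/-! ### Embeddings, branch vertices, isolated sets, tightness and rigidity. -/

section General

variable {V W X : Type*}

/-- `x` has at least three neighbours. -/
def IsBranch (G : SimpleGraph V) (x : V) : Prop :=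
  ∃ a b c, a ≠ b ∧ a ≠ c ∧ b ≠ c ∧ G.Adj x a ∧ G.Adj x b ∧ G.Adj x c

/-- `f` is an embedding of `G` as a (not necessarily induced) subgraph of `H`. -/
structure IsEmb (f : V → W) (G : SimpleGraph V) (H : SimpleGraph W) : Prop where
  inj : Injective f
  adj : ∀ x y, G.Adj x y → H.Adj (f x) (f y)

/-- A vertex set that contains the `K`-ball around each of its branch vertices. -/
def Isolated (G : SimpleGraph V) (K : ℕ) (U : Set V) : Prop :=
  ∀ d ∈ U, IsBranch G d → ∀ y (w : G.Walk d y), w.length ≤ K → y ∈ U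

/-- The only `K`-isolated set with a branch vertex is the whole vertex set. -/
def Tight (G : SimpleGraph V) (K : ℕ) : Prop :=
  ∀ U : Set V, (∃ d ∈ U, IsBranch G d) → Isolated G K U → ∀ y, y ∈ U

/-- All self-embeddings preserve a common finite nonempty set. -/
def Rigid (G : SimpleGraph V) : Prop :=
  ∃ F : Set V, F.Finite ∧ F.Nonempty ∧ ∀ f : V → V, IsEmb f G G → Set.MapsTo f F F

theorem IsEmb.comp {G : SimpleGraph V} {H : SimpleGraph W} {I : SimpleGraph X} {g : W → X}
    {f : V → W} (hg : IsEmb g H I) (hf : IsEmb f G H) : IsEmb (g ∘ f) G I :=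
  ⟨hg.inj.comp hf.inj, fun _ _ h => hg.adj _ _ (hf.adj _ _ h)⟩

theorem IsEmb.isContained {G : SimpleGraph V} {H : SimpleGraph W} {f : V → W} (hf : IsEmb f G H) :
    G.IsContained H :=
  ⟨⟨⟨f, fun h => hf.adj _ _ h⟩, hf.inj⟩⟩

theorem exists_isEmb {G : SimpleGraph V} {H : SimpleGraph W} (h : G.IsContained H) :
    ∃ f : V → W, IsEmb f G H := by
  obtain ⟨f⟩ := h
  exact ⟨f, f.injective, fun x y hxy => f.toHom.map_adj hxy⟩

theorem IsBranch.map {G : SimpleGraph V} {H : SimpleGraph W} {f : V → W} (hf : IsEmb f G H) {x : V}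
    (h : IsBranch G x) : IsBranch H (f x) := by
  obtain ⟨a, b, c, h1, h2, h3, h4, h5, h6⟩ := h
  exact ⟨f a, f b, f c, hf.inj.ne h1, hf.inj.ne h2, hf.inj.ne h3, hf.adj _ _ h4, hf.adj _ _ h5,
    hf.adj _ _ h6⟩

theorem not_isBranch {G : SimpleGraph V} {x : V} {g : V → W} (hg : Injective g) (a b : W)
    (h : ∀ y, G.Adj x y → g y = a ∨ g y = b) : ¬ IsBranch G x := by
  rintro ⟨p, q, r, h1, h2, h3, h4, h5, h6⟩
  have := h _ h4; have := h _ h5; have := h _ h6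
  have := hg.ne h1; have := hg.ne h2; have := hg.ne h3
  grind

theorem encard_neighborSet_le_three {G : SimpleGraph V} {x : V} {g : V → W} (hg : Injective g)
    (a b c : W) (h : ∀ y, G.Adj x y → g y = a ∨ g y = b ∨ g y = c) :
    (G.neighborSet x).encard ≤ 3 := by
  have hs : g '' G.neighborSet x ⊆ {a, b, c} := by
    rintro _ ⟨y, hy, rfl⟩
    simpa using h y hy
  rw [← hg.encard_image]
  refine (Set.encard_le_encard hs).trans ?_
  refine (Set.encard_insert_le _ _).trans ?_
  have := Set.encard_insert_le {c} b
  rw [Set.encard_singleton] at this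
  calc _ ≤ (1 + 1 : ℕ∞) + 1 := by gcongr
    _ = 3 := by norm_num

theorem exists_three_of_encard_le {G : SimpleGraph V} {x : V}
    (h : (G.neighborSet x).encard ≤ 3) : ∃ a b c, ∀ y, G.Adj x y → y = a ∨ y = b ∨ y = c := by
  have hfin : (G.neighborSet x).Finite := Set.finite_of_encard_le_coe (k := 3) h
  by_cases h1 : ∃ a, G.Adj x a
  swap
  · exact ⟨x, x, x, fun y hy => (h1 ⟨y, hy⟩).elim⟩
  obtain ⟨a, ha⟩ := h1
  by_cases h2 : ∃ b, G.Adj x b ∧ b ≠ a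
  swap
  · push Not at h2
    exact ⟨a, a, a, fun y hy => Or.inl (h2 y hy)⟩
  obtain ⟨b, hb, hab⟩ := h2
  by_cases h3 : ∃ c, G.Adj x c ∧ c ≠ a ∧ c ≠ b
  swap
  · refine ⟨a, b, b, fun y hy => ?_⟩
    by_contra hcon
    exact h3 ⟨y, hy, by tauto, by tauto⟩
  obtain ⟨c, hc, hca, hcb⟩ := h3
  refine ⟨a, b, c, fun y hy => ?_⟩
  by_contra hcon
  push Not at hcon
  have hs : ({y, a, b, c} : Set V) ⊆ G.neighborSet x := by
    rintro z (rfl | rfl | rfl | rfl) <;> assumption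
  have h4 : ({y, a, b, c} : Set V).encard = 4 := by
    rw [Set.encard_insert_of_notMem (by simp [hcon]), Set.encard_insert_of_notMem
      (by simp [hab.symm, hca.symm]), Set.encard_insert_of_notMem (by simp [hcb.symm]),
      Set.encard_singleton]
    norm_num
  have := (Set.encard_le_encard hs).trans h
  rw [h4] at this
  exact absurd this (by norm_num)

theorem IsBranch.three_le_encard {G : SimpleGraph V} {x : V} (h : IsBranch G x) :
    3 ≤ (G.neighborSet x).encard := by
  obtain ⟨a, b, c, h1, h2, h3, h4, h5, h6⟩ := h
  have hs : ({a, b, c} : Set V) ⊆ G.neighborSet x := by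
    rintro z (rfl | rfl | rfl) <;> assumption
  have h4 : ({a, b, c} : Set V).encard = 3 := by
    rw [Set.encard_insert_of_notMem (by simp [h1, h2]), Set.encard_insert_of_notMem
      (by simp [h3]), Set.encard_singleton]
    norm_num
  rw [← h4]
  exact Set.encard_le_encard hs

/-- Embeddings preserve branch vertices and do not lengthen walks, so the preimage of an isolated
set is isolated. A single branch vertex thus decides which piece receives the whole graph. -/
theorem Tight.mem_of_isEmb {G : SimpleGraph V} {H : SimpleGraph W} {K : ℕ} (hG : Tight G K)
    {f : V → W} (hf : IsEmb f G H) {U : Set W} (hU : Isolated H K U) {x : V} (hx : IsBranch G x)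
    (hxU : f x ∈ U) (y : V) : f y ∈ U := by
  refine hG (f ⁻¹' U) ⟨x, hxU, hx⟩ (fun d hd hbr z w hw => ?_) y
  exact hU (f d) hd (hbr.map hf) _ (w.map ⟨f, fun h => hf.adj _ _ h⟩) (by simpa using hw)

/-- A set `U` with a map `g` to a graph `H` that is a homomorphism on `U` is isolated if the
vertices where one can leave `U` are far from all branch vertices. -/
theorem isolated_of {G : SimpleGraph V} {H : SimpleGraph W} {K : ℕ} {U : Set V} (g : V → W)
    (E : Set W)
    (h : ∀ x ∈ U, ∀ y, G.Adj x y → (y ∈ U ∧ H.Adj (g x) (g y)) ∨ g x ∈ E)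
    (hE : ∀ d ∈ U, IsBranch G d → ∀ e ∈ E, ∀ w : H.Walk (g d) e, K ≤ w.length) :
    Isolated G K U := by
  intro d hd hbr y w hw
  have key : ∀ (x y : V) (w : G.Walk x y), x ∈ U → ∀ w' : H.Walk (g d) (g x),
      w'.length + w.length ≤ K → y ∈ U := by
    intro x y w
    induction w with
    | nil => intro hx _ _; exact hx
    | @cons x z y hxz w ih =>
      intro hx w' hl
      simp only [Walk.length_cons] at hl
      rcases h x hx z hxz with ⟨hz, hadj⟩ | hxE
      · exact ih hz (w'.concat hadj) (by simp only [Walk.length_concat]; omega)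
      · have := hE d hd hbr _ hxE w'
        omega
  exact key d y w hd Walk.nil (by simpa using hw)

/-- Lower bounds on walk lengths are obtained below from explicit potentials of this kind. -/
theorem le_length_of_lipschitz {G : SimpleGraph V} (g : V → ℕ)
    (hg : ∀ x y, G.Adj x y → g y ≤ g x + 1) {x y : V} (w : G.Walk x y) : g y ≤ g x + w.length := by
  induction w with
  | nil => simp
  | cons h w ih =>
    have := hg _ _ h
    simp only [Walk.length_cons]
    omega

theorem dist_map_le {G : SimpleGraph V} (hc : G.Connected) (ρ : V → V)
    (hρ : ∀ x y, G.Adj x y → ρ x = ρ y ∨ G.Adj (ρ x) (ρ y)) (x y : V) :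
    G.dist (ρ x) (ρ y) ≤ G.dist x y := by
  obtain ⟨w, hw⟩ := hc.exists_walk_length_eq_dist x y
  rw [← hw]
  clear hw
  induction w with
  | nil => simp
  | @cons u v w h p ih =>
    have h1 : G.dist (ρ u) (ρ v) ≤ 1 := by
      rcases hρ _ _ h with h | h
      · simp [h]
      · exact (dist_eq_one_iff_adj.2 h).le
    have h2 := hc.dist_triangle (u := ρ u) (v := ρ v) (w := ρ w)
    simp only [Walk.length_cons]
    omega

/-- The map `ρ` is a retraction onto a part in which branch vertices are `R`-dense. Inside this part
one hops from branch vertex to branch vertex without leaving `U`; every other vertex lies within `K`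
of a branch vertex and is absorbed at the end. -/
theorem tight_of_dense {G : SimpleGraph V} {R K : ℕ} (hc : G.Connected) (ρ : V → V)
    (hρ : ∀ x y, G.Adj x y → ρ x = ρ y ∨ G.Adj (ρ x) (ρ y)) (hidem : ∀ x, ρ (ρ x) = ρ x)
    (hbr : ∀ d, IsBranch G d → ρ d = d)
    (hdense : ∀ x, ρ x = x → ∃ d, IsBranch G d ∧ G.dist x d ≤ R)
    (hleg : ∀ x, ρ x ≠ x → ∃ d, IsBranch G d ∧ G.dist d x ≤ K) (hK : 2 * R + 1 ≤ K) :
    Tight G K := by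
  rintro U ⟨d₀, hd₀U, hd₀⟩ hU
  have hstep : ∀ d ∈ U, IsBranch G d → ∀ y, G.dist d y ≤ K → y ∈ U := by
    intro d hd hb y hy
    obtain ⟨w, hw⟩ := hc.exists_walk_length_eq_dist d y
    exact hU d hd hb y w (hw ▸ hy)
  have main : ∀ m, ∀ d ∈ U, IsBranch G d → ∀ y, ρ y = y → G.dist d y ≤ m → y ∈ U := by
    intro m
    induction m with
    | zero => exact fun d hd hb y _ hm => hstep d hd hb y (hm.trans (Nat.zero_le _))
    | succ m ih =>
      intro d hd hb y hy hm
      by_cases hle : G.dist d y ≤ K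
      · exact hstep d hd hb y hle
      obtain ⟨w, hw⟩ := hc.exists_walk_length_eq_dist d y
      -- Retract the point at distance `R + 1` along the geodesic and take a branch vertex `d'`
      -- within `R` of it. Then `d'` is within `2 * R + 1 ≤ K` of `d`, hence in `U`, and at least
      -- one step closer to `y` than `d`.
      have h1 : G.dist d (w.getVert (R + 1)) ≤ R + 1 :=
        (dist_le (w.take (R + 1))).trans (by simp)
      have h2 : G.dist (w.getVert (R + 1)) y ≤ w.length - (R + 1) :=
        (dist_le (w.drop (R + 1))).trans (by simp)
      have h3 := dist_map_le hc ρ hρ d (w.getVert (R + 1))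
      have h4 := dist_map_le hc ρ hρ (w.getVert (R + 1)) y
      rw [hbr d hb] at h3
      rw [hy] at h4
      obtain ⟨d', hd'b, hd'⟩ := hdense _ (hidem (w.getVert (R + 1)))
      have h5 := hc.dist_triangle (u := d) (v := ρ (w.getVert (R + 1))) (w := d')
      have h6 := hc.dist_triangle (u := d') (v := ρ (w.getVert (R + 1))) (w := y)
      rw [dist_comm (u := d') (v := ρ (w.getVert (R + 1)))] at h6
      exact ih d' (hstep d hd hb d' (by omega)) hd'b y hy (by omega)
  intro y
  by_cases hy : ρ y = y
  · exact main _ d₀ hd₀U hd₀ y hy le_rfl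
  · obtain ⟨d, hd, hdy⟩ := hleg y hy
    exact hstep d (main _ d₀ hd₀U hd₀ d (hbr d hd) le_rfl) hd y hdy

/-- The vertices within distance `K` of some branch vertex form an isolated set. -/
theorem Tight.exists_walk {G : SimpleGraph V} {K : ℕ} (h : Tight G K) {d₀ : V}
    (hd₀ : IsBranch G d₀) (x : V) : ∃ d, IsBranch G d ∧ ∃ w : G.Walk x d, w.length ≤ K := by
  refine h {x | ∃ d, IsBranch G d ∧ ∃ w : G.Walk x d, w.length ≤ K}
    ⟨d₀, ⟨d₀, hd₀, .nil, by simp⟩, hd₀⟩ ?_ x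
  intro d _ hb y w hw
  exact ⟨d, hb, w.reverse, by simpa using hw⟩

theorem finite_ball {G : SimpleGraph V} (hf : ∀ x, (G.neighborSet x).Finite) (o : V) (n : ℕ) :
    {y | ∃ w : G.Walk o y, w.length ≤ n}.Finite := by
  induction n generalizing o with
  | zero =>
    refine (Set.finite_singleton o).subset ?_
    rintro y ⟨w, hw⟩
    exact (Walk.eq_of_length_eq_zero (Nat.le_zero.1 hw)).symm
  | succ n ih =>
    refine ((Set.finite_singleton o).union ((hf o).biUnion fun z _ => ih z)).subset ?_
    rintro y ⟨w, hw⟩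
    cases w with
    | nil => simp
    | @cons _ z _ h w =>
      refine Or.inr (Set.mem_biUnion (x := z) h ⟨w, ?_⟩)
      simpa using hw

/-- The parts of `A` within a fixed distance of the preserved set are finite and invariant under
`f`, so the injection `f` permutes each of them, and they exhaust `A`. -/
theorem Rigid.surjOn {G : SimpleGraph V} (hr : Rigid G) (hc : G.Connected)
    (hf : ∀ x, (G.neighborSet x).Finite) {f : V → V} (hemb : IsEmb f G G) {A : Set V}
    (hA : Set.MapsTo f A A) : Set.SurjOn f A A := by
  obtain ⟨F, hFf, ⟨o, ho⟩, hF⟩ := hr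
  intro x hx
  obtain ⟨w⟩ := hc.preconnected o x
  let B : Set V := A ∩ ⋃ p ∈ F, {y | ∃ w' : G.Walk p y, w'.length ≤ w.length}
  have hB : B.Finite := (hFf.biUnion fun p _ => finite_ball hf p w.length).inter_of_right A
  have hmaps : Set.MapsTo f B B := by
    rintro y ⟨hyA, hy⟩
    simp only [Set.mem_iUnion, Set.mem_ofPred_eq] at hy
    obtain ⟨p, hp, w', hw'⟩ := hy
    refine ⟨hA hyA, ?_⟩
    simp only [Set.mem_iUnion, Set.mem_ofPred_eq]
    exact ⟨f p, hF f hemb hp, w'.map ⟨f, fun h => hemb.adj _ _ h⟩, by simpa using hw'⟩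
  have hsurj := ((Set.Finite.injOn_iff_bijOn_of_mapsTo hB hmaps).1 hemb.inj.injOn).surjOn
  obtain ⟨y, hy, rfl⟩ := hsurj (show x ∈ B from ⟨hx, by
    simp only [Set.mem_iUnion, Set.mem_ofPred_eq]; exact ⟨o, ho, w, le_rfl⟩⟩)
  exact ⟨y, hy.1, rfl⟩

/-! ### Recognizing trees by a height function. -/

/-- A vertex of maximal height on a cycle would have two different neighbours that are not higher.
-/
theorem isAcyclic_of_height {G : SimpleGraph V} (h : V → ℕ)
    (hu : ∀ x y z, G.Adj x y → G.Adj x z → h y ≤ h x → h z ≤ h x → y = z) : G.IsAcyclic := by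
  rw [isAcyclic_iff_free_cycleGraph]
  rintro n hn hcon
  obtain ⟨f, hf⟩ := exists_isEmb hcon
  obtain ⟨m, rfl⟩ : ∃ m, n = m + 3 := ⟨n - 3, by omega⟩
  obtain ⟨i, -, hi⟩ := Finset.exists_max_image (Finset.univ : Finset (Fin (m + 3)))
    (fun i => h (f i)) ⟨0, Finset.mem_univ _⟩
  have h1 : (cycleGraph (m + 3)).Adj i (i + 1) := by
    rw [cycleGraph_adj]; right; abel
  have h2 : (cycleGraph (m + 3)).Adj i (i - 1) := by
    rw [cycleGraph_adj]; left; abel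
  have := hu _ _ _ (hf.adj _ _ h1) (hf.adj _ _ h2) (hi _ (Finset.mem_univ _))
    (hi _ (Finset.mem_univ _))
  have h3 := hf.inj this
  -- The two neighbours on the cycle could coincide only if 2 vanished modulo `m + 3`.
  have h4 : (1 : Fin (m + 3)) + 1 = 0 := by
    have : i + 1 - (i - 1) = 0 := by rw [h3]; abel
    calc (1 : Fin (m + 3)) + 1 = i + 1 - (i - 1) := by abel
      _ = 0 := this
  have h5 := congrArg Fin.val h4
  simp [Fin.val_add, Nat.mod_eq_of_lt (show 2 < m + 3 by omega)] at h5

theorem connected_of_height {G : SimpleGraph V} (r : V) (h : V → ℕ)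
    (hl : ∀ x, x ≠ r → ∃ y, G.Adj x y ∧ h y < h x) : G.Connected := by
  have key : ∀ n x, h x ≤ n → G.Reachable x r := by
    intro n
    induction n with
    | zero =>
      intro x hx
      by_contra hne
      obtain ⟨y, _, hy⟩ := hl x (fun e => hne (e ▸ Reachable.refl _))
      omega
    | succ n ih =>
      intro x hx
      by_cases hxr : x = r
      · exact hxr ▸ Reachable.refl _
      · obtain ⟨y, hy, hlt⟩ := hl x hxr
        exact hy.reachable.trans (ih y (by omega))
  exact (connected_iff _).2 ⟨fun x y => (key _ x le_rfl).trans (key _ y le_rfl).symm, ⟨r⟩⟩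

theorem exists_adj_dist_lt {G : SimpleGraph V} (hc : G.Connected) {r x : V} (hx : x ≠ r) :
    ∃ y, G.Adj x y ∧ G.dist r y < G.dist r x := by
  obtain ⟨w, hw⟩ := hc.exists_walk_length_eq_dist x r
  cases w with
  | nil => exact (hx rfl).elim
  | @cons _ y _ h w =>
    refine ⟨y, h, ?_⟩
    rw [dist_comm, dist_comm (u := r) (v := x), ← hw]
    have := dist_le w
    simp only [Walk.length_cons]
    omega

/-- In a tree a neighbour that is not farther from `r` is strictly closer, hence it is the second
vertex of the unique path to `r`. -/
theorem eq_of_adj_of_dist_le {G : SimpleGraph V} (ht : G.IsTree) {r x y z : V} (hy : G.Adj x y)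
    (hz : G.Adj x z) (hdy : G.dist r y ≤ G.dist r x) (hdz : G.dist r z ≤ G.dist r x) : y = z := by
  classical
  have key : ∀ y, G.Adj x y → G.dist r y ≤ G.dist r x → ∀ p : G.Walk x r, p.IsPath →
      p.snd = y := by
    intro y hy hd p hp
    obtain ⟨q, hq⟩ := ht.connected.exists_walk_length_eq_dist y r
    have hlt : G.dist r y < G.dist r x := by
      have := ht.dist_ne_of_adj r hy
      omega
    have hqp : (Walk.cons hy q).IsPath := by
      apply Walk.isPath_of_length_eq_dist
      have h1 := dist_le (Walk.cons hy q)
      simp only [Walk.length_cons] at h1 ⊢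
      rw [dist_comm (u := x)] at h1 ⊢
      rw [dist_comm (u := y)] at hq
      omega
    have := (ht.isAcyclic.subsingleton_path x r).elim ⟨p, hp⟩ ⟨_, hqp⟩
    have h2 : p = Walk.cons hy q := congrArg Subtype.val this
    rw [h2]
    simp
  obtain ⟨p, hp, -⟩ := ht.existsUnique_path x r
  rw [← key y hy hdy p hp, ← key z hz hdz p hp]

/-! ### Promises and the invariants of a stage. -/

/-- `e` matches the port colours and is an isomorphism away from `v`. -/
structure Promise (G : SimpleGraph V) (c : V → Option Bool) (H : SimpleGraph W)
    (d : W → Option Bool) (v : V) (e : V ≃ W) : Prop where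
  col : ∀ x, d (e x) = c x
  adj : ∀ x y, x ≠ v → y ≠ v → (G.Adj x y ↔ H.Adj (e x) (e y))

theorem Promise.symm {G : SimpleGraph V} {c : V → Option Bool} {H : SimpleGraph W}
    {d : W → Option Bool} {v : V} {e : V ≃ W} (h : Promise G c H d v e) :
    Promise H d G c (e v) e.symm := by
  refine ⟨fun x => by simpa using (h.col (e.symm x)).symm, fun x y hx hy => ?_⟩
  have := h.adj (e.symm x) (e.symm y) (fun h => hx (by simp [← h])) (fun h => hy (by simp [← h]))
  simpa using this.symm

theorem Promise.nonempty_iso {G : SimpleGraph V} {c : V → Option Bool} {H : SimpleGraph W}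
    {d : W → Option Bool} {v : V} {e : V ≃ W} (h : Promise G c H d v e) :
    Nonempty (G.induce {v}ᶜ ≃g H.induce {e v}ᶜ) := by
  refine ⟨⟨e.subtypeEquiv fun x => by simp, ?_⟩⟩
  rintro ⟨x, hx⟩ ⟨y, hy⟩
  exact (h.adj x y hx hy).symm

/-- The invariants of a tree with coloured ports at scale `K`. -/
structure PortTree (K : ℕ) (G : SimpleGraph V) (c : V → Option Bool) : Prop where
  tree : G.IsTree
  deg : ∀ x, (G.neighborSet x).encard ≤ 3
  port_deg : ∀ x, c x ≠ none → ∀ y z, G.Adj x y → G.Adj x z → y = z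
  port_far : ∀ p d, c p ≠ none → IsBranch G d → ∀ w : G.Walk d p, K ≤ w.length
  tight : Tight G K
  -- This supplies an attachment vertex so far from the treated vertex that the path between them
  -- has a vertex number `K + 1`.
  far : ∀ x k, ∃ p, c p = some k ∧ K + 1 ≤ G.dist x p
  -- A comb has only three branch vertices, so four of them prevent the tree from being mapped into
  -- a comb.
  four : ∃ f : Fin 4 → V, Injective f ∧ ∀ i, IsBranch G (f i)
  rigid : Rigid G
  countable : Countable V

theorem PortTree.finite {K : ℕ} {G : SimpleGraph V} {c : V → Option Bool} (h : PortTree K G c)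
    (x : V) : (G.neighborSet x).Finite :=
  Set.finite_of_encard_le_coe (k := 3) (h.deg x)

theorem PortTree.surjective {K : ℕ} {G : SimpleGraph V} {c : V → Option Bool} (h : PortTree K G c)
    {f : V → V} (hf : IsEmb f G G) : Surjective f := by
  have := h.rigid.surjOn h.tree.connected h.finite hf (Set.mapsTo_univ f _)
  exact Set.surjOn_univ.1 this

end General

/-! ### The gadgets and the recursive extension. -/

/-- Local positions in a gadget: a vertex of the comb, of the copy of `S` or of the copy of `T`. -/
inductive Loc (V W : Type) : Type
  | m (b : Bool) (i j : ℕ)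
  | s (y : W)
  | t (x : V)

/-- Addresses in the recursive extension of a base graph by gadgets; the last position is pushed
at the front. -/
inductive Word (B V W : Type) : Type
  | base (x : B)
  | push (g : Loc V W) (z : Word B V W)

/-- The data used to extend two trees `T` and `S` with ports. -/
structure Gadget (V W : Type) where
  T : SimpleGraph V
  c : V → Option Bool
  S : SimpleGraph W
  d : W → Option Bool
  a : V
  u : V
  v : V
  s : W
  K : ℕ
  L : ℕ

/-- Adjacency in the infinite comb on `ℕ × ℕ`. -/
def comb (i j i' j' : ℕ) : Prop :=
  (i = i' ∧ (j' = j + 1 ∨ j = j' + 1)) ∨ (j = 0 ∧ j' = 0 ∧ (i' = i + 1 ∨ i = i' + 1))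

namespace Gadget

variable {B V W : Type} (D : Gadget V W)

/-- `T` without the edge `uv`. -/
def cut : SimpleGraph V := D.T.deleteEdges {s(D.u, D.v)}

/-- The side of `a` after deleting the edge `uv`. -/
def side : Set V := {x | D.cut.Reachable D.a x}

/-- The length of the spine of the comb. -/
def N : ℕ := 2 * D.K + 10

/-- Both kinds use the same comb, with `s` at its end 0 and `a` at its end `N`. In the true kind the
copy of `S` hangs at the end 0 and the root is the end `N`; in the false kind the root is the end 0
and the cut copy of `T` hangs at the end `N` and at the tip of the short tooth. -/
def ladj : Loc V W → Loc V W → Prop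
  | .m b i j, .m b' i' j' => b = b' ∧ comb i j i' j'
  | .s y, .s y' => D.S.Adj y y'
  | .t x, .t x' => D.cut.Adj x x'
  | .m b i j, .s y => b = true ∧ i = 0 ∧ j = 0 ∧ y = D.s
  | .s y, .m b i j => b = true ∧ i = 0 ∧ j = 0 ∧ y = D.s
  | .m b i j, .t x =>
    b = false ∧ ((i = D.N ∧ j = 0 ∧ x = D.a) ∨ (i = D.K + 1 ∧ j = D.K + 1 ∧ x = D.v))
  | .t x, .m b i j =>
    b = false ∧ ((i = D.N ∧ j = 0 ∧ x = D.a) ∨ (i = D.K + 1 ∧ j = D.K + 1 ∧ x = D.v))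
  | .s _, .t _ => False
  | .t _, .s _ => False

/-- The position of the root of the comb of each kind. -/
def ri (D : Gadget V W) (b : Bool) : ℕ := if b then D.N else 0

def isRoot : Loc V W → Prop
  | .m b i j => j = 0 ∧ i = D.ri b
  | _ => False

def kind : Loc V W → Bool
  | .m b _ _ => b
  | .s _ => true
  | .t _ => false

open Classical in
/-- The colours of the positions at which further gadgets are attached. -/
noncomputable def lcol : Loc V W → Option Bool
  | .m _ _ _ => none
  | .s y => if y = D.s then none else D.d y
  | .t x => if x = D.a then none else D.c x

/-- The heights of the teeth. -/
def tooth (D : Gadget V W) (i : ℕ) : ℕ :=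
  if i = D.K + 1 then D.K + 1 else if i = D.K + 2 ∨ i = D.K + 3 then D.L else 0

def okL : Loc V W → Prop
  | .m _ i j => i ≤ D.N ∧ j ≤ D.tooth i
  | _ => True

/-- The colours of the new ports. -/
def ncol : Loc V W → Option Bool
  | .m _ i j => if j = D.L ∧ i = D.K + 2 then some true else
      if j = D.L ∧ i = D.K + 3 then some false else none
  | _ => none

variable (G : SimpleGraph B) (cB : B → Option Bool)

def wadj : Word B V W → Word B V W → Prop
  | .base x, .base y => G.Adj x y
  | .base x, .push g z => z = .base x ∧ D.isRoot g
  | .push g z, .base x => z = .base x ∧ D.isRoot g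
  | .push g z, .push g' z' => (z = z' ∧ D.ladj g g') ∨ (z' = .push g z ∧ D.isRoot g') ∨
      (z = .push g' z' ∧ D.isRoot g)

noncomputable def col : Word B V W → Option Bool
  | .base x => cB x
  | .push g _ => D.lcol g

/-- A gadget hangs only from a coloured position, whose colour is its kind. Since `lcol` is `none`
on the copies of `s` and `a`, nothing hangs from them. -/
def Valid : Word B V W → Prop
  | .base _ => True
  | .push g z => Valid z ∧ D.okL g ∧ D.col cB z = some (kind g)

/-- The vertices of the extension. -/
abbrev Vert : Type := {z : Word B V W // D.Valid cB z}

theorem comb_symm {i j i' j' : ℕ} : comb i j i' j' → comb i' j' i j := by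
  unfold comb; omega

theorem comb_irrefl {i j : ℕ} : ¬ comb i j i j := by
  unfold comb; omega

theorem ladj_symm : ∀ g g', D.ladj g g' → D.ladj g' g
  | .m _ _ _, .m _ _ _ => fun h => ⟨h.1.symm, comb_symm h.2⟩
  | .s _, .s _ => fun h => D.S.adj_symm h
  | .t _, .t _ => fun h => D.cut.adj_symm h
  | .m _ _ _, .s _ => id
  | .s _, .m _ _ _ => id
  | .m _ _ _, .t _ => id
  | .t _, .m _ _ _ => id
  | .s _, .t _ => id
  | .t _, .s _ => id

theorem ladj_irrefl : ∀ g, ¬ D.ladj g g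
  | .m _ _ _ => fun h => comb_irrefl h.2
  | .s _ => fun h => D.S.irrefl h
  | .t _ => fun h => D.cut.irrefl h

theorem wadj_symm : ∀ z z', D.wadj G z z' → D.wadj G z' z
  | .base _, .base _ => fun h => G.adj_symm h
  | .base _, .push _ _ => id
  | .push _ _, .base _ => id
  | .push _ _, .push _ _ => by
    rintro (⟨h, h'⟩ | h | h)
    · exact Or.inl ⟨h.symm, D.ladj_symm _ _ h'⟩
    · exact Or.inr (Or.inr h)
    · exact Or.inr (Or.inl h)

theorem push_ne (g : Loc V W) : ∀ z : Word B V W, Word.push g z ≠ z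
  | .base _ => by simp
  | .push g' z => by
    intro h
    injection h with h1 h2
    exact push_ne g' z h2

theorem wadj_irrefl : ∀ z, ¬ D.wadj G z z
  | .base _ => fun h => G.irrefl h
  | .push g z => by
    rintro (⟨_, h⟩ | h | h)
    · exact D.ladj_irrefl _ h
    · exact push_ne g z h.1.symm
    · exact push_ne g z h.1.symm

/-- The extension of the base graph `G` by gadgets. -/
def ext : SimpleGraph (D.Vert cB) where
  Adj z z' := D.wadj G z.1 z'.1
  symm := ⟨fun _ _ h => D.wadj_symm G _ _ h⟩
  loopless := ⟨fun _ h => D.wadj_irrefl G _ h⟩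

noncomputable def newCol (z : D.Vert cB) : Option Bool :=
  match z.1 with
  | .base _ => none
  | .push g _ => D.ncol g

def inl (x : B) : D.Vert cB := ⟨.base x, trivial⟩

variable {G cB}

theorem wadj_push {g : Loc V W} {z y : Word B V W} : D.wadj G (.push g z) y ↔
    (∃ g', y = .push g' z ∧ D.ladj g g') ∨ (y = z ∧ D.isRoot g) ∨
      (∃ g', D.isRoot g' ∧ y = .push g' (.push g z)) := by
  cases y with
  | base x => simp [wadj, eq_comm]
  | push g' z' =>
    simp only [wadj, Word.push.injEq]
    constructor
    · rintro (⟨rfl, h⟩ | ⟨rfl, h⟩ | ⟨rfl, h⟩)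
      · exact Or.inl ⟨_, ⟨rfl, rfl⟩, h⟩
      · exact Or.inr (Or.inr ⟨_, h, rfl, rfl⟩)
      · exact Or.inr (Or.inl ⟨rfl, h⟩)
    · rintro (⟨g'', ⟨rfl, rfl⟩, h⟩ | ⟨rfl, h⟩ | ⟨_, h, rfl, rfl⟩)
      · exact Or.inl ⟨rfl, h⟩
      · exact Or.inr (Or.inr ⟨rfl, h⟩)
      · exact Or.inr (Or.inl ⟨rfl, h⟩)

theorem wadj_base {x : B} {y : Word B V W} : D.wadj G (.base x) y ↔
    (∃ x', y = .base x' ∧ G.Adj x x') ∨ (∃ g', D.isRoot g' ∧ y = .push g' (.base x)) := by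
  cases y with
  | base x => simp [wadj]
  | push g' z' => simp [wadj, and_comm]

theorem isRoot_iff {g : Loc V W} : D.isRoot g ↔ g = .m (kind g) (D.ri (kind g)) 0 := by
  cases g with
  | m b i j => simp [isRoot, kind]; tauto
  | s y => simp [isRoot]
  | t x => simp [isRoot]

/-- A child of `z` that is a root is determined by the colour of `z`. -/
theorem eq_of_root {g : Loc V W} {z : Word B V W} {k : Bool} (hg : D.isRoot g)
    (hv : D.Valid cB (.push g z)) (hk : D.col cB z = some k) : g = .m k (D.ri k) 0 := by
  have h := hv.2.2
  rw [hk] at h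
  rw [D.isRoot_iff.1 hg, ← Option.some.inj h]

theorem isEmb_inl : IsEmb (D.inl cB) G (D.ext G cB) :=
  ⟨fun _ _ h => Word.base.inj (congrArg Subtype.val h), fun _ _ h => h⟩

/-- The hypotheses under which the gadgets are used; `π` is a path from `v` to `a`. -/
structure Ok (D : Gadget V W) (π : ℕ → V) (n : ℕ) : Prop where
  hT : PortTree D.K D.T D.c
  hS : PortTree D.K D.S D.d
  one_le : 1 ≤ D.K
  -- The form `2 * R + 1` required by `tight_of_dense`, with `R` the density radius of `dense`.
  hL : 2 * (2 * D.N + 2 * D.K + D.cut.dist D.u D.a + 2) + 1 ≤ D.L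
  ca : D.c D.a = some true
  ds : D.d D.s = some false
  hn : D.K + 1 ≤ n
  path_zero : π 0 = D.v
  path_one : π 1 = D.u
  path_n : π n = D.a
  path_dist : ∀ i ≤ n, D.T.dist D.v (π i) = i
  path_adj : ∀ i < n, D.T.Adj (π i) (π (i + 1))

variable {D} {π : ℕ → V} {n : ℕ}

/-! ### The two sides of the edge `uv`. -/

namespace Ok

theorem adj_uv (h : D.Ok π n) : D.T.Adj D.u D.v := by
  have := h.path_adj 0 (by have := h.hn; omega)
  rw [h.path_zero, zero_add, h.path_one] at this
  exact this.symm

theorem cut_adj_iff {x y : V} : D.cut.Adj x y ↔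
    D.T.Adj x y ∧ ¬ (x = D.u ∧ y = D.v) ∧ ¬ (x = D.v ∧ y = D.u) := by
  simp [cut, deleteEdges_adj]

theorem not_reachable_uv (h : D.Ok π n) : ¬ D.cut.Reachable D.u D.v := by
  have := isAcyclic_iff_forall_adj_isBridge.1 h.hT.tree.isAcyclic h.adj_uv
  exact (isBridge_iff.1 this)

theorem reachable_path (h : D.Ok π n) (i : ℕ) (hi : i + 1 ≤ n) :
    D.cut.Reachable D.u (π (i + 1)) := by
  induction i with
  | zero => rw [zero_add, h.path_one]
  | succ i ih =>
    refine (ih (by omega)).trans (Adj.reachable ?_)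
    have h1 := h.path_dist (i + 1) (by omega)
    have h2 := h.path_dist (i + 1 + 1) (by omega)
    refine cut_adj_iff.2 ⟨h.path_adj _ (by omega), ?_, ?_⟩
    · rintro ⟨-, he⟩
      rw [he] at h2
      simp at h2
    · rintro ⟨he, -⟩
      rw [he] at h1
      simp at h1

theorem path_mem_side (h : D.Ok π n) {i : ℕ} (hi : i + 1 ≤ n) : π (i + 1) ∈ D.side := by
  have h1 := h.reachable_path (n - 1) (by have := h.hn; omega)
  rw [Nat.sub_add_cancel (by have := h.hn; omega), h.path_n] at h1
  exact h1.symm.trans (h.reachable_path i hi)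

theorem u_mem (h : D.Ok π n) : D.u ∈ D.side := by
  have := h.path_mem_side (i := 0) (by have := h.hn; omega)
  rwa [zero_add, h.path_one] at this

theorem a_mem : D.a ∈ D.side := Reachable.refl _

theorem v_notMem (h : D.Ok π n) : D.v ∉ D.side := fun hv =>
  h.not_reachable_uv ((show D.cut.Reachable D.a D.u from h.u_mem).symm.trans hv)

theorem mem_side_iff {x y : V} (hxy : D.cut.Adj x y) : x ∈ D.side ↔ y ∈ D.side :=
  ⟨fun hx => Reachable.trans hx hxy.reachable, fun hy => Reachable.trans hy hxy.symm.reachable⟩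

theorem v_ne_a (h : D.Ok π n) : D.v ≠ D.a := fun e => h.v_notMem (e ▸ a_mem)

theorem cut_adj_of_ne {x y : V} (h : D.T.Adj x y) (hx : x ≠ D.v) (hy : y ≠ D.v) :
    D.cut.Adj x y :=
  cut_adj_iff.2 ⟨h, fun e => hy e.2, fun e => hx e.1⟩

end Ok

end Gadget

theorem PortTree.exists_nbr {V : Type*} {K : ℕ} {G : SimpleGraph V} {c : V → Option Bool}
    (h : PortTree K G c) {x : V} (hx : c x ≠ none) : ∃ p, ∀ y, G.Adj x y → y = p := by
  by_cases hp : ∃ p, G.Adj x p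
  · obtain ⟨p, hp⟩ := hp
    exact ⟨p, fun y hy => h.port_deg x hx _ _ hy hp⟩
  · exact ⟨x, fun y hy => (hp ⟨y, hy⟩).elim⟩

/-! ### Neighbourhoods, degrees and branch vertices in the extension. -/

namespace Gadget

variable {B V W : Type} {D : Gadget V W} {π : ℕ → V} {n : ℕ} {G : SimpleGraph B}
  {cB : B → Option Bool}

theorem adj_m {b : Bool} {i j : ℕ} {z y : Word B V W} (hy : D.Valid cB y)
    (h : D.wadj G (.push (.m b i j) z) y) :
    (∃ i' j', y = .push (.m b i' j') z ∧ comb i j i' j' ∧ i' ≤ D.N ∧ j' ≤ D.tooth i') ∨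
    (b = true ∧ i = 0 ∧ j = 0 ∧ y = .push (.s D.s) z) ∨
    (b = false ∧ i = D.N ∧ j = 0 ∧ y = .push (.t D.a) z) ∨
    (b = false ∧ i = D.K + 1 ∧ j = D.K + 1 ∧ y = .push (.t D.v) z) ∨
    (y = z ∧ j = 0 ∧ i = D.ri b) := by
  rcases D.wadj_push.1 h with ⟨g', rfl, hl⟩ | ⟨rfl, hr⟩ | ⟨g', hr, rfl⟩
  · cases g' with
    | m b' i' j' =>
      obtain ⟨rfl, hc⟩ := hl
      exact Or.inl ⟨i', j', rfl, hc, hy.2.1.1, hy.2.1.2⟩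
    | s y =>
      obtain ⟨h1, h2, h3, rfl⟩ := hl
      exact Or.inr (Or.inl ⟨h1, h2, h3, rfl⟩)
    | t x =>
      obtain ⟨h1, ⟨h2, h3, rfl⟩ | ⟨h2, h3, rfl⟩⟩ := hl
      · exact Or.inr (Or.inr (Or.inl ⟨h1, h2, h3, rfl⟩))
      · exact Or.inr (Or.inr (Or.inr (Or.inl ⟨h1, h2, h3, rfl⟩)))
  · exact Or.inr (Or.inr (Or.inr (Or.inr ⟨rfl, hr.1, hr.2⟩)))
  · have := hy.2.2
    simp [col, lcol] at this

theorem adj_s {q : W} {z y : Word B V W} (hy : D.Valid cB y)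
    (h : D.wadj G (.push (.s q) z) y) :
    (∃ q', y = .push (.s q') z ∧ D.S.Adj q q') ∨
    (q = D.s ∧ y = .push (.m true 0 0) z) ∨
    (q ≠ D.s ∧ ∃ k, D.d q = some k ∧ y = .push (.m k (D.ri k) 0) (.push (.s q) z)) := by
  rcases D.wadj_push.1 h with ⟨g', rfl, hl⟩ | ⟨rfl, hr⟩ | ⟨g', hr, rfl⟩
  · cases g' with
    | m b' i' j' =>
      obtain ⟨rfl, rfl, rfl, hq⟩ := hl
      exact Or.inr (Or.inl ⟨hq, rfl⟩)
    | s y => exact Or.inl ⟨y, rfl, hl⟩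
    | t x => exact hl.elim
  · exact hr.elim
  · have h1 := hy.2.2
    simp only [col, lcol] at h1
    split_ifs at h1 with hq
    refine Or.inr (Or.inr ⟨hq, _, h1,
      congrArg (Word.push · _) (D.eq_of_root hr hy hy.2.2)⟩)

theorem adj_t {x : V} {z y : Word B V W} (hy : D.Valid cB y)
    (h : D.wadj G (.push (.t x) z) y) :
    (∃ x', y = .push (.t x') z ∧ D.cut.Adj x x') ∨
    (x = D.a ∧ y = .push (.m false D.N 0) z) ∨
    (x = D.v ∧ y = .push (.m false (D.K + 1) (D.K + 1)) z) ∨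
    (x ≠ D.a ∧ ∃ k, D.c x = some k ∧ y = .push (.m k (D.ri k) 0) (.push (.t x) z)) := by
  rcases D.wadj_push.1 h with ⟨g', rfl, hl⟩ | ⟨rfl, hr⟩ | ⟨g', hr, rfl⟩
  · cases g' with
    | m b' i' j' =>
      obtain ⟨rfl, ⟨rfl, rfl, rfl⟩ | ⟨rfl, rfl, rfl⟩⟩ := hl
      · exact Or.inr (Or.inl ⟨rfl, rfl⟩)
      · exact Or.inr (Or.inr (Or.inl ⟨rfl, rfl⟩))
    | s y => exact hl.elim
    | t x => exact Or.inl ⟨x, rfl, hl⟩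
  · exact hr.elim
  · have h1 := hy.2.2
    simp only [col, lcol] at h1
    split_ifs at h1 with hq
    refine Or.inr (Or.inr (Or.inr ⟨hq, _, h1,
      congrArg (Word.push · _) (D.eq_of_root hr hy hy.2.2)⟩))

theorem adj_base {x : B} {y : Word B V W} (hy : D.Valid cB y)
    (h : D.wadj G (.base x) y) :
    (∃ x', y = .base x' ∧ G.Adj x x') ∨
    (∃ k, cB x = some k ∧ y = .push (.m k (D.ri k) 0) (.base x)) := by
  rcases D.wadj_base.1 h with h | ⟨g', hr, rfl⟩
  · exact Or.inl h
  · exact Or.inr ⟨_, hy.2.2, congrArg (Word.push · _) (D.eq_of_root hr hy hy.2.2)⟩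

theorem adj_m_spine {b : Bool} {i : ℕ} {z y : Word B V W} (hy : D.Valid cB y)
    (h : D.wadj G (.push (.m b i 0) z) y) (h0 : 0 < i) (hN : i < D.N) :
    y = .push (.m b (i - 1) 0) z ∨ y = .push (.m b (i + 1) 0) z ∨
    (y = .push (.m b i 1) z ∧ (i = D.K + 1 ∨ i = D.K + 2 ∨ i = D.K + 3)) := by
  rcases adj_m hy h with ⟨i', j', rfl, hc, h1, h2⟩ | h | h | h | h
  · rcases hc with ⟨rfl, h | h⟩ | ⟨-, rfl, rfl | rfl⟩
    · obtain rfl : j' = 1 := h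
      refine Or.inr (Or.inr ⟨rfl, ?_⟩)
      unfold tooth at h2
      split_ifs at h2 <;> omega
    · omega
    · exact Or.inr (Or.inl rfl)
    · exact Or.inl rfl
  · omega
  · omega
  · omega
  · have := h.2.2
    cases b <;> simp [ri] at this <;> omega

theorem adj_m_tooth {b : Bool} {i j : ℕ} {z y : Word B V W} (hy : D.Valid cB y)
    (h : D.wadj G (.push (.m b i j) z) y) (h0 : 0 < j) (hj : ¬ (i = D.K + 1 ∧ j = D.K + 1)) :
    y = .push (.m b i (j - 1)) z ∨ (y = .push (.m b i (j + 1)) z ∧ j + 1 ≤ D.tooth i) := by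
  rcases adj_m hy h with ⟨i', j', rfl, hc, h1, h2⟩ | h | h | h | h
  · rcases hc with ⟨rfl, rfl | rfl⟩ | h
    · exact Or.inr ⟨rfl, h2⟩
    · exact Or.inl rfl
    · omega
  all_goals omega

theorem adj_m_tip {b : Bool} {z y : Word B V W} (hy : D.Valid cB y)
    (h : D.wadj G (.push (.m b (D.K + 1) (D.K + 1)) z) y) :
    y = .push (.m b (D.K + 1) D.K) z ∨ (b = false ∧ y = .push (.t D.v) z) := by
  rcases adj_m hy h with ⟨i', j', rfl, hc, h1, h2⟩ | h | h | h | h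
  · rcases hc with ⟨rfl, rfl | h⟩ | h
    · simp [tooth] at h2
    · obtain rfl : j' = D.K := by omega
      exact Or.inl rfl
    · omega
  · omega
  · omega
  · exact Or.inr ⟨h.1, h.2.2.2⟩
  · omega

theorem adj_m_zero {b : Bool} {z y : Word B V W} (hy : D.Valid cB y)
    (h : D.wadj G (.push (.m b 0 0) z) y) :
    y = .push (.m b 1 0) z ∨ (b = true ∧ y = .push (.s D.s) z) ∨ (b = false ∧ y = z) := by
  rcases adj_m hy h with ⟨i', j', rfl, hc, h1, h2⟩ | h | h | h | h
  · rcases hc with ⟨rfl, rfl | h⟩ | ⟨-, rfl, rfl | h⟩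
    · simp [tooth] at h2
    · omega
    · exact Or.inl rfl
    · omega
  · exact Or.inr (Or.inl ⟨h.1, h.2.2.2⟩)
  · have := h.2.1; simp [N] at this
  · omega
  · have := h.2.2
    cases b
    · exact Or.inr (Or.inr ⟨rfl, h.1⟩)
    · simp [ri, N] at this

theorem adj_m_N {b : Bool} {z y : Word B V W} (hy : D.Valid cB y)
    (h : D.wadj G (.push (.m b D.N 0) z) y) :
    y = .push (.m b (D.N - 1) 0) z ∨ (b = false ∧ y = .push (.t D.a) z) ∨ (b = true ∧ y = z) := by
  rcases adj_m hy h with ⟨i', j', rfl, hc, h1, h2⟩ | h | h | h | h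
  · rcases hc with ⟨rfl, rfl | h⟩ | ⟨-, rfl, rfl | h⟩
    · unfold tooth at h2
      have : D.N = 2 * D.K + 10 := rfl
      split_ifs at h2 <;> omega
    · omega
    · omega
    · obtain rfl : i' = D.N - 1 := by omega
      exact Or.inl rfl
  · have := h.2.1; simp [N] at this
  · exact Or.inr (Or.inl ⟨h.1, h.2.2.2⟩)
  · omega
  · have := h.2.2
    cases b
    · simp [ri, N] at this
    · exact Or.inr (Or.inr ⟨rfl, h.1⟩)

namespace Ok

theorem encard_le_three (h : D.Ok π n) (hB : PortTree D.K G cB) (z : D.Vert cB) :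
    ((D.ext G cB).neighborSet z).encard ≤ 3 := by
  obtain ⟨z, hz⟩ := z
  cases z with
  | base x =>
    rcases hx : cB x with _ | k
    · obtain ⟨p, q, r, hpqr⟩ := exists_three_of_encard_le (hB.deg x)
      refine encard_neighborSet_le_three Subtype.val_injective (.base p) (.base q) (.base r) ?_
      rintro ⟨y, hy⟩ hadj
      rcases adj_base hy hadj with ⟨x', rfl, h'⟩ | ⟨k, h', -⟩
      · simpa using hpqr x' h'
      · simp [hx] at h'
    · obtain ⟨p, hp⟩ := hB.exists_nbr (x := x) (by simp [hx])
      refine encard_neighborSet_le_three Subtype.val_injective (.base p) (.base p)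
        (.push (.m k (D.ri k) 0) (.base x)) ?_
      rintro ⟨y, hy⟩ hadj
      rcases adj_base hy hadj with ⟨x', rfl, h'⟩ | ⟨k', h', rfl⟩
      · simp [hp x' h']
      · rw [hx] at h'
        obtain rfl := Option.some.inj h'
        simp
  | push g z =>
    cases g with
    | m b i j =>
      obtain ⟨-, ⟨hi, hj⟩, -⟩ := hz
      have hN : D.N = 2 * D.K + 10 := rfl
      by_cases hj0 : j = 0
      · subst hj0
        by_cases hi0 : i = 0
        · subst hi0
          refine encard_neighborSet_le_three Subtype.val_injective (.push (.m b 1 0) z)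
            (.push (.s D.s) z) z ?_
          rintro ⟨y, hy⟩ hadj
          have := adj_m_zero hy hadj
          tauto
        by_cases hiN : i = D.N
        · subst hiN
          refine encard_neighborSet_le_three Subtype.val_injective (.push (.m b (D.N - 1) 0) z)
            (.push (.t D.a) z) z ?_
          rintro ⟨y, hy⟩ hadj
          have := adj_m_N hy hadj
          tauto
        refine encard_neighborSet_le_three Subtype.val_injective (.push (.m b (i - 1) 0) z)
            (.push (.m b (i + 1) 0) z) (.push (.m b i 1) z) ?_
        rintro ⟨y, hy⟩ hadj
        have := adj_m_spine hy hadj (by omega) (by omega)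
        tauto
      by_cases htip : i = D.K + 1 ∧ j = D.K + 1
      · obtain ⟨rfl, rfl⟩ := htip
        refine encard_neighborSet_le_three Subtype.val_injective (.push (.m b (D.K + 1) D.K) z)
            (.push (.t D.v) z) (.push (.t D.v) z) ?_
        rintro ⟨y, hy⟩ hadj
        have := adj_m_tip hy hadj
        tauto
      refine encard_neighborSet_le_three Subtype.val_injective (.push (.m b i (j - 1)) z)
            (.push (.m b i (j + 1)) z) z ?_
      rintro ⟨y, hy⟩ hadj
      have := adj_m_tooth hy hadj (by omega) htip
      tauto
    | s q =>
      rcases hq : D.d q with _ | k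
      · obtain ⟨p₁, p₂, p₃, hp⟩ := exists_three_of_encard_le (h.hS.deg q)
        refine encard_neighborSet_le_three Subtype.val_injective (.push (.s p₁) z)
          (.push (.s p₂) z) (.push (.s p₃) z) ?_
        rintro ⟨y, hy⟩ hadj
        rcases adj_s hy hadj with ⟨x', rfl, h'⟩ | ⟨rfl, h'⟩ | ⟨-, k, h', -⟩
        · simpa using hp x' h'
        · simp [h.ds] at hq
        · simp [hq] at h'
      · obtain ⟨p, hp⟩ := h.hS.exists_nbr (x := q) (by simp [hq])
        refine encard_neighborSet_le_three Subtype.val_injective (.push (.s p) z)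
          (.push (.m true 0 0) z) (.push (.m k (D.ri k) 0) (.push (.s q) z)) ?_
        rintro ⟨y, hy⟩ hadj
        rcases adj_s hy hadj with ⟨x', rfl, h'⟩ | ⟨rfl, rfl⟩ | ⟨-, k', h', rfl⟩
        · simp [hp x' h']
        · simp
        · rw [hq] at h'
          obtain rfl := Option.some.inj h'
          simp
    | t x =>
      by_cases hxv : x = D.v
      · subst hxv
        rcases hx : D.c D.v with _ | k
        · obtain ⟨p₁, p₂, p₃, hp⟩ := exists_three_of_encard_le (h.hT.deg D.v)
          have hu := hp D.u h.adj_uv.symm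
          -- Removing `uv` frees one of the three places at `v` for the edge to the tooth tip.
          have key : ∃ q₁ q₂, ∀ y, D.cut.Adj D.v y → y = q₁ ∨ y = q₂ := by
            have h' : ∀ y, D.cut.Adj D.v y → (y = p₁ ∨ y = p₂ ∨ y = p₃) ∧ y ≠ D.u := fun y hy =>
              ⟨hp y (cut_adj_iff.1 hy).1, fun e => (cut_adj_iff.1 hy).2.2 ⟨rfl, e⟩⟩
            rcases hu with hu | hu | hu
            · exact ⟨p₂, p₃, fun y hy => by have := h' y hy; rw [hu] at this; tauto⟩
            · exact ⟨p₁, p₃, fun y hy => by have := h' y hy; rw [hu] at this; tauto⟩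
            · exact ⟨p₁, p₂, fun y hy => by have := h' y hy; rw [hu] at this; tauto⟩
          obtain ⟨q₁, q₂, hq⟩ := key
          refine encard_neighborSet_le_three Subtype.val_injective (.push (.t q₁) z)
            (.push (.t q₂) z) (.push (.m false (D.K + 1) (D.K + 1)) z) ?_
          rintro ⟨y, hy⟩ hadj
          rcases adj_t hy hadj with ⟨x', rfl, h'⟩ | ⟨h', -⟩ | ⟨-, rfl⟩ | ⟨-, k, h', -⟩
          · rcases hq x' h' with rfl | rfl <;> simp
          · exact (h.v_ne_a h').elim
          · simp
          · simp [hx] at h'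
        · refine encard_neighborSet_le_three Subtype.val_injective
            (.push (.m k (D.ri k) 0) (.push (.t D.v) z)) (.push (.m false (D.K + 1) (D.K + 1)) z)
            (.push (.m false (D.K + 1) (D.K + 1)) z) ?_
          rintro ⟨y, hy⟩ hadj
          rcases adj_t hy hadj with ⟨x', rfl, h'⟩ | ⟨h', -⟩ | ⟨-, rfl⟩ | ⟨-, k', h', rfl⟩
          · obtain ⟨h1, h2, h3⟩ := cut_adj_iff.1 h'
            exact (h3 ⟨rfl, h.hT.port_deg D.v (by simp [hx]) _ _ h1 h.adj_uv.symm⟩).elim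
          · exact (h.v_ne_a h').elim
          · simp
          · rw [hx] at h'
            obtain rfl := Option.some.inj h'
            simp
      · rcases hx : D.c x with _ | k
        · obtain ⟨p₁, p₂, p₃, hp⟩ := exists_three_of_encard_le (h.hT.deg x)
          refine encard_neighborSet_le_three Subtype.val_injective (.push (.t p₁) z)
            (.push (.t p₂) z) (.push (.t p₃) z) ?_
          rintro ⟨y, hy⟩ hadj
          rcases adj_t hy hadj with ⟨x', rfl, h'⟩ | ⟨rfl, h'⟩ | ⟨h', -⟩ | ⟨-, k, h', -⟩
          · simpa using hp x' (cut_adj_iff.1 h').1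
          · simp [h.ca] at hx
          · exact (hxv h').elim
          · simp [hx] at h'
        · obtain ⟨p, hp⟩ := h.hT.exists_nbr (x := x) (by simp [hx])
          refine encard_neighborSet_le_three Subtype.val_injective (.push (.t p) z)
            (.push (.m false D.N 0) z) (.push (.m k (D.ri k) 0) (.push (.t x) z)) ?_
          rintro ⟨y, hy⟩ hadj
          rcases adj_t hy hadj with ⟨x', rfl, h'⟩ | ⟨rfl, rfl⟩ | ⟨h', -⟩ | ⟨-, k', h', rfl⟩
          · simp [hp x' (cut_adj_iff.1 h').1]
          · simp
          · exact (hxv h').elim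
          · rw [hx] at h'
            obtain rfl := Option.some.inj h'
            simp

/-- Only the feet of the three teeth have three neighbours: each end of the spine has one spine
neighbour and one glued neighbour. -/
theorem isBranch_m {b : Bool} {i j : ℕ} {z : Word B V W}
    {hz : D.Valid cB (.push (.m b i j) z)} (hbr : IsBranch (D.ext G cB) ⟨_, hz⟩) :
    j = 0 ∧ (i = D.K + 1 ∨ i = D.K + 2 ∨ i = D.K + 3) := by
  by_contra hcon
  revert hbr
  have hN : D.N = 2 * D.K + 10 := rfl
  obtain ⟨-, ⟨hi, hj⟩, -⟩ := hz
  by_cases hj0 : j = 0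
  · subst hj0
    by_cases hi0 : i = 0
    · subst hi0
      cases b
      · refine not_isBranch Subtype.val_injective (.push (.m false 1 0) z) z ?_
        rintro ⟨y, hy⟩ hadj
        have := adj_m_zero hy hadj
        simpa using this
      · refine not_isBranch Subtype.val_injective (.push (.m true 1 0) z) (.push (.s D.s) z) ?_
        rintro ⟨y, hy⟩ hadj
        have := adj_m_zero hy hadj
        simpa using this
    by_cases hiN : i = D.N
    · subst hiN
      cases b
      · refine not_isBranch Subtype.val_injective (.push (.m false (D.N - 1) 0) z)
          (.push (.t D.a) z) ?_
        rintro ⟨y, hy⟩ hadj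
        have := adj_m_N hy hadj
        simpa using this
      · refine not_isBranch Subtype.val_injective (.push (.m true (D.N - 1) 0) z) z ?_
        rintro ⟨y, hy⟩ hadj
        have := adj_m_N hy hadj
        simpa using this
    refine not_isBranch Subtype.val_injective (.push (.m b (i - 1) 0) z)
        (.push (.m b (i + 1) 0) z) ?_
    rintro ⟨y, hy⟩ hadj
    have := adj_m_spine hy hadj (by omega) (by omega)
    tauto
  by_cases htip : i = D.K + 1 ∧ j = D.K + 1
  · obtain ⟨rfl, rfl⟩ := htip
    refine not_isBranch Subtype.val_injective (.push (.m b (D.K + 1) D.K) z)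
        (.push (.t D.v) z) ?_
    rintro ⟨y, hy⟩ hadj
    have := adj_m_tip hy hadj
    tauto
  refine not_isBranch Subtype.val_injective (.push (.m b i (j - 1)) z)
        (.push (.m b i (j + 1)) z) ?_
  rintro ⟨y, hy⟩ hadj
  have := adj_m_tooth hy hadj (by omega) htip
  tauto

/-- A port has degree at most two after gluing, so the base acquires no new branch vertices. -/
theorem isBranch_base (hB : PortTree D.K G cB) {x : B}
    {hz : D.Valid cB (.base x)} (hbr : IsBranch (D.ext G cB) ⟨_, hz⟩) :
    cB x = none ∧ IsBranch G x := by
  rcases hx : cB x with _ | k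
  · refine ⟨rfl, ?_⟩
    have key : ∀ y : D.Vert cB, (D.ext G cB).Adj ⟨_, hz⟩ y → ∃ x', y = D.inl cB x' ∧ G.Adj x x' := by
      rintro ⟨y, hy⟩ hadj
      rcases adj_base hy hadj with ⟨x', rfl, h'⟩ | ⟨k, h', -⟩
      · exact ⟨x', rfl, h'⟩
      · simp [hx] at h'
    obtain ⟨p, q, r, h1, h2, h3, h4, h5, h6⟩ := hbr
    obtain ⟨p, rfl, hp⟩ := key p h4
    obtain ⟨q, rfl, hq⟩ := key q h5
    obtain ⟨r, rfl, hr⟩ := key r h6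
    exact ⟨p, q, r, fun e => h1 (e ▸ rfl), fun e => h2 (e ▸ rfl), fun e => h3 (e ▸ rfl), hp, hq, hr⟩
  · exfalso
    revert hbr
    obtain ⟨p, hp⟩ := hB.exists_nbr (x := x) (by simp [hx])
    refine not_isBranch Subtype.val_injective (.base p) (.push (.m k (D.ri k) 0) (.base x)) ?_
    rintro ⟨y, hy⟩ hadj
    rcases adj_base hy hadj with ⟨x', rfl, h'⟩ | ⟨k', h', rfl⟩
    · simp [hp x' h']
    · rw [hx] at h'
      obtain rfl := Option.some.inj h'
      simp

theorem isBranch_s (h : D.Ok π n) {q : W} {z : Word B V W}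
    {hz : D.Valid cB (.push (.s q) z)} (hbr : IsBranch (D.ext G cB) ⟨_, hz⟩) :
    IsBranch D.S q := by
  rcases hq : D.d q with _ | k
  · have key : ∀ y : D.Vert cB, (D.ext G cB).Adj ⟨_, hz⟩ y →
        ∃ x', y.1 = .push (.s x') z ∧ D.S.Adj q x' := by
      rintro ⟨y, hy⟩ hadj
      rcases adj_s hy hadj with ⟨x', rfl, h'⟩ | ⟨rfl, h'⟩ | ⟨-, k, h', -⟩
      · exact ⟨x', rfl, h'⟩
      · simp [h.ds] at hq
      · simp [hq] at h'
    obtain ⟨p₁, p₂, p₃, h1, h2, h3, h4, h5, h6⟩ := hbr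
    obtain ⟨q₁, e₁, hq₁⟩ := key _ h4
    obtain ⟨q₂, e₂, hq₂⟩ := key _ h5
    obtain ⟨q₃, e₃, hq₃⟩ := key _ h6
    exact ⟨q₁, q₂, q₃, fun e => h1 (Subtype.ext (by rw [e₁, e₂, e])),
      fun e => h2 (Subtype.ext (by rw [e₁, e₃, e])), fun e => h3 (Subtype.ext (by rw [e₂, e₃, e])),
      hq₁, hq₂, hq₃⟩
  · exfalso
    revert hbr
    obtain ⟨p, hp⟩ := h.hS.exists_nbr (x := q) (by simp [hq])
    by_cases hqs : q = D.s
    · refine not_isBranch Subtype.val_injective (.push (.s p) z) (.push (.m true 0 0) z) ?_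
      rintro ⟨y, hy⟩ hadj
      rcases adj_s hy hadj with ⟨x', rfl, h'⟩ | ⟨rfl, rfl⟩ | ⟨h', -⟩
      · simp [hp x' h']
      · simp
      · exact (h' hqs).elim
    · refine not_isBranch Subtype.val_injective (.push (.s p) z)
        (.push (.m k (D.ri k) 0) (.push (.s q) z)) ?_
      rintro ⟨y, hy⟩ hadj
      rcases adj_s hy hadj with ⟨x', rfl, h'⟩ | ⟨rfl, rfl⟩ | ⟨-, k', h', rfl⟩
      · simp [hp x' h']
      · exact (hqs rfl).elim
      · rw [hq] at h'
        obtain rfl := Option.some.inj h'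
        simp

theorem isBranch_t (h : D.Ok π n) {x : V} {z : Word B V W}
    {hz : D.Valid cB (.push (.t x) z)} (hbr : IsBranch (D.ext G cB) ⟨_, hz⟩) :
    IsBranch D.T x := by
  classical
  rcases hx : D.c x with _ | k
  · -- map the neighbour on the comb to `u`
    let φ : D.Vert cB → V := fun y => match y.1 with
      | .push (.t x') _ => x'
      | _ => D.u
    have key : ∀ y : D.Vert cB, (D.ext G cB).Adj ⟨_, hz⟩ y →
        (∃ x', y.1 = .push (.t x') z ∧ D.cut.Adj x x') ∨
          (x = D.v ∧ y.1 = .push (.m false (D.K + 1) (D.K + 1)) z) := by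
      rintro ⟨y, hy⟩ hadj
      rcases adj_t hy hadj with ⟨x', rfl, h'⟩ | ⟨rfl, h'⟩ | h' | ⟨-, k, h', -⟩
      · exact Or.inl ⟨x', rfl, h'⟩
      · simp [h.ca] at hx
      · exact Or.inr h'
      · simp [hx] at h'
    have hadj : ∀ y : D.Vert cB, (D.ext G cB).Adj ⟨_, hz⟩ y → D.T.Adj x (φ y) := by
      intro y hy
      rcases key y hy with ⟨x', e, h'⟩ | ⟨rfl, e⟩
      · simp only [φ, e]
        exact (cut_adj_iff.1 h').1
      · simp only [φ, e]
        exact h.adj_uv.symm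
    have hinj : ∀ y y' : D.Vert cB, (D.ext G cB).Adj ⟨_, hz⟩ y → (D.ext G cB).Adj ⟨_, hz⟩ y' →
        y ≠ y' → φ y ≠ φ y' := by
      intro y y' hy hy' hne he
      apply hne
      apply Subtype.ext
      rcases key y hy with ⟨x₁, e₁, h₁⟩ | ⟨h₁, e₁⟩ <;>
        rcases key y' hy' with ⟨x₂, e₂, h₂⟩ | ⟨h₂, e₂⟩ <;>
        simp only [φ, e₁, e₂] at he ⊢
      · rw [he]
      · subst h₂
        exact ((cut_adj_iff.1 h₁).2.2 ⟨rfl, he⟩).elim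
      · subst h₁
        exact ((cut_adj_iff.1 h₂).2.2 ⟨rfl, he.symm⟩).elim
    obtain ⟨p₁, p₂, p₃, h1, h2, h3, h4, h5, h6⟩ := hbr
    exact ⟨φ p₁, φ p₂, φ p₃, hinj _ _ h4 h5 h1, hinj _ _ h4 h6 h2, hinj _ _ h5 h6 h3, hadj _ h4,
      hadj _ h5, hadj _ h6⟩
  · exfalso
    revert hbr
    obtain ⟨p, hp⟩ := h.hT.exists_nbr (x := x) (by simp [hx])
    by_cases hxa : x = D.a
    · refine not_isBranch Subtype.val_injective (.push (.t p) z) (.push (.m false D.N 0) z) ?_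
      rintro ⟨y, hy⟩ hadj
      rcases adj_t hy hadj with ⟨x', rfl, h'⟩ | ⟨rfl, rfl⟩ | ⟨rfl, h'⟩ | ⟨h', -⟩
      · simp [hp x' (cut_adj_iff.1 h').1]
      · simp
      · exact (h.v_ne_a hxa).elim
      · exact (h' hxa).elim
    by_cases hxv : x = D.v
    · refine not_isBranch Subtype.val_injective (.push (.m false (D.K + 1) (D.K + 1)) z)
        (.push (.m k (D.ri k) 0) (.push (.t x) z)) ?_
      rintro ⟨y, hy⟩ hadj
      rcases adj_t hy hadj with ⟨x', rfl, h'⟩ | ⟨h', -⟩ | ⟨-, rfl⟩ | ⟨-, k', h', rfl⟩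
      · obtain ⟨h1, h2, h3⟩ := cut_adj_iff.1 h'
        refine (h3 ⟨hxv, h.hT.port_deg x (by simp [hx]) _ _ h1 ?_⟩).elim
        rw [hxv]
        exact h.adj_uv.symm
      · exact (hxa h').elim
      · simp
      · rw [hx] at h'
        obtain rfl := Option.some.inj h'
        simp
    · refine not_isBranch Subtype.val_injective (.push (.t p) z)
        (.push (.m k (D.ri k) 0) (.push (.t x) z)) ?_
      rintro ⟨y, hy⟩ hadj
      rcases adj_t hy hadj with ⟨x', rfl, h'⟩ | ⟨h', -⟩ | ⟨h', -⟩ | ⟨-, k', h', rfl⟩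
      · simp [hp x' (cut_adj_iff.1 h').1]
      · exact (hxa h').elim
      · exact (hxv h').elim
      · rw [hx] at h'
        obtain rfl := Option.some.inj h'
        simp

end Ok

end Gadget

/-! ### The extension is a tree. -/

namespace Gadget

variable {B V W : Type} {D : Gadget V W} {π : ℕ → V} {n : ℕ} {G : SimpleGraph B}
  {cB : B → Option Bool}

open Classical in
/-- The distance of a local position from the root of its gadget. -/
noncomputable def lheight (D : Gadget V W) : Loc V W → ℕ
  | .m b i j => (if b then D.N - i else i) + j
  | .s y => D.N + 1 + D.S.dist D.s y
  -- The root is at distance `N + 1` from `a`, along the spine and one edge. It is at distance `2 *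
  -- K + 3` from `v`: `K + 1` steps on the spine, `K + 1` up the tooth, and one edge.
  | .t x => if x ∈ D.side then D.N + 1 + D.T.dist D.a x else 2 * D.K + 3 + D.T.dist D.v x

noncomputable def height (D : Gadget V W) (G : SimpleGraph B) (o : B) : Word B V W → ℕ
  | .base x => G.dist o x
  | .push g z => height D G o z + 1 + D.lheight g

namespace Ok

/-- Hence a step towards `a` inside its side never crosses from `u` to `v`. -/
theorem dist_u_lt (h : D.Ok π n) : D.T.dist D.a D.u < D.T.dist D.a D.v := by
  have key : ∀ k, k + 1 ≤ n → D.T.dist D.a (π (n - k)) ≤ k := by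
    intro k
    induction k with
    | zero => intro _; simp [h.path_n]
    | succ k ih =>
      intro hk
      have h1 := h.path_adj (n - (k + 1)) (by omega)
      rw [show n - (k + 1) + 1 = n - k by omega] at h1
      have h2 := h.hT.tree.connected.dist_triangle (u := D.a) (v := π (n - k))
        (w := π (n - (k + 1)))
      rw [dist_eq_one_iff_adj.2 h1.symm] at h2
      have := ih (by omega)
      omega
  have hn := h.hn
  have h1 := key (n - 1) (by omega)
  rw [show n - (n - 1) = 1 by omega, h.path_one] at h1
  have h2 := h.path_dist n le_rfl
  rw [h.path_n, dist_comm] at h2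
  omega

theorem lheight_t_in {x : V} (hx : x ∈ D.side) :
    D.lheight (.t x) = D.N + 1 + D.T.dist D.a x := by simp [lheight, hx]

theorem lheight_t_out {x : V} (hx : x ∉ D.side) :
    D.lheight (.t x) = 2 * D.K + 3 + D.T.dist D.v x := by simp [lheight, hx]

theorem lheight_m {b : Bool} {i j : ℕ} :
    D.lheight (.m b i j) = (if b then D.N - i else i) + j := rfl

theorem lheight_t_a : D.lheight (.t D.a) = D.N + 1 := by
  rw [lheight_t_in a_mem, SimpleGraph.dist_self]

theorem lheight_t_v (h : D.Ok π n) : D.lheight (.t D.v) = 2 * D.K + 3 := by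
  rw [lheight_t_out h.v_notMem, SimpleGraph.dist_self]

theorem lheight_s : D.lheight (.s D.s : Loc V W) = D.N + 1 := by
  simp [lheight]

theorem lower_t (h : D.Ok π n) {x y y' : V} (hy : D.cut.Adj x y) (hy' : D.cut.Adj x y')
    (hl : D.lheight (.t y) ≤ D.lheight (.t x)) (hl' : D.lheight (.t y') ≤ D.lheight (.t x)) :
    y = y' := by
  by_cases hx : x ∈ D.side
  · rw [lheight_t_in hx, lheight_t_in ((mem_side_iff hy).1 hx)] at hl
    rw [lheight_t_in hx, lheight_t_in ((mem_side_iff hy').1 hx)] at hl'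
    exact eq_of_adj_of_dist_le h.hT.tree (cut_adj_iff.1 hy).1 (cut_adj_iff.1 hy').1
      (r := D.a) (by omega) (by omega)
  · rw [lheight_t_out hx, lheight_t_out (fun e => hx ((mem_side_iff hy).2 e))] at hl
    rw [lheight_t_out hx, lheight_t_out (fun e => hx ((mem_side_iff hy').2 e))] at hl'
    exact eq_of_adj_of_dist_le h.hT.tree (cut_adj_iff.1 hy).1 (cut_adj_iff.1 hy').1
      (r := D.v) (by omega) (by omega)

theorem lheight_lt_of_cut_a {y : V} (hy : D.cut.Adj D.a y) :
    D.lheight (.t D.a) < D.lheight (.t y) := by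
  rw [lheight_t_a, lheight_t_in ((mem_side_iff hy).1 a_mem)]
  have := dist_eq_one_iff_adj.2 (cut_adj_iff.1 hy).1
  omega

theorem lheight_lt_of_cut_v (h : D.Ok π n) {y : V} (hy : D.cut.Adj D.v y) :
    D.lheight (.t D.v) < D.lheight (.t y) := by
  rw [h.lheight_t_v, lheight_t_out (fun e => h.v_notMem ((mem_side_iff hy).2 e))]
  have := dist_eq_one_iff_adj.2 (cut_adj_iff.1 hy).1
  omega

/-- The acyclicity half of the height criterion inside one gadget; `exists_lower` is the
connectivity half. -/
theorem lower_unique (h : D.Ok π n) {g g₁ g₂ : Loc V W} (h₁ : D.ladj g g₁) (h₂ : D.ladj g g₂)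
    (ho : D.okL g) (ho₁ : D.okL g₁) (ho₂ : D.okL g₂) (hl₁ : D.lheight g₁ ≤ D.lheight g)
    (hl₂ : D.lheight g₂ ≤ D.lheight g) : g₁ = g₂ := by
  have hN : D.N = 2 * D.K + 10 := rfl
  have hs := lheight_s (D := D)
  have ha := lheight_t_a (D := D)
  have hv := h.lheight_t_v
  cases g with
  | m b i j =>
    have key : ∀ g', D.ladj (.m b i j) g' → D.okL g' → D.lheight g' ≤ D.lheight (.m b i j) →
        g' = if j = 0 then .m b (if b then i + 1 else i - 1) 0 else .m b i (j - 1) := by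
      intro g' hadj ho' hl
      cases g' with
      | m b' i' j' =>
        obtain ⟨rfl, hc⟩ := hadj
        simp only [lheight_m] at hl
        obtain ⟨ho1, -⟩ := ho
        obtain ⟨ho2, -⟩ := ho'
        unfold comb at hc
        cases b <;> simp only [if_true, if_false, Bool.false_eq_true] at hl ⊢ <;>
          split_ifs <;> simp only [Loc.m.injEq, true_and] <;> omega
      | s y =>
        obtain ⟨rfl, rfl, rfl, rfl⟩ := hadj
        rw [hs, lheight_m] at hl
        simp at hl
      | t x =>
        obtain ⟨rfl, ⟨rfl, rfl, rfl⟩ | ⟨rfl, rfl, rfl⟩⟩ := hadj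
        · rw [ha, lheight_m] at hl
          simp at hl
        · rw [hv, lheight_m] at hl
          simp at hl
          omega
    rw [key g₁ h₁ ho₁ hl₁, key g₂ h₂ ho₂ hl₂]
  | s q =>
    have key : ∀ q', D.S.Adj D.s q' → ¬ D.lheight (.s q' : Loc V W) ≤ D.lheight (.s D.s) := by
      intro q' hq hl
      simp only [lheight, SimpleGraph.dist_self] at hl
      rw [dist_eq_one_iff_adj.2 hq] at hl
      omega
    cases g₁ with
    | m b₁ i₁ j₁ =>
      obtain ⟨rfl, rfl, rfl, rfl⟩ := h₁
      cases g₂ with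
      | m b₂ i₂ j₂ =>
        obtain ⟨rfl, rfl, rfl, -⟩ := h₂
        rfl
      | s q₂ => exact (key _ h₂ hl₂).elim
      | t x => exact h₂.elim
    | s q₁ =>
      cases g₂ with
      | m b₂ i₂ j₂ =>
        obtain ⟨rfl, rfl, rfl, rfl⟩ := h₂
        exact (key _ h₁ hl₁).elim
      | s q₂ =>
        simp only [lheight] at hl₁ hl₂
        rw [eq_of_adj_of_dist_le h.hS.tree h₁ h₂ (r := D.s) (by omega) (by omega)]
      | t x => exact h₂.elim
    | t x => exact h₁.elim
  | t x =>
    have key : ∀ x', D.cut.Adj x x' → D.lheight (.t x') ≤ D.lheight (.t x) → x ≠ D.a ∧ x ≠ D.v := by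
      intro x' hx' hl
      constructor
      · rintro rfl
        exact absurd (lheight_lt_of_cut_a hx') (by omega)
      · rintro rfl
        exact absurd (h.lheight_lt_of_cut_v hx') (by omega)
    cases g₁ with
    | m b₁ i₁ j₁ =>
      obtain ⟨rfl, hx₁⟩ := h₁
      cases g₂ with
      | m b₂ i₂ j₂ =>
        obtain ⟨rfl, hx₂⟩ := h₂
        have := h.v_ne_a
        obtain ⟨rfl, rfl, rfl⟩ | ⟨rfl, rfl, rfl⟩ := hx₁ <;>
          obtain ⟨rfl, rfl, e⟩ | ⟨rfl, rfl, e⟩ := hx₂ <;> first | rfl | (exfalso; tauto)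
      | s q₂ => exact h₂.elim
      | t x₂ =>
        have := key x₂ h₂ hl₂
        tauto
    | s q₁ => exact h₁.elim
    | t x₁ =>
      cases g₂ with
      | m b₂ i₂ j₂ =>
        obtain ⟨rfl, hx₂⟩ := h₂
        have := key x₁ h₁ hl₁
        tauto
      | s q₂ => exact h₂.elim
      | t x₂ => rw [h.lower_t h₁ h₂ hl₁ hl₂]

theorem lheight_root {g : Loc V W} (hg : D.isRoot g) : D.lheight g = 0 := by
  rw [D.isRoot_iff.1 hg, lheight_m]
  cases kind g <;> simp [ri]

theorem lheight_pos_of_root {g g' : Loc V W} (hg : D.isRoot g) (hadj : D.ladj g g')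
    (ho : D.okL g') : 0 < D.lheight g' := by
  have hN : D.N = 2 * D.K + 10 := rfl
  rw [D.isRoot_iff.1 hg] at hadj
  cases g' with
  | m b i j =>
    obtain ⟨rfl, hc⟩ := hadj
    obtain ⟨ho, -⟩ := ho
    rw [lheight_m]
    unfold comb at hc
    cases hk : kind g <;> simp only [hk, ri, if_true, if_false, Bool.false_eq_true] at hc ⊢ <;>
      omega
  | s q => simp only [lheight]; omega
  | t x =>
    by_cases hx : x ∈ D.side
    · rw [lheight_t_in hx]; omega
    · rw [lheight_t_out hx]; omega

theorem exists_lower (h : D.Ok π n) {g : Loc V W} (hg : ¬ D.isRoot g) (ho : D.okL g) :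
    ∃ g', D.ladj g g' ∧ D.okL g' ∧ kind g' = kind g ∧ D.lheight g' < D.lheight g := by
  have hN : D.N = 2 * D.K + 10 := rfl
  cases g with
  | m b i j =>
    obtain ⟨ho1, ho2⟩ := ho
    by_cases hj : j = 0
    · subst hj
      cases b
      · have hi : i ≠ 0 := fun e => hg ⟨rfl, by simp [ri, e]⟩
        refine ⟨.m false (i - 1) 0, ⟨rfl, ?_⟩, ⟨by omega, Nat.zero_le _⟩, rfl, ?_⟩
        · unfold comb; omega
        · simp [lheight_m]; omega
      · have hi : i ≠ D.N := fun e => hg ⟨rfl, by simp [ri, e]⟩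
        refine ⟨.m true (i + 1) 0, ⟨rfl, ?_⟩, ⟨by omega, Nat.zero_le _⟩, rfl, ?_⟩
        · unfold comb; omega
        · simp [lheight_m]; omega
    · refine ⟨.m b i (j - 1), ⟨rfl, ?_⟩, ⟨ho1, by omega⟩, rfl, ?_⟩
      · unfold comb; omega
      · simp only [lheight_m]; omega
  | s q =>
    by_cases hq : q = D.s
    · subst hq
      refine ⟨.m true 0 0, ⟨rfl, rfl, rfl, rfl⟩, ⟨Nat.zero_le _, Nat.zero_le _⟩, rfl, ?_⟩
      rw [lheight_s, lheight_m]; simp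
    · obtain ⟨y, hy, hlt⟩ := exists_adj_dist_lt h.hS.tree.connected hq
      refine ⟨.s y, hy, trivial, rfl, ?_⟩
      simp only [lheight]; omega
  | t x =>
    by_cases hx : x ∈ D.side
    · by_cases hxa : x = D.a
      · subst hxa
        refine ⟨.m false D.N 0, ⟨rfl, Or.inl ⟨rfl, rfl, rfl⟩⟩, ⟨le_rfl, Nat.zero_le _⟩, rfl, ?_⟩
        rw [lheight_t_a, lheight_m]; simp
      · obtain ⟨y, hy, hlt⟩ := exists_adj_dist_lt h.hT.tree.connected hxa
        have hcut : D.cut.Adj x y := by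
          refine cut_adj_iff.2 ⟨hy, ?_, ?_⟩
          · rintro ⟨rfl, rfl⟩
            exact absurd h.dist_u_lt (by omega)
          · rintro ⟨rfl, -⟩
            exact h.v_notMem hx
        refine ⟨.t y, hcut, trivial, rfl, ?_⟩
        rw [lheight_t_in hx, lheight_t_in ((mem_side_iff hcut).1 hx)]
        omega
    · by_cases hxv : x = D.v
      · subst hxv
        refine ⟨.m false (D.K + 1) (D.K + 1), ⟨rfl, Or.inr ⟨rfl, rfl, rfl⟩⟩,
          ⟨by omega, by simp [tooth]⟩, rfl, ?_⟩
        rw [h.lheight_t_v, lheight_m]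
        simp only [Bool.false_eq_true, if_false]; omega
      · obtain ⟨y, hy, hlt⟩ := exists_adj_dist_lt h.hT.tree.connected hxv
        have hcut : D.cut.Adj x y :=
          cut_adj_iff.2 ⟨hy, fun e => hx (e.1 ▸ h.u_mem), fun e => hxv e.1⟩
        refine ⟨.t y, hcut, trivial, rfl, ?_⟩
        rw [lheight_t_out hx, lheight_t_out (fun e => hx ((mem_side_iff hcut).2 e))]
        omega

theorem isTree (h : D.Ok π n) (hB : PortTree D.K G cB) : (D.ext G cB).IsTree := by
  obtain ⟨o⟩ := hB.tree.connected.nonempty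
  refine ⟨connected_of_height (D.inl cB o) (fun z => height D G o z.1) ?_,
    isAcyclic_of_height (fun z => height D G o z.1) ?_⟩
  · rintro ⟨z, hz⟩ hne
    cases z with
    | base x =>
      have hx : x ≠ o := by rintro rfl; exact hne rfl
      obtain ⟨y, hy, hlt⟩ := exists_adj_dist_lt hB.tree.connected hx
      exact ⟨D.inl cB y, hy, hlt⟩
    | push g z =>
      by_cases hg : D.isRoot g
      · exact ⟨⟨z, hz.1⟩, (D.wadj_push (G := G)).2 (Or.inr (Or.inl ⟨rfl, hg⟩)), by simp only [height]; omega⟩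
      · obtain ⟨g', h1, h2, h3, h4⟩ := h.exists_lower hg hz.2.1
        exact ⟨⟨.push g' z, hz.1, h2, h3 ▸ hz.2.2⟩, (D.wadj_push (G := G)).2 (Or.inl ⟨g', rfl, h1⟩), by
          simp only [height]; omega⟩
  · rintro ⟨z, hz⟩ ⟨y, hy⟩ ⟨y', hy'⟩ hadj hadj' hl hl'
    apply Subtype.ext
    simp only at hl hl' ⊢
    cases z with
    | base x =>
      rcases adj_base hy hadj with ⟨x₁, rfl, h₁⟩ | ⟨k, -, rfl⟩
      · rcases adj_base hy' hadj' with ⟨x₂, rfl, h₂⟩ | ⟨k, -, rfl⟩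
        · rw [eq_of_adj_of_dist_le hB.tree h₁ h₂ hl hl']
        · simp only [height] at hl'; omega
      · simp only [height] at hl; omega
    | push g z =>
      rcases D.wadj_push.1 hadj with ⟨g₁, rfl, h₁⟩ | ⟨rfl, h₁⟩ | ⟨g₁, h₁, rfl⟩
      · rcases D.wadj_push.1 hadj' with ⟨g₂, rfl, h₂⟩ | ⟨rfl, h₂⟩ | ⟨g₂, h₂, rfl⟩
        · simp only [height] at hl hl'
          rw [h.lower_unique h₁ h₂ hz.2.1 hy.2.1 hy'.2.1 (by omega) (by omega)]
        · have := lheight_pos_of_root h₂ h₁ hy.2.1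
          have := lheight_root h₂
          simp only [height] at hl; omega
        · simp only [height] at hl'; omega
      · rcases D.wadj_push.1 hadj' with ⟨g₂, rfl, h₂⟩ | ⟨rfl, h₂⟩ | ⟨g₂, h₂, rfl⟩
        · have := lheight_pos_of_root h₁ h₂ hy'.2.1
          have := lheight_root h₁
          simp only [height] at hl'; omega
        · rfl
        · simp only [height] at hl'; omega
      · simp only [height] at hl; omega

end Ok

end Gadget

/-! ### New ports, tightness and the remaining invariants of the extension. -/

namespace Gadget

variable {B V W : Type} {D : Gadget V W} {π : ℕ → V} {n : ℕ} {G : SimpleGraph B}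
  {cB : B → Option Bool}

/-- The column of the tooth whose tip is a new port of colour `k`. -/
def portCol (D : Gadget V W) (k : Bool) : ℕ := if k then D.K + 2 else D.K + 3

theorem tooth_portCol (k : Bool) : D.tooth (D.portCol k) = D.L := by
  cases k <;> simp [tooth, portCol]

theorem newCol_push_m {b k : Bool} {z : Word B V W}
    (hz : D.Valid cB (.push (.m b (D.portCol k) D.L) z)) :
    D.newCol cB ⟨_, hz⟩ = some k := by
  cases k <;> simp [newCol, ncol, portCol]

theorem exists_of_newCol {z : D.Vert cB} {k : Bool} (h : D.newCol cB z = some k) :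
    ∃ b z', z.1 = .push (.m b (D.portCol k) D.L) z' := by
  obtain ⟨z, hz⟩ := z
  cases z with
  | base x => simp [newCol] at h
  | push g z =>
    cases g with
    | m b i j =>
      refine ⟨b, z, ?_⟩
      simp only [newCol, ncol] at h
      split_ifs at h with h1 h2
      · obtain rfl := Option.some.inj h
        simp [portCol, h1.1, h1.2]
      · obtain rfl := Option.some.inj h
        simp [portCol, h2.1, h2.2]
    | s q => simp [newCol, ncol] at h
    | t x => simp [newCol, ncol] at h

open Classical in
/-- The height (plus one) of a vertex on a given tooth of a given comb, zero elsewhere. -/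
noncomputable def toothHeight (b : Bool) (i : ℕ) (z₀ : Word B V W) : Word B V W → ℕ
  | .push (.m b' i' j) z => if b' = b ∧ i' = i ∧ z = z₀ then j + 1 else 0
  | _ => 0

theorem toothHeight_self {b : Bool} {i j : ℕ} {z : Word B V W} :
    toothHeight b i z (.push (.m b i j) z) = j + 1 := by simp [toothHeight]

theorem exists_of_toothHeight {b : Bool} {i : ℕ} {z₀ y : Word B V W}
    (h : toothHeight b i z₀ y ≠ 0) :
    ∃ j, y = .push (.m b i j) z₀ ∧ toothHeight b i z₀ y = j + 1 := by
  unfold toothHeight at h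
  split at h
  · next b' i' j z =>
    split_ifs at h with hc
    · obtain ⟨rfl, rfl, rfl⟩ := hc
      exact ⟨j, rfl, toothHeight_self⟩
    · exact (h rfl).elim
  · exact (h rfl).elim

/-- A long tooth can be left only through its foot, where the shifted height is 1, or along the
tooth itself. -/
theorem toothHeight_lipschitz {b k : Bool} {z₀ : Word B V W} (x y : D.Vert cB)
    (h : (D.ext G cB).Adj x y) :
    toothHeight b (D.portCol k) z₀ y.1 ≤ toothHeight b (D.portCol k) z₀ x.1 + 1 := by
  by_cases h0 : toothHeight b (D.portCol k) z₀ y.1 = 0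
  · omega
  obtain ⟨j, hy, hj⟩ := exists_of_toothHeight h0
  rw [hj]
  by_cases hj0 : j = 0
  · omega
  have hadj : D.wadj G (.push (.m b (D.portCol k) j) z₀) x.1 := hy ▸ h.symm
  rcases adj_m_tooth x.2 hadj (by omega) (by cases k <;> simp [portCol]) with e | ⟨e, -⟩
  · rw [e, toothHeight_self]; omega
  · rw [e, toothHeight_self]; omega

/-- Moves the vertices on the teeth carrying new ports down to the spine. -/
def flattenLoc (D : Gadget V W) : Loc V W → Loc V W
  | .m b i j => if i = D.K + 2 ∨ i = D.K + 3 then .m b i 0 else .m b i j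
  | g => g

def flattenWord (D : Gadget V W) : Word B V W → Word B V W
  | .base x => .base x
  | .push g z => .push (D.flattenLoc g) z

theorem kind_flattenLoc (g : Loc V W) : kind (D.flattenLoc g) = kind g := by
  cases g with
  | m b i j => simp only [flattenLoc]; split_ifs <;> rfl
  | s q => rfl
  | t x => rfl

theorem okL_flattenLoc {g : Loc V W} (h : D.okL g) : D.okL (D.flattenLoc g) := by
  cases g with
  | m b i j =>
    simp only [flattenLoc]; split_ifs
    · exact ⟨h.1, Nat.zero_le _⟩
    · exact h
  | s q => exact h
  | t x => exact h

/-- The retraction fed to `tight_of_dense`. It removes the long teeth, the only places whose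
distance to branch vertices is not bounded independently of `L`. -/
def flatten (D : Gadget V W) (z : D.Vert cB) : D.Vert cB :=
  ⟨D.flattenWord z.1, by
    obtain ⟨z, hz⟩ := z
    cases z with
    | base x => exact hz
    | push g z => exact ⟨hz.1, okL_flattenLoc hz.2.1, by rw [kind_flattenLoc]; exact hz.2.2⟩⟩

theorem flattenLoc_flattenLoc (g : Loc V W) :
    D.flattenLoc (D.flattenLoc g) = D.flattenLoc g := by
  cases g with
  | m b i j =>
    by_cases h : i = D.K + 2 ∨ i = D.K + 3
    · simp [flattenLoc, h]
    · simp [flattenLoc, h]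
  | s q => rfl
  | t x => rfl

theorem flattenLoc_of_isRoot {g : Loc V W} (h : D.isRoot g) : D.flattenLoc g = g := by
  rw [D.isRoot_iff.1 h]
  simp [flattenLoc]

theorem flattenLoc_of_lcol {g : Loc V W} {k : Bool} (h : D.lcol g = some k) :
    D.flattenLoc g = g := by
  cases g with
  | m b i j => simp [lcol] at h
  | s q => rfl
  | t x => rfl

theorem flattenLoc_ladj {g g' : Loc V W} (h : D.ladj g g') (ho : D.okL g) (ho' : D.okL g') :
    D.flattenLoc g = D.flattenLoc g' ∨ D.ladj (D.flattenLoc g) (D.flattenLoc g') := by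
  have hN : D.N = 2 * D.K + 10 := rfl
  cases g with
  | m b i j =>
    cases g' with
    | m b' i' j' =>
      obtain ⟨rfl, hc⟩ := h
      obtain ⟨-, ho⟩ := ho
      obtain ⟨-, ho'⟩ := ho'
      simp only [tooth] at ho ho'
      simp only [flattenLoc]
      unfold comb at hc
      split_ifs with h1 h2 h2 <;> simp only [ladj, Loc.m.injEq, true_and, and_true, eq_self] <;> unfold comb <;>
        split_ifs at ho ho' <;> omega
    | s q =>
      obtain ⟨rfl, rfl, rfl, rfl⟩ := h
      right
      simp [flattenLoc, ladj]
    | t x =>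
      obtain ⟨rfl, ⟨rfl, rfl, rfl⟩ | ⟨rfl, rfl, rfl⟩⟩ := h
      · right
        simp [flattenLoc, ladj]
      · right
        simp [flattenLoc, ladj]
  | s q =>
    cases g' with
    | m b' i' j' =>
      obtain ⟨rfl, rfl, rfl, rfl⟩ := h
      right
      simp [flattenLoc, ladj]
    | s q => exact Or.inr h
    | t x => exact h.elim
  | t x =>
    cases g' with
    | m b' i' j' =>
      obtain ⟨rfl, ⟨rfl, rfl, rfl⟩ | ⟨rfl, rfl, rfl⟩⟩ := h
      · right
        simp [flattenLoc, ladj]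
      · right
        simp [flattenLoc, ladj]
    | s q => exact h.elim
    | t x => exact Or.inr h

theorem flatten_adj (x y : D.Vert cB) (h : (D.ext G cB).Adj x y) :
    D.flatten x = D.flatten y ∨ (D.ext G cB).Adj (D.flatten x) (D.flatten y) := by
  obtain ⟨x, hx⟩ := x
  obtain ⟨y, hy⟩ := y
  cases x with
  | base p =>
    right
    rcases D.wadj_base.1 h with ⟨p', rfl, h'⟩ | ⟨g', hg, rfl⟩
    · exact h
    · change D.wadj G (.base p) (.push (D.flattenLoc g') (.base p))
      rw [flattenLoc_of_isRoot hg]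
      exact h
  | push g z =>
    rcases D.wadj_push.1 h with ⟨g', rfl, h'⟩ | ⟨rfl, hg⟩ | ⟨g', hg, rfl⟩
    · rcases flattenLoc_ladj h' hx.2.1 hy.2.1 with e | e
      · left
        exact Subtype.ext (congrArg (Word.push · z) e)
      · right
        exact (D.wadj_push (G := G)).2 (Or.inl ⟨_, rfl, e⟩)
    · right
      have hcol := hx.2.2
      change D.wadj G (.push (D.flattenLoc g) y) (D.flattenWord y)
      rw [flattenLoc_of_isRoot hg]
      cases y with
      | base p => exact h
      | push g' z' =>
        change D.wadj G _ (.push (D.flattenLoc g') z')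
        rw [flattenLoc_of_lcol hcol]
        exact h
    · right
      have hcol := hy.2.2
      change D.wadj G (.push (D.flattenLoc g) z) (.push (D.flattenLoc g') (.push g z))
      rw [flattenLoc_of_isRoot hg, flattenLoc_of_lcol hcol]
      exact h

theorem valid_s {z : Word B V W} (hz : D.Valid cB z) (hc : D.col cB z = some true) (q : W) :
    D.Valid cB (.push (.s q) z) := ⟨hz, trivial, hc⟩

theorem valid_t {z : Word B V W} (hz : D.Valid cB z) (hc : D.col cB z = some false) (x : V) :
    D.Valid cB (.push (.t x) z) := ⟨hz, trivial, hc⟩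

theorem valid_m {b : Bool} {i j : ℕ} {z : Word B V W} (hz : D.Valid cB z)
    (hc : D.col cB z = some b) (hi : i ≤ D.N) (hj : j ≤ D.tooth i) :
    D.Valid cB (.push (.m b i j) z) := ⟨hz, ⟨hi, hj⟩, hc⟩

theorem wadj_of_ladj (G : SimpleGraph B) (g g' : Loc V W) {z : Word B V W} (h : D.ladj g g') :
    D.wadj G (.push g z) (.push g' z) := Or.inl ⟨rfl, h⟩

theorem isEmb_s {z : Word B V W} (hz : D.Valid cB z) (hc : D.col cB z = some true) :
    IsEmb (fun q => (⟨.push (.s q) z, valid_s hz hc q⟩ : D.Vert cB)) D.S (D.ext G cB) :=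
  ⟨fun q q' e => by simpa using congrArg Subtype.val e,
    fun q q' h => wadj_of_ladj G (.s q) (.s q') h⟩

theorem isEmb_t {z : Word B V W} (hz : D.Valid cB z) (hc : D.col cB z = some false) :
    IsEmb (fun x => (⟨.push (.t x) z, valid_t hz hc x⟩ : D.Vert cB)) D.cut (D.ext G cB) :=
  ⟨fun q q' e => by simpa using congrArg Subtype.val e,
    fun q q' h => wadj_of_ladj G (.t q) (.t q') h⟩

theorem adj_m_m {b : Bool} {i j i' j' : ℕ} {z : Word B V W}
    (hz : D.Valid cB (.push (.m b i j) z)) (hz' : D.Valid cB (.push (.m b i' j') z))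
    (hc : comb i j i' j') : (D.ext G cB).Adj ⟨_, hz⟩ ⟨_, hz'⟩ :=
  wadj_of_ladj G (.m b i j) (.m b i' j') ⟨rfl, hc⟩

theorem dist_spine (hconn : (D.ext G cB).Connected) {b : Bool} {z : Word B V W}
    (hz : D.Valid cB z) (hc : D.col cB z = some b) {i : ℕ} (k : ℕ) (hi : i + k ≤ D.N) :
    (D.ext G cB).dist ⟨_, valid_m hz hc (by omega) (Nat.zero_le (D.tooth i))⟩
      ⟨_, valid_m hz hc hi (Nat.zero_le (D.tooth (i + k)))⟩ ≤ k := by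
  induction k with
  | zero => simp
  | succ k ih =>
    have h1 := ih (by omega)
    have h2 : (D.ext G cB).Adj ⟨_, valid_m hz hc (i := i + k) (by omega) (Nat.zero_le _)⟩
        ⟨_, valid_m hz hc hi (Nat.zero_le _)⟩ := adj_m_m _ _ (by unfold comb; omega)
    have h3 := dist_eq_one_iff_adj.2 h2
    exact hconn.dist_triangle.trans (by rw [h3]; exact Nat.succ_le_succ h1)

theorem dist_tooth (hconn : (D.ext G cB).Connected) {b : Bool} {z : Word B V W}
    (hz : D.Valid cB z) (hc : D.col cB z = some b) {i : ℕ} (hi : i ≤ D.N) (j : ℕ)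
    (hj : j ≤ D.tooth i) :
    (D.ext G cB).dist ⟨_, valid_m hz hc hi (Nat.zero_le _)⟩ ⟨_, valid_m hz hc hi hj⟩ ≤ j := by
  induction j with
  | zero => simp
  | succ j ih =>
    have h1 := ih (by omega)
    have h2 : (D.ext G cB).Adj ⟨_, valid_m hz hc hi (show j ≤ D.tooth i by omega)⟩
        ⟨_, valid_m hz hc hi hj⟩ := adj_m_m _ _ (by unfold comb; omega)
    have h3 := dist_eq_one_iff_adj.2 h2
    exact hconn.dist_triangle.trans (by rw [h3]; exact Nat.succ_le_succ h1)

/-- Follow the walk until its next edge would be `uv`. -/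
theorem exists_cut_walk {x d : V} (w : D.T.Walk x d) (hd : IsBranch D.T d) :
    ∃ y, (∃ w' : D.cut.Walk x y, w'.length ≤ w.length) ∧
      (y = D.u ∨ y = D.v ∨ IsBranch D.T y) := by
  induction w with
  | nil => exact ⟨_, ⟨.nil, le_rfl⟩, Or.inr (Or.inr hd)⟩
  | @cons x x' d hadj w ih =>
    by_cases hc : D.cut.Adj x x'
    · obtain ⟨y, ⟨w', hw'⟩, hy⟩ := ih hd
      exact ⟨y, ⟨.cons hc w', by simpa using hw'⟩, hy⟩
    · refine ⟨x, ⟨.nil, by simp⟩, ?_⟩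
      rw [Ok.cut_adj_iff] at hc
      tauto

namespace Ok

theorem one_le_L (h : D.Ok π n) : 1 ≤ D.L := by have := h.hL; omega

theorem isBranch_mk_m (h : D.Ok π n) {b : Bool} {i : ℕ} {z : Word B V W}
    (hi : i = D.K + 1 ∨ i = D.K + 2 ∨ i = D.K + 3) (hz : D.Valid cB (.push (.m b i 0) z)) :
    IsBranch (D.ext G cB) ⟨_, hz⟩ := by
  have hN : D.N = 2 * D.K + 10 := rfl
  have hL := h.one_le_L
  have ht : 1 ≤ D.tooth i := by
    simp only [tooth]; split_ifs <;> omega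
  refine ⟨⟨_, valid_m hz.1 hz.2.2 (i := i - 1) (by omega) (Nat.zero_le _)⟩,
    ⟨_, valid_m hz.1 hz.2.2 (i := i + 1) (by omega) (Nat.zero_le _)⟩,
    ⟨_, valid_m hz.1 hz.2.2 (by omega) ht⟩, ?_, ?_, ?_,
    adj_m_m _ _ ?_, adj_m_m _ _ ?_, adj_m_m _ _ ?_⟩
  · intro e
    have := congrArg Subtype.val e
    simp at this
  · intro e
    have := congrArg Subtype.val e
    simp at this
  · intro e
    have := congrArg Subtype.val e
    simp at this
  all_goals unfold comb; simp; try omega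

theorem isBranch_mk_t {x : V} {z : Word B V W} (hx : IsBranch D.T x) (hu : x ≠ D.u)
    (hv : x ≠ D.v) (hz : D.Valid cB (.push (.t x) z)) :
    IsBranch (D.ext G cB) ⟨_, hz⟩ := by
  have hcut : ∀ y, D.T.Adj x y → D.cut.Adj x y := fun y hy =>
    cut_adj_iff.2 ⟨hy, fun e => hu e.1, fun e => hv e.1⟩
  obtain ⟨p, q, r, h1, h2, h3, h4, h5, h6⟩ := hx
  exact IsBranch.map (isEmb_t hz.1 hz.2.2)
    ⟨p, q, r, h1, h2, h3, hcut _ h4, hcut _ h5, hcut _ h6⟩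

theorem exists_isBranch {V : Type*} {K : ℕ} {G : SimpleGraph V} {c : V → Option Bool}
    (h : PortTree K G c) : ∃ x, IsBranch G x := by
  obtain ⟨f, -, hf⟩ := h.four
  exact ⟨_, hf 0⟩

/-- Base and copies inherit density from tightness at scale `K`. In a copy of `T` the missing edge
may stop a walk at `u` or `v`. From `v` one edge leads to the comb, and from `u` one reaches it
through `a`, which is why the distance from `u` to `a` in the cut tree enters the bound. -/
theorem dense (h : D.Ok π n) (hB : PortTree D.K G cB) (z : D.Vert cB) (hz : D.flatten z = z) :
    ∃ d, IsBranch (D.ext G cB) d ∧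
      (D.ext G cB).dist z d ≤ 2 * D.N + 2 * D.K + D.cut.dist D.u D.a + 2 := by
  have hN : D.N = 2 * D.K + 10 := rfl
  have hconn := (h.isTree hB).connected
  -- vertices of the comb
  have hm : ∀ (b : Bool) (i j : ℕ) (z : Word B V W) (hz : D.Valid cB (.push (.m b i j) z)),
      D.flattenLoc (.m b i j : Loc V W) = .m b i j → ∃ d, IsBranch (D.ext G cB) d ∧
        (D.ext G cB).dist ⟨_, hz⟩ d ≤ D.N + D.K + 1 := by
    intro b i j z hz hfl
    obtain ⟨hz', ⟨hi, hj⟩, hc⟩ := hz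
    have hjK : j ≤ D.K + 1 := by
      simp only [flattenLoc] at hfl
      simp only [tooth] at hj
      split_ifs at hfl hj <;> simp only [Loc.m.injEq, true_and] at hfl <;> omega
    refine ⟨_, h.isBranch_mk_m (Or.inl rfl)
      (valid_m (b := b) hz' hc (i := D.K + 1) (by omega) (Nat.zero_le _)), ?_⟩
    have h1 := dist_tooth (G := G) hconn hz' hc hi j hj
    rw [SimpleGraph.dist_comm] at h1
    have h2 : (D.ext G cB).dist ⟨_, valid_m hz' hc hi (Nat.zero_le _)⟩
        ⟨_, valid_m hz' hc (i := D.K + 1) (by omega) (Nat.zero_le _)⟩ ≤ D.N := by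
      rcases le_total i (D.K + 1) with hle | hle
      · obtain ⟨k, hk⟩ := Nat.exists_eq_add_of_le hle
        have := dist_spine (G := G) hconn hz' hc (i := i) k (by omega)
        simp only [← hk] at this
        omega
      · obtain ⟨k, rfl⟩ := Nat.exists_eq_add_of_le hle
        have := dist_spine (G := G) hconn hz' hc (i := D.K + 1) k (by omega)
        rw [SimpleGraph.dist_comm] at this
        omega
    refine hconn.dist_triangle.trans ((Nat.add_le_add h1 h2).trans ?_)
    omega
  obtain ⟨z, hv⟩ := z
  cases z with
  | base x =>
    obtain ⟨d₀, hd₀⟩ := exists_isBranch hB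
    obtain ⟨d, hd, w, hw⟩ := hB.tight.exists_walk hd₀ x
    refine ⟨_, hd.map (D.isEmb_inl), (dist_le (w.map ⟨D.inl cB, fun h => h⟩)).trans ?_⟩
    rw [Walk.length_map]
    omega
  | push g z =>
    have hfl : D.flattenLoc g = g := (Word.push.inj (congrArg Subtype.val hz)).1
    cases g with
    | m b i j =>
      obtain ⟨d, hd, hle⟩ := hm b i j z hv hfl
      exact ⟨d, hd, by omega⟩
    | s q =>
      obtain ⟨d₀, hd₀⟩ := exists_isBranch h.hS
      obtain ⟨d, hd, w, hw⟩ := h.hS.tight.exists_walk hd₀ q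
      have hemb := isEmb_s (G := G) hv.1 hv.2.2
      refine ⟨_, hd.map hemb, (dist_le (w.map ⟨_, fun h => hemb.adj _ _ h⟩)).trans ?_⟩
      rw [Walk.length_map]
      omega
    | t x =>
      obtain ⟨d₀, hd₀⟩ := exists_isBranch h.hT
      obtain ⟨d, hd, w, hw⟩ := h.hT.tight.exists_walk hd₀ x
      obtain ⟨y, ⟨w', hw'⟩, hy⟩ := exists_cut_walk w hd
      have hemb := isEmb_t (G := G) hv.1 hv.2.2
      have h1 : (D.ext G cB).dist ⟨_, hv⟩ ⟨_, valid_t hv.1 hv.2.2 y⟩ ≤ D.K := by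
        refine (dist_le (w'.map ⟨_, fun h => hemb.adj _ _ h⟩)).trans ?_
        rw [Walk.length_map]
        omega
      by_cases hyu : y = D.u
      · subst hyu
        have hr : D.cut.Reachable D.u D.a := Reachable.symm h.u_mem
        obtain ⟨w₂, hw₂⟩ := hr.exists_walk_length_eq_dist
        have h2 : (D.ext G cB).dist ⟨_, valid_t hv.1 hv.2.2 D.u⟩ ⟨_, valid_t hv.1 hv.2.2 D.a⟩ ≤
            D.cut.dist D.u D.a := by
          refine (dist_le (w₂.map ⟨_, fun h => hemb.adj _ _ h⟩)).trans ?_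
          rw [Walk.length_map, hw₂]
        have h3 : (D.ext G cB).Adj ⟨_, valid_t hv.1 hv.2.2 D.a⟩
            ⟨_, valid_m hv.1 hv.2.2 le_rfl (Nat.zero_le _)⟩ :=
          wadj_of_ladj G (.t D.a) (.m false D.N 0) ⟨rfl, Or.inl ⟨rfl, rfl, rfl⟩⟩
        obtain ⟨d', hd', hle⟩ := hm false D.N 0 z (valid_m hv.1 hv.2.2 le_rfl (Nat.zero_le _))
          (by simp [flattenLoc])
        refine ⟨d', hd', ?_⟩
        have h4 := dist_eq_one_iff_adj.2 h3
        refine hconn.dist_triangle.trans ((Nat.add_le_add h1 (hconn.dist_triangle.trans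
          (Nat.add_le_add h2 (hconn.dist_triangle.trans (Nat.add_le_add h4.le hle))))).trans ?_)
        omega
      by_cases hyv : y = D.v
      · subst hyv
        have hval : D.Valid cB (.push (.m false (D.K + 1) (D.K + 1)) z) :=
          valid_m hv.1 hv.2.2 (by omega) (by simp [tooth])
        have h3 : (D.ext G cB).Adj ⟨_, valid_t hv.1 hv.2.2 D.v⟩ ⟨_, hval⟩ :=
          wadj_of_ladj G (.t D.v) (.m false (D.K + 1) (D.K + 1)) ⟨rfl, Or.inr ⟨rfl, rfl, rfl⟩⟩
        obtain ⟨d', hd', hle⟩ := hm false _ _ z hval (by simp [flattenLoc])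
        refine ⟨d', hd', ?_⟩
        have h4 := dist_eq_one_iff_adj.2 h3
        refine hconn.dist_triangle.trans ((Nat.add_le_add h1 (hconn.dist_triangle.trans
          (Nat.add_le_add h4.le hle))).trans ?_)
        omega
      · exact ⟨_, isBranch_mk_t (by tauto) hyu hyv _, h1.trans (by omega)⟩

theorem tight (h : D.Ok π n) (hB : PortTree D.K G cB) : Tight (D.ext G cB) D.L := by
  have hN : D.N = 2 * D.K + 10 := rfl
  refine tight_of_dense (h.isTree hB).connected D.flatten flatten_adj ?_ ?_ (h.dense hB) ?_ h.hL
  · rintro ⟨z, hz⟩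
    cases z with
    | base x => rfl
    | push g z => exact Subtype.ext (congrArg (Word.push · z) (flattenLoc_flattenLoc g))
  · rintro ⟨z, hz⟩ hbr
    cases z with
    | base x => rfl
    | push g z =>
      apply Subtype.ext
      cases g with
      | m b i j =>
        obtain ⟨rfl, -⟩ := isBranch_m hbr
        simp [flatten, flattenWord, flattenLoc]
      | s q => rfl
      | t x => rfl
  · rintro ⟨z, hz⟩ hne
    cases z with
    | base x => exact (hne rfl).elim
    | push g z =>
      cases g with
      | m b i j =>
        have hi : i = D.K + 2 ∨ i = D.K + 3 := by
          by_contra hcon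
          exact hne (Subtype.ext (by simp [flatten, flattenWord, flattenLoc, hcon]))
        obtain ⟨hz', ⟨hi', hj⟩, hc⟩ := hz
        refine ⟨_, h.isBranch_mk_m (Or.inr hi) (valid_m hz' hc hi' (Nat.zero_le _)), ?_⟩
        refine (dist_tooth (h.isTree hB).connected hz' hc hi' j hj).trans (hj.trans ?_)
        unfold tooth
        split_ifs <;> omega
      | s q => exact (hne rfl).elim
      | t x => exact (hne rfl).elim

theorem port_deg (h : D.Ok π n) (x : D.Vert cB) (hx : D.newCol cB x ≠ none) (y z : D.Vert cB)
    (hy : (D.ext G cB).Adj x y) (hz : (D.ext G cB).Adj x z) : y = z := by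
  obtain ⟨k, hk⟩ := Option.ne_none_iff_exists'.1 hx
  obtain ⟨b, x', e⟩ := exists_of_newCol hk
  have key : ∀ y : D.Vert cB, (D.ext G cB).Adj x y →
      y.1 = .push (.m b (D.portCol k) (D.L - 1)) x' := by
    intro y hy
    have hadj : D.wadj G (.push (.m b (D.portCol k) D.L) x') y.1 := e ▸ hy
    rcases adj_m_tooth y.2 hadj h.one_le_L (by cases k <;> simp [portCol]) with e | ⟨-, e⟩
    · exact e
    · rw [tooth_portCol] at e
      omega
  exact Subtype.ext ((key y hy).trans (key z hz).symm)

theorem port_far (p d : D.Vert cB) (hp : D.newCol cB p ≠ none) (hd : IsBranch (D.ext G cB) d)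
    (w : (D.ext G cB).Walk d p) : D.L ≤ w.length := by
  obtain ⟨k, hk⟩ := Option.ne_none_iff_exists'.1 hp
  obtain ⟨b, x', e⟩ := exists_of_newCol hk
  have h1 := le_length_of_lipschitz (fun z : D.Vert cB => toothHeight b (D.portCol k) x' z.1)
    toothHeight_lipschitz w
  simp only [e, toothHeight_self] at h1
  have h2 : toothHeight b (D.portCol k) x' d.1 ≤ 1 := by
    by_contra hcon
    obtain ⟨j, hj, hj'⟩ := exists_of_toothHeight (by omega : toothHeight b (D.portCol k) x' d.1 ≠ 0)
    obtain ⟨d, hd'⟩ := d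
    simp only at hj
    subst hj
    have := (isBranch_m hd).1
    simp only at hj' hcon
    omega
  omega

/-- Two true combs are available, one at a true port of the base and one at a true port of the copy
of `S` beyond it. The vertex `x` lies on the relevant tooth of at most one of them, and from outside
a long tooth its tip is at distance at least `L + 1`. -/
theorem far (h : D.Ok π n) (hB : PortTree D.K G cB) (x : D.Vert cB) (k : Bool) :
    ∃ p, D.newCol cB p = some k ∧ D.L + 1 ≤ (D.ext G cB).dist x p := by
  have hN : D.N = 2 * D.K + 10 := rfl
  obtain ⟨o⟩ := hB.tree.connected.nonempty
  obtain ⟨p₀, hp₀, -⟩ := hB.far o true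
  obtain ⟨q, hq, -⟩ := h.hS.far D.s true
  have hqs : q ≠ D.s := by
    rintro rfl
    rw [h.ds] at hq
    simp at hq
  have key : ∀ z : Word B V W, D.Valid cB z → D.col cB z = some true →
      toothHeight true (D.portCol k) z x.1 = 0 →
      ∃ p, D.newCol cB p = some k ∧ D.L + 1 ≤ (D.ext G cB).dist x p := by
    intro z hz hc h0
    have hv : D.Valid cB (.push (.m true (D.portCol k) D.L) z) :=
      valid_m hz hc (by cases k <;> simp [portCol] <;> omega) (by rw [tooth_portCol])
    refine ⟨⟨_, hv⟩, newCol_push_m hv, ?_⟩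
    obtain ⟨w, hw⟩ := (h.isTree hB).connected.exists_walk_length_eq_dist x ⟨_, hv⟩
    have h1 := le_length_of_lipschitz
      (fun y : D.Vert cB => toothHeight true (D.portCol k) z y.1) toothHeight_lipschitz w
    simp only [toothHeight_self, h0] at h1
    omega
  by_cases h0 : toothHeight true (D.portCol k) (.base p₀) x.1 = 0
  · exact key (.base p₀) trivial hp₀ h0
  · obtain ⟨j, hj, -⟩ := exists_of_toothHeight h0
    refine key (.push (.s q) (.base p₀)) (valid_s (z := .base p₀) trivial hp₀ q) (by simp [col, lcol, hqs, hq]) ?_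
    by_contra hcon
    obtain ⟨j', hj', -⟩ := exists_of_toothHeight hcon
    rw [hj] at hj'
    simp at hj'

theorem four (hB : PortTree D.K G cB) :
    ∃ f : Fin 4 → D.Vert cB, Injective f ∧ ∀ i, IsBranch (D.ext G cB) (f i) := by
  obtain ⟨f, hf, hbr⟩ := hB.four
  exact ⟨fun i => D.inl cB (f i), (D.isEmb_inl (G := G)).inj.comp hf,
    fun i => (hbr i).map D.isEmb_inl⟩

end Ok

instance [Countable V] [Countable W] : Countable (Loc V W) := by
  let f : Loc V W → (Bool × ℕ × ℕ) ⊕ (W ⊕ V) := fun g => match g with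
    | .m b i j => .inl (b, i, j)
    | .s y => .inr (.inl y)
    | .t x => .inr (.inr x)
  refine Injective.countable (f := f) ?_
  intro g g' h
  cases g <;> cases g' <;> simp_all [f]

/-- The list of positions of a word and its base vertex. -/
def toList : Word B V W → List (Loc V W) × B
  | .base x => ([], x)
  | .push g z => (g :: (toList z).1, (toList z).2)

theorem toList_injective : Injective (toList : Word B V W → _) := by
  intro z
  induction z with
  | base x =>
    intro z' h
    cases z' with
    | base y => simpa [toList] using h
    | push g z' => simp [toList] at h
  | push g z ih =>
    intro z' h
    cases z' with
    | base y => simp [toList] at h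
    | push g' z' =>
      simp only [toList, Prod.mk.injEq, List.cons.injEq] at h
      rw [h.1.1, ih (Prod.ext h.1.2 h.2)]

instance [Countable B] [Countable V] [Countable W] : Countable (Word B V W) :=
  toList_injective.countable

end Gadget

/-! ### Isolated pieces of the extension and embeddings of tight graphs. -/

/-- The infinite comb, with all teeth infinite. -/
def combGraph : SimpleGraph (ℕ × ℕ) where
  Adj p q := comb p.1 p.2 q.1 q.2
  symm := ⟨fun _ _ h => Gadget.comb_symm h⟩
  loopless := ⟨fun _ h => Gadget.comb_irrefl h⟩

namespace Gadget

variable {B V W : Type} {D : Gadget V W} {π : ℕ → V} {n : ℕ} {G : SimpleGraph B}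
  {cB : B → Option Bool}

/-- The base is left only through its ports, which are far from its branch vertices. The other
pieces are treated alike, with comb ends as additional exits. -/
theorem isolated_base (hB : PortTree D.K G cB) :
    Isolated (D.ext G cB) D.K {z | ∃ x, z.1 = .base x} := by
  obtain ⟨o⟩ := hB.tree.connected.nonempty
  refine isolated_of (H := G) (fun z => match z.1 with | .base x => x | .push _ _ => o)
    {x | cB x ≠ none} ?_ ?_
  · rintro ⟨z, hz⟩ ⟨x, rfl⟩ ⟨y, hy⟩ hadj
    rcases adj_base hy hadj with ⟨x', rfl, h'⟩ | ⟨k, h', -⟩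
    · exact Or.inl ⟨⟨x', rfl⟩, h'⟩
    · exact Or.inr (by simp [h'])
  · rintro ⟨z, hz⟩ ⟨x, rfl⟩ hbr e he w
    exact hB.port_far e _ he (Ok.isBranch_base hB hbr).2 w

namespace Ok

theorem isolated_s (h : D.Ok π n) (z : Word B V W) :
    Isolated (D.ext G cB) D.K {y | ∃ q, y.1 = .push (.s q) z} := by
  refine isolated_of (H := D.S)
    (fun z => match z.1 with | .push (.s q) _ => q | _ => D.s) {x | D.d x ≠ none} ?_ ?_
  · rintro ⟨z', hz⟩ ⟨x, rfl⟩ ⟨y, hy⟩ hadj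
    rcases adj_s hy hadj with ⟨x', rfl, h'⟩ | ⟨rfl, -⟩ | ⟨-, k, h', -⟩
    · exact Or.inl ⟨⟨x', rfl⟩, h'⟩
    · exact Or.inr (by simp [h.ds])
    · exact Or.inr (by simp [h'])
  · rintro ⟨z', hz⟩ ⟨x, rfl⟩ hbr e he w
    exact h.hS.port_far e _ he (h.isBranch_s hbr) w

theorem isolated_side (h : D.Ok π n) (z : Word B V W) :
    Isolated (D.ext G cB) D.K {y | ∃ x ∈ D.side, y.1 = .push (.t x) z} := by
  refine isolated_of (H := D.T)
    (fun z => match z.1 with | .push (.t q) _ => q | _ => D.v) {x | D.c x ≠ none} ?_ ?_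
  · rintro ⟨z', hz⟩ ⟨x, hx, rfl⟩ ⟨y, hy⟩ hadj
    rcases adj_t hy hadj with ⟨x', rfl, h'⟩ | ⟨rfl, -⟩ | ⟨rfl, -⟩ | ⟨-, k, h', -⟩
    · exact Or.inl ⟨⟨x', (mem_side_iff h').1 hx, rfl⟩, (cut_adj_iff.1 h').1⟩
    · exact Or.inr (by simp [h.ca])
    · exact (h.v_notMem hx).elim
    · exact Or.inr (by simp [h'])
  · rintro ⟨z', hz⟩ ⟨x, hx, rfl⟩ hbr e he w
    exact h.hT.port_far e _ he (h.isBranch_t hbr) w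

/-- The part of a `T`-gadget beyond the edge `uv`, with the end of the tooth leading to it. -/
def farPart (D : Gadget V W) (z : Word B V W) : Set (Word B V W) :=
  {y | (∃ x, x ∉ D.side ∧ y = .push (.t x) z) ∨
    ∃ i < D.K, y = .push (.m false (D.K + 1) (D.K + 1 - i)) z}

/-- Maps `farPart` to `T`, the tooth going to the path `π`. -/
def farMap (D : Gadget V W) (π : ℕ → V) : Word B V W → V
  | .push (.t x) _ => x
  | .push (.m _ _ j) _ => π (D.K + 2 - j)
  | _ => D.v

theorem farMap_m {z : Word B V W} {i : ℕ} (hi : i < D.K) :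
    farMap D π (.push (.m false (D.K + 1) (D.K + 1 - i)) z) = π (i + 1) := by
  simp only [farMap]
  congr 1
  omega

/-- The potential is the distance from `v` on the side of `a` and zero beyond `uv`. It is Lipschitz
because `uv` is the only edge between the sides. -/
theorem le_length_path (h : D.Ok π n) {x : V} (hx : x ∉ D.side) (w : D.T.Walk x (π D.K)) :
    D.K ≤ w.length := by
  classical
  have hn := h.hn
  have h1 := h.one_le
  have hlip : ∀ p q, D.T.Adj p q → (if q ∈ D.side then D.T.dist D.v q else 0) ≤
      (if p ∈ D.side then D.T.dist D.v p else 0) + 1 := by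
    intro p q hpq
    by_cases hc : D.cut.Adj p q
    · by_cases hp : p ∈ D.side
      · rw [if_pos hp, if_pos ((mem_side_iff hc).1 hp)]
        have := h.hT.tree.connected.dist_triangle (u := D.v) (v := p) (w := q)
        rwa [dist_eq_one_iff_adj.2 hpq] at this
      · rw [if_neg (fun e => hp ((mem_side_iff hc).2 e))]
        omega
    · rw [cut_adj_iff] at hc
      have hc' : (p = D.u ∧ q = D.v) ∨ (p = D.v ∧ q = D.u) := by tauto
      rcases hc' with ⟨rfl, rfl⟩ | ⟨rfl, rfl⟩
      · rw [if_neg h.v_notMem]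
        omega
      · rw [if_pos h.u_mem, dist_eq_one_iff_adj.2 hpq]
        omega
  have := le_length_of_lipschitz _ hlip w
  have hmem := h.path_mem_side (i := D.K - 1) (by omega)
  rw [Nat.sub_add_cancel h1] at hmem
  rw [if_pos hmem, if_neg hx, h.path_dist D.K (by omega)] at this
  omega

/-- The upper `K` vertices of the short tooth imitate the vertices 1 to `K` of the path `π`, so this
piece looks like a part of `T` whose only exit besides ports is `π K`. -/
theorem isolated_farPart (h : D.Ok π n) (z : Word B V W) :
    Isolated (D.ext G cB) D.K {y | y.1 ∈ farPart D z} := by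
  have hn := h.hn
  have h1 := h.one_le
  refine isolated_of (H := D.T) (fun z => farMap D π z.1) {x | D.c x ≠ none ∨ x = π D.K} ?_ ?_
  · rintro ⟨z', hz⟩ (⟨x, hx, rfl⟩ | ⟨i, hi, rfl⟩) ⟨y, hy⟩ hadj
    · rcases adj_t hy hadj with ⟨x', rfl, h'⟩ | ⟨rfl, -⟩ | ⟨rfl, rfl⟩ | ⟨-, k, h', -⟩
      · exact Or.inl ⟨Or.inl ⟨x', fun e => hx ((mem_side_iff h').2 e), rfl⟩, (cut_adj_iff.1 h').1⟩
      · exact (hx a_mem).elim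
      · refine Or.inl ⟨Or.inr ⟨0, by omega, rfl⟩, ?_⟩
        have := h.path_adj 0 (by omega)
        rw [h.path_zero] at this
        change D.T.Adj D.v (farMap D π (.push (.m false (D.K + 1) (D.K + 1 - 0)) z))
        rwa [farMap_m (by omega)]
      · exact Or.inr (Or.inl (by simp [farMap, h']))
    · simp only [Set.mem_ofPred_eq, farMap_m hi]
      by_cases hiK : i + 1 = D.K
      · exact Or.inr (Or.inr (by rw [hiK]))
      left
      have hup : ∀ i, i + 1 < D.K → D.T.Adj (π (i + 1))
          (farMap D π (.push (.m false (D.K + 1) (D.K + 1 - (i + 1))) z : Word B V W)) := by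
        intro i hi'
        rw [farMap_m (by omega)]
        exact h.path_adj _ (by omega)
      by_cases hi0 : i = 0
      · subst hi0
        rcases adj_m_tip hy hadj with rfl | ⟨-, rfl⟩
        · exact ⟨Or.inr ⟨1, by omega, rfl⟩, hup 0 (by omega)⟩
        · refine ⟨Or.inl ⟨D.v, h.v_notMem, rfl⟩, ?_⟩
          have := h.path_adj 0 (by omega)
          rw [h.path_zero] at this
          exact this.symm
      · rcases adj_m_tooth hy hadj (by omega) (by omega) with rfl | ⟨rfl, -⟩
        · have e : D.K + 1 - i - 1 = D.K + 1 - (i + 1) := by omega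
          rw [e]
          exact ⟨Or.inr ⟨i + 1, by omega, rfl⟩, hup i (by omega)⟩
        · have e : D.K + 1 - i + 1 = D.K + 1 - (i - 1) := by omega
          rw [e]
          refine ⟨Or.inr ⟨i - 1, by omega, rfl⟩, ?_⟩
          rw [farMap_m (by omega)]
          have := h.path_adj i (by omega)
          rw [Nat.sub_add_cancel (by omega)]
          exact this.symm
  · rintro ⟨z', hz⟩ (⟨x, hx, rfl⟩ | ⟨i, hi, rfl⟩) hbr e he w
    · rcases he with he | rfl
      · exact h.hT.port_far e _ he (h.isBranch_t hbr) w
      · exact h.le_length_path hx w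
    · have := (isBranch_m hbr).1
      omega

/-- The exits are the two ends of the spine and the tip of the short tooth. Three potentials, two
horizontal and one vertical, show that each is at least `K` away from the feet of the teeth. -/
theorem isolated_m (b : Bool) (z : Word B V W) :
    Isolated (D.ext G cB) D.K {y | ∃ i j, y.1 = .push (.m b i j) z} := by
  have hN : D.N = 2 * D.K + 10 := rfl
  refine isolated_of (H := combGraph)
    (fun z => match z.1 with | .push (.m _ i j) _ => (i, j) | _ => (0, 0))
    {p | p = (0, 0) ∨ p = (D.N, 0) ∨ p = (D.K + 1, D.K + 1)} ?_ ?_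
  · rintro ⟨z', hz⟩ ⟨i, j, rfl⟩ ⟨y, hy⟩ hadj
    rcases adj_m hy hadj with ⟨i', j', rfl, hc, -⟩ | h | h | h | h
    · exact Or.inl ⟨⟨i', j', rfl⟩, hc⟩
    · exact Or.inr (Or.inl (by simp [h]))
    · exact Or.inr (Or.inr (Or.inl (by simp [h])))
    · exact Or.inr (Or.inr (Or.inr (by simp [h])))
    · cases b
      · exact Or.inr (Or.inl (by simp [h, ri]))
      · exact Or.inr (Or.inr (Or.inl (by simp [h, ri])))
  · rintro ⟨z', hz⟩ ⟨i, j, rfl⟩ hbr e he w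
    obtain ⟨rfl, hi⟩ := isBranch_m hbr
    simp only at w
    rcases he with rfl | rfl | rfl
    · have := le_length_of_lipschitz (fun p : ℕ × ℕ => D.K + 1 - p.1) (by
        rintro ⟨p, p'⟩ ⟨q, q'⟩ hpq
        simp only [combGraph, comb] at hpq ⊢
        omega) w
      simp only at this
      omega
    · have := le_length_of_lipschitz (fun p : ℕ × ℕ => p.1 - (D.K + 3)) (by
        rintro ⟨p, p'⟩ ⟨q, q'⟩ hpq
        simp only [combGraph, comb] at hpq ⊢
        omega) w
      simp only at this
      omega
    · have := le_length_of_lipschitz (fun p : ℕ × ℕ => p.2) (by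
        rintro ⟨p, p'⟩ ⟨q, q'⟩ hpq
        simp only [combGraph, comb] at hpq ⊢
        omega) w
      simp only at this
      omega

/-- An embedding of a tight graph into an extension goes to the base, to a copy of `S`, or gives a
non-surjective embedding into `T`. -/
theorem embed_cases (h : D.Ok π n) (hB : PortTree D.K G cB) {X : Type} {P : SimpleGraph X}
    (hP : Tight P D.K) (h4 : ∃ f : Fin 4 → X, Injective f ∧ ∀ i, IsBranch P (f i))
    {f : X → D.Vert cB} (hf : IsEmb f P (D.ext G cB)) :
    (∃ σ : X → B, IsEmb σ P G ∧ ∀ x, (f x).1 = .base (σ x)) ∨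
    (∃ (z : Word B V W) (σ : X → W), IsEmb σ P D.S ∧ ∀ x, (f x).1 = .push (.s (σ x)) z) ∨
    (∃ τ : X → V, IsEmb τ P D.T ∧ ¬ Surjective τ) := by
  have hn := h.hn
  obtain ⟨b, hb, hbr⟩ := h4
  have hx₀ := hbr 0
  have hval : ∀ {x y}, (f x).1 = (f y).1 → x = y := fun e => hf.inj (Subtype.ext e)
  have hadj : ∀ {x y}, P.Adj x y → D.wadj G (f x).1 (f y).1 := fun e => hf.adj _ _ e
  rcases hx : (f (b 0)).1 with x | ⟨⟨b', i, j⟩ | q | x, z⟩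
  · left
    have hU := hP.mem_of_isEmb hf (isolated_base hB) hx₀ ⟨x, hx⟩
    choose σ hσ using hU
    refine ⟨σ, ⟨fun p q e => hval (by rw [hσ, hσ, e]), fun p q e => ?_⟩, hσ⟩
    have := hadj e
    rw [hσ, hσ] at this
    exact this
  · exfalso
    have hU := hP.mem_of_isEmb hf (isolated_m b' z) hx₀ ⟨i, j, hx⟩
    choose σ τ hσ using hU
    -- The four branch vertices of `P` would have to go to the three feet of the teeth.
    have hcol : ∀ k, τ (b k) = 0 ∧
        (σ (b k) = D.K + 1 ∨ σ (b k) = D.K + 2 ∨ σ (b k) = D.K + 3) := by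
      intro k
      have h1 := (hbr k).map hf
      have h2 := hσ (b k)
      revert h1 h2
      generalize f (b k) = y
      rintro h1 h2
      obtain ⟨y, hy⟩ := y
      simp only at h2
      subst h2
      exact isBranch_m h1
    have hinj : Injective (fun k : Fin 4 => (⟨σ (b k) - (D.K + 1), by
        have := (hcol k).2; omega⟩ : Fin 3)) := by
      intro k l e
      simp only [Fin.mk.injEq] at e
      refine hb (hval ?_)
      have h1 := hcol k
      have h2 := hcol l
      rw [hσ, hσ, h1.1, h2.1, show σ (b k) = σ (b l) by omega]
    have := Fintype.card_le_of_injective _ hinj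
    simp at this
  · right; left
    have hU := hP.mem_of_isEmb hf (h.isolated_s z) hx₀ ⟨q, hx⟩
    choose σ hσ using hU
    refine ⟨z, σ, ⟨fun p q e => hval (by rw [hσ, hσ, e]), fun p q e => ?_⟩, hσ⟩
    have := hadj e
    rw [hσ, hσ, D.wadj_push] at this
    rcases this with ⟨g', e', hl⟩ | ⟨-, hr⟩ | ⟨g', -, e'⟩
    · obtain rfl := (Word.push.inj e').1
      exact hl
    · exact hr.elim
    · exact (push_ne _ _ (Word.push.inj e').2.symm).elim
  · right; right
    -- On the side of `a` the induced map to `T` misses `v`. Beyond `uv`, with the tooth laid along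
    -- `π`, it misses `π (K + 1)`.
    by_cases hside : x ∈ D.side
    · have hU := hP.mem_of_isEmb hf (h.isolated_side z) hx₀ ⟨x, hside, hx⟩
      choose τ hτs hτ using hU
      refine ⟨τ, ⟨fun p q e => hval (by rw [hτ, hτ, e]), fun p q e => ?_⟩, fun hsurj => ?_⟩
      · have := hadj e
        rw [hτ, hτ, D.wadj_push] at this
        rcases this with ⟨g', e', hl⟩ | ⟨-, hr⟩ | ⟨g', -, e'⟩
        · obtain rfl := (Word.push.inj e').1
          exact (cut_adj_iff.1 hl).1
        · exact hr.elim
        · exact (push_ne _ _ (Word.push.inj e').2.symm).elim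
      · obtain ⟨y, hy⟩ := hsurj D.v
        exact h.v_notMem (hy ▸ hτs y)
    · have hU := hP.mem_of_isEmb hf (h.isolated_farPart z) hx₀ (Or.inl ⟨x, hside, hx⟩)
      have hpath : ∀ i < D.K, π (i + 1) ∈ D.side := fun i hi => h.path_mem_side (by omega)
      have hpinj : ∀ i ≤ D.K, ∀ j ≤ D.K, π (i + 1) = π (j + 1) → i = j := by
        intro i hi j hj e
        have h1 := h.path_dist (i + 1) (by omega)
        rw [e, h.path_dist (j + 1) (by omega)] at h1
        omega
      refine ⟨fun x => farMap D π (f x).1, ⟨fun p q e => hval ?_, fun p q e => ?_⟩,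
        fun hsurj => ?_⟩
      · rcases hU p with ⟨x, hx, e₁⟩ | ⟨i, hi, e₁⟩ <;> rcases hU q with ⟨y, hy, e₂⟩ | ⟨j, hj, e₂⟩ <;>
          rw [e₁, e₂] at e ⊢
        · rw [show x = y from e]
        · rw [farMap_m hj] at e
          exact (hx ((show x = π (j + 1) from e) ▸ hpath j hj)).elim
        · rw [farMap_m hi] at e
          exact (hy ((show π (i + 1) = y from e) ▸ hpath i hi)).elim
        · rw [farMap_m hi, farMap_m hj] at e
          rw [hpinj i hi.le j hj.le e]
      · have hw := hadj e
        rcases hU p with ⟨x, hx, e₁⟩ | ⟨i, hi, e₁⟩ <;> rcases hU q with ⟨y, hy, e₂⟩ | ⟨j, hj, e₂⟩ <;>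
          rw [e₁, e₂] at hw ⊢ <;> rw [D.wadj_push] at hw <;>
          rcases hw with ⟨g', e', hl⟩ | ⟨e', hr⟩ | ⟨g', -, e'⟩
        any_goals exact (push_ne _ _ (Word.push.inj e').2.symm).elim
        any_goals exact (push_ne _ _ e').elim
        · obtain rfl := (Word.push.inj e').1
          exact (cut_adj_iff.1 hl).1
        · obtain rfl := (Word.push.inj e').1
          obtain ⟨-, ⟨h1, -⟩ | ⟨-, h1, rfl⟩⟩ := hl
          · have : D.N = 2 * D.K + 10 := rfl
            omega
          · rw [farMap_m hj, show j = 0 by omega, ← h.path_zero]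
            exact h.path_adj 0 (by omega)
        · obtain rfl := (Word.push.inj e').1
          obtain ⟨-, ⟨h1, -⟩ | ⟨-, h1, rfl⟩⟩ := hl
          · have : D.N = 2 * D.K + 10 := rfl
            omega
          · rw [farMap_m hi, show i = 0 by omega]
            simp only [farMap]
            rw [← h.path_zero]
            exact (h.path_adj 0 (by omega)).symm
        · obtain rfl := (Word.push.inj e').1
          rw [farMap_m hi, farMap_m hj]
          have hc : comb _ _ _ _ := hl.2
          unfold comb at hc
          rcases (show j = i + 1 ∨ i = j + 1 by omega) with rfl | rfl
          · exact h.path_adj _ (by omega)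
          · exact (h.path_adj _ (by omega)).symm
      · obtain ⟨y, hy⟩ := hsurj (π (D.K + 1))
        simp only at hy
        rcases hU y with ⟨x, hx, e₁⟩ | ⟨i, hi, e₁⟩ <;> rw [e₁] at hy
        · have hy' : x = π (D.K + 1) := hy
          exact hx (hy' ▸ h.path_mem_side (by have := h.hn; omega))
        · rw [farMap_m hi] at hy
          have := hpinj i hi.le D.K le_rfl hy
          omega

end Ok

end Gadget

/-! ### The extension of `S` does not send `S` to one of its copies. -/

namespace Gadget

variable {A B V W : Type} {D : Gadget V W} {π : ℕ → V} {n : ℕ} {G : SimpleGraph B}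
  {cB : B → Option Bool} {P : SimpleGraph A} {cA : A → Option Bool}

/-- Along a path whose inner vertices have degree two, an embedding is determined by its first
step. -/
theorem forced_path {f : D.Vert cA → D.Vert cB} (hf : IsEmb f (D.ext P cA) (D.ext G cB)) {n : ℕ}
    (p : ℕ → Word A V W) (t : ℕ → Word B V W) (hv : ∀ i ≤ n, D.Valid cA (p i))
    (hp : ∀ i < n, D.wadj P (p i) (p (i + 1))) (hpne : ∀ i, i + 2 ≤ n → p (i + 2) ≠ p i)
    (ht : ∀ i, i + 2 ≤ n → ∀ y, D.Valid cB y → D.wadj G (t (i + 1)) y → y = t i ∨ y = t (i + 2))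
    (h0 : ∀ hz, (f ⟨p 0, hz⟩).1 = t 0) (h1 : ∀ hz, (f ⟨p 1, hz⟩).1 = t 1) :
    ∀ i ≤ n, ∀ hz, (f ⟨p i, hz⟩).1 = t i := by
  have key : ∀ i, i + 1 ≤ n →
      (∀ hz, (f ⟨p i, hz⟩).1 = t i) ∧ (∀ hz, (f ⟨p (i + 1), hz⟩).1 = t (i + 1)) := by
    intro i
    induction i with
    | zero => exact fun _ => ⟨h0, h1⟩
    | succ i ih =>
      intro hi
      obtain ⟨ha, hb⟩ := ih (by omega)
      refine ⟨hb, fun hz => ?_⟩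
      have hadj : D.wadj G (f ⟨_, hv (i + 1) (by omega)⟩).1 (f ⟨_, hz⟩).1 :=
        hf.adj _ _ (hp (i + 1) (by omega))
      rw [hb] at hadj
      rcases ht i (by omega) _ (f ⟨_, hz⟩).2 hadj with h | h
      · rw [← ha (hv i (by omega))] at h
        exact (hpne i (by omega) (congrArg Subtype.val (hf.inj (Subtype.ext h)))).elim
      · exact h
  intro i hi
  cases i with
  | zero => exact h0
  | succ i => exact (key i hi).2

namespace Ok

/-- In a true comb the short tooth is a dead end of height `K + 1`, too short for a path with `K +
2` edges that starts up it. -/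
theorem not_into_tooth {f : D.Vert cA → D.Vert cB}
    (hf : IsEmb f (D.ext P cA) (D.ext G cB)) (p : ℕ → Word A V W) {z : Word B V W}
    (hv : ∀ i ≤ D.K + 2, D.Valid cA (p i)) (hp : ∀ i < D.K + 2, D.wadj P (p i) (p (i + 1)))
    (hpne : ∀ i, i + 2 ≤ D.K + 2 → p (i + 2) ≠ p i)
    (h0 : ∀ hz, (f ⟨p 0, hz⟩).1 = .push (.m true (D.K + 1) 0) z)
    (h1 : ∀ hz, (f ⟨p 1, hz⟩).1 = .push (.m true (D.K + 1) 1) z) : False := by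
  have key := forced_path hf (n := D.K + 1) p (fun j => .push (.m true (D.K + 1) j) z)
    (fun i hi => hv i (by omega)) (fun i hi => hp i (by omega)) (fun i hi => hpne i (by omega))
    (fun i hi y hy hadj => by
      rcases adj_m_tooth hy hadj (by omega) (by omega) with e | ⟨e, -⟩
      · exact Or.inl e
      · exact Or.inr e) h0 h1
  have hadj : D.wadj G (f ⟨_, hv (D.K + 1) (by omega)⟩).1 (f ⟨_, hv (D.K + 2) le_rfl⟩).1 :=
    hf.adj _ _ (hp (D.K + 1) (by omega))
  rw [key _ le_rfl] at hadj
  rcases adj_m_tip (f ⟨_, hv (D.K + 2) le_rfl⟩).2 hadj with e | ⟨e, -⟩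
  · rw [← key D.K (by omega) (hv D.K (by omega))] at e
    exact hpne D.K le_rfl (congrArg Subtype.val (hf.inj (Subtype.ext e)))
  · cases e

/-- The comb glued to a false port `q` of `S` must continue into whatever hangs at the copy of `σ
q`. This forces `σ q` to be a false port other than `s`. But `σ` maps the false ports into
themselves, so by rigidity onto themselves, and `s` would be in the image. -/
theorem not_into_s (h : D.Ok π n) {f : D.Vert D.d → D.Vert cB}
    (hf : IsEmb f (D.ext D.S D.d) (D.ext G cB)) {z : Word B V W} {σ : W → W}
    (hσ : IsEmb σ D.S D.S) (hfs : ∀ q, (f (D.inl D.d q)).1 = .push (.s (σ q)) z) : False := by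
  have hN : D.N = 2 * D.K + 10 := rfl
  have hK := h.one_le
  have hsurj := h.hS.surjective hσ
  suffices key : ∀ q, D.d q = some false → D.d (σ q) = some false ∧ σ q ≠ D.s by
    obtain ⟨q, hq, hqs⟩ := h.hS.rigid.surjOn h.hS.tree.connected h.hS.finite hσ
      (A := {q | D.d q = some false}) (fun q hq => (key q hq).1) h.ds
    exact (key q hq).2 hqs
  intro q hq
  have hvm : ∀ i j, i ≤ D.N → j ≤ D.tooth i →
      D.Valid D.d (.push (.m false i j) (.base q) : Word W V W) :=
    fun i j hi hj => valid_m trivial hq hi hj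
  have hadj : D.wadj G (f (D.inl D.d q)).1 (f ⟨_, hvm 0 0 (by omega) (Nat.zero_le _)⟩).1 :=
    hf.adj _ _ ⟨rfl, rfl, rfl⟩
  rw [hfs] at hadj
  have hspine : ∀ i, D.wadj D.S (.push (.m false i 0) (.base q)) (.push (.m false (i + 1) 0) (.base q)) :=
    fun i => wadj_of_ladj _ _ _ ⟨rfl, Or.inr ⟨rfl, rfl, Or.inl rfl⟩⟩
  have htooth : ∀ i j, D.wadj D.S (.push (.m false i j) (.base q))
      (.push (.m false i (j + 1)) (.base q)) :=
    fun i j => wadj_of_ladj _ _ _ ⟨rfl, Or.inl ⟨rfl, Or.inl rfl⟩⟩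
  have hspv : ∀ i ≤ D.K + 1, D.Valid D.d (.push (.m false i 0) (.base q) : Word W V W) :=
    fun i hi => hvm i 0 (by omega) (Nat.zero_le _)
  have hstep : ∀ t : ℕ → Word B V W, (∀ i, i + 2 ≤ D.K + 1 → ∀ y, D.Valid cB y →
      D.wadj G (t (i + 1)) y → y = t i ∨ y = t (i + 2)) →
      (f ⟨_, hvm 0 0 (by omega) (Nat.zero_le _)⟩).1 = t 0 →
      (f ⟨_, hvm 1 0 (by omega) (Nat.zero_le _)⟩).1 = t 1 →
      ∀ i ≤ D.K + 1, ∀ hz, (f ⟨.push (.m false i 0) (.base q), hz⟩).1 = t i := by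
    intro t ht h0 h1
    exact forced_path hf (fun i => .push (.m false i 0) (.base q)) t hspv (fun i _ => hspine i)
      (fun i _ e => by simp at e) ht (fun _ => h0) (fun _ => h1)
  have hadj' : D.wadj G (f ⟨_, hvm 0 0 (by omega) (Nat.zero_le _)⟩).1
      (f ⟨_, hvm 1 0 (by omega) (Nat.zero_le _)⟩).1 := hf.adj _ _ (hspine 0)
  have hne : (f ⟨_, hvm 1 0 (by omega) (Nat.zero_le _)⟩).1 ≠ (f (D.inl D.d q)).1 := by
    intro e
    cases congrArg Subtype.val (hf.inj (Subtype.ext e))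
  rw [hfs] at hne
  rcases adj_s (f ⟨_, hvm 0 0 (by omega) (Nat.zero_le _)⟩).2 hadj with
    ⟨q', e, -⟩ | ⟨hs, e⟩ | ⟨hs, k, hk, e⟩
  · obtain ⟨q'', rfl⟩ := hsurj q'
    rw [← hfs] at e
    cases congrArg Subtype.val (hf.inj (Subtype.ext e))
  · exfalso
    rw [e] at hadj'
    have h1 : (f ⟨_, hvm 1 0 (by omega) (Nat.zero_le _)⟩).1 = .push (.m true 1 0) z := by
      rcases adj_m_zero (f ⟨_, hvm 1 0 (by omega) (Nat.zero_le _)⟩).2 hadj' with e' | ⟨-, e'⟩ | ⟨e', -⟩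
      · exact e'
      · exact (hne (hs ▸ e')).elim
      · cases e'
    have key := hstep (fun i => .push (.m true i 0) z) (fun i hi y hy ha => by
      rcases adj_m_spine hy ha (by omega) (by omega) with e' | e' | ⟨-, e'⟩
      · exact Or.inl e'
      · exact Or.inr e'
      · omega) e h1
    have hadjK : ∀ y : D.Vert D.d,
        D.wadj D.S (.push (.m false (D.K + 1) 0) (.base q)) y.1 →
        y.1 ≠ .push (.m false D.K 0) (.base q) →
        (f y).1 = .push (.m true (D.K + 2) 0) z ∨ (f y).1 = .push (.m true (D.K + 1) 1) z := by
      intro y hy hyne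
      have ha : D.wadj G (f ⟨_, hspv (D.K + 1) le_rfl⟩).1 (f y).1 := hf.adj _ _ hy
      rw [key _ le_rfl] at ha
      rcases adj_m_spine (f y).2 ha (by omega) (by omega) with e' | e' | ⟨e', -⟩
      · have e'' : (f y).1 = .push (.m true D.K 0) z := e'
        rw [← key D.K (by omega) (hspv _ (by omega))] at e''
        exact (hyne (congrArg Subtype.val (hf.inj (Subtype.ext e'')))).elim
      · exact Or.inl e'
      · exact Or.inr e'
    have htv : ∀ j ≤ D.K + 1, D.Valid D.d (.push (.m false (D.K + 1) j) (.base q) : Word W V W) :=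
      fun j hj => hvm _ _ (by omega) (by simpa [tooth] using hj)
    have htip : D.wadj D.S (.push (.m false (D.K + 1) (D.K + 1)) (.base q))
        (.push (.t D.v) (.base q)) :=
      wadj_of_ladj _ _ _ ⟨rfl, Or.inr ⟨rfl, rfl, rfl⟩⟩
    -- The tooth or the spine of the false comb has to enter the short tooth of the true comb, and
    -- both go on for `K + 2` steps: the tooth through its edge to the copy of `v`, the spine
    -- because `N` is large.
    rcases hadjK ⟨_, htv 1 (by omega)⟩ (htooth _ _) (by simp) with e₁ | e₁
    · rcases hadjK ⟨_, hvm (D.K + 2) 0 (by omega) (Nat.zero_le _)⟩ (hspine _) (by simp) with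
        e₂ | e₂
      · have := congrArg Subtype.val (hf.inj (Subtype.ext (e₁.trans e₂.symm)))
        simp at this
      · refine not_into_tooth hf (fun i => .push (.m false (D.K + 1 + i) 0) (.base q)) (z := z)
          (fun i hi => hvm _ _ (by omega) (Nat.zero_le _)) (fun i _ => hspine _)
          (fun i _ e' => by simp at e') (key _ le_rfl) (fun _ => e₂)
    · refine not_into_tooth hf (fun i => if i = D.K + 2 then .push (.t D.v) (.base q) else
        .push (.m false (D.K + 1) i) (.base q)) (z := z) (fun i hi => ?_) (fun i hi => ?_)
        (fun i hi => ?_) ?_ ?_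
      · by_cases hi' : i = D.K + 2
        · simp only [hi', if_true]
          exact ⟨trivial, trivial, hq⟩
        · simp only [hi', if_false]
          exact htv i (by omega)
      · by_cases hi' : i = D.K + 1
        · subst hi'
          simpa using htip
        · simpa [show i ≠ D.K + 2 by omega, hi'] using htooth (D.K + 1) i
      · by_cases hi' : i = D.K
        · subst hi'
          simp
        · simp [show i ≠ D.K + 2 by omega, hi']
      · simpa using key (D.K + 1) le_rfl
      · simpa [show (1 : ℕ) ≠ D.K + 2 by omega] using fun _ => e₁
  · cases k with
    | false => exact ⟨hk, hs⟩
    | true =>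
      exfalso
      have e' : (f ⟨_, hvm 0 0 (by omega) (Nat.zero_le _)⟩).1 =
          .push (.m true D.N 0) (.push (.s (σ q)) z) := e
      rw [e'] at hadj'
      have h1 : (f ⟨_, hvm 1 0 (by omega) (Nat.zero_le _)⟩).1 =
          .push (.m true (D.N - 1) 0) (.push (.s (σ q)) z) := by
        rcases adj_m_N (f ⟨_, hvm 1 0 (by omega) (Nat.zero_le _)⟩).2 hadj' with e' | ⟨e', -⟩ | ⟨-, e'⟩
        · exact e'
        · cases e'
        · exact (hne e').elim
      have key := hstep (fun i => .push (.m true (D.N - i) 0) (.push (.s (σ q)) z))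
        (fun i hi y hy ha => by
          rcases adj_m_spine hy ha (by omega) (by omega) with e' | e' | ⟨-, e'⟩
          · exact Or.inr (e'.trans (by congr 2))
          · exact Or.inl (e'.trans (by congr 2; omega))
          · omega) e' h1
      -- From its end `N` the target comb has no branch vertex after `K + 1` steps, since `N - (K +
      -- 1)` exceeds `K + 3`; the false comb has one there.
      have hbr := (h.isBranch_mk_m (G := D.S) (Or.inl rfl) (hspv (D.K + 1) le_rfl)).map hf
      have e₃ : f ⟨_, hspv (D.K + 1) le_rfl⟩ = ⟨_, key (D.K + 1) le_rfl (hspv _ le_rfl) ▸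
          (f ⟨_, hspv (D.K + 1) le_rfl⟩).2⟩ := Subtype.ext (key (D.K + 1) le_rfl (hspv _ le_rfl))
      rw [e₃] at hbr
      have := isBranch_m hbr
      omega

end Ok

end Gadget

/-! ### Good pairs and extensions. -/

/-- Two trees with ports at scale `K`, none of which embeds into the other. -/
structure Good {V W : Type} (K : ℕ) (T : SimpleGraph V) (c : V → Option Bool) (S : SimpleGraph W)
    (d : W → Option Bool) : Prop where
  left : PortTree K T c
  right : PortTree K S d
  one_le : 1 ≤ K
  left_right : ∀ f, ¬ IsEmb f T S
  right_left : ∀ f, ¬ IsEmb f S T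

theorem Good.symm {V W : Type} {K : ℕ} {T : SimpleGraph V} {c : V → Option Bool}
    {S : SimpleGraph W} {d : W → Option Bool} (h : Good K T c S d) : Good K S d T c :=
  ⟨h.right, h.left, h.one_le, h.right_left, h.left_right⟩

/-- `ι` embeds `G` into a larger tree `G'` that leaves `G` only at its ports. -/
structure Extends {V V' : Type} (G : SimpleGraph V) (c : V → Option Bool) (G' : SimpleGraph V')
    (c' : V' → Option Bool) (ι : V → V') : Prop where
  inj : Injective ι
  adj : ∀ x y, G'.Adj (ι x) (ι y) ↔ G.Adj x y
  closed : ∀ x, c x = none → ∀ y, G'.Adj (ι x) y → y ∈ Set.range ι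
  col : ∀ x, c' (ι x) = none
  branch : ∀ x, IsBranch G' (ι x) → IsBranch G x

theorem Extends.comp {V V' V'' : Type} {G : SimpleGraph V} {c : V → Option Bool}
    {G' : SimpleGraph V'} {c' : V' → Option Bool} {G'' : SimpleGraph V''}
    {c'' : V'' → Option Bool} {ι : V → V'} {κ : V' → V''} (h' : Extends G' c' G'' c'' κ)
    (h : Extends G c G' c' ι) : Extends G c G'' c'' (κ ∘ ι) := by
  refine ⟨h'.inj.comp h.inj, fun x y => (h'.adj _ _).trans (h.adj _ _), fun x hx y hy => ?_,
    fun x => h'.col _, fun x hx => h.branch _ (h'.branch _ hx)⟩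
  obtain ⟨y, rfl⟩ := h'.closed _ (h.col x) _ hy
  obtain ⟨y, rfl⟩ := h.closed _ hx _ ((h'.adj _ _).1 hy)
  exact ⟨y, rfl⟩

namespace Gadget

variable {A B V W : Type} {D : Gadget V W} {π : ℕ → V} {n : ℕ} {G : SimpleGraph B}
  {cB : B → Option Bool} {P : SimpleGraph A} {cA : A → Option Bool}

theorem push_notMem_range {g : Loc V W} {z : Word B V W} (hz : D.Valid cB (.push g z)) :
    (⟨_, hz⟩ : D.Vert cB) ∉ Set.range (D.inl cB) := by
  rintro ⟨x, hx⟩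
  cases congrArg Subtype.val hx

theorem extends_inl (hB : PortTree D.K G cB) :
    Extends G cB (D.ext G cB) (D.newCol cB) (D.inl cB) := by
  refine ⟨D.isEmb_inl.inj (H := D.ext G cB) (G := G), fun x y => Iff.rfl, ?_, fun x => rfl,
    fun x hx => (Ok.isBranch_base hB hx).2⟩
  rintro x hx ⟨y, hy⟩ hadj
  rcases adj_base hy hadj with ⟨x', rfl, h'⟩ | ⟨k, h', -⟩
  · exact ⟨x', rfl⟩
  · simp [hx] at h'

/-- Change the base of an address. -/
def mapWord (e : A → B) : Word A V W → Word B V W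
  | .base x => .base (e x)
  | .push g z => .push g (mapWord e z)

theorem mapWord_mapWord {C : Type} (e : A → B) (e' : B → C) (h : A → C) (he : ∀ x, e' (e x) = h x)
    (z : Word A V W) : mapWord e' (mapWord e z) = mapWord h z := by
  induction z with
  | base x => simp [mapWord, he]
  | push g z ih => simp [mapWord, ih]

theorem mapWord_id (z : Word A V W) : mapWord id z = z := by
  induction z with
  | base x => rfl
  | push g z ih => simp [mapWord, ih]

theorem valid_mapWord {e : A → B} (he : ∀ x, cB (e x) = cA x) {z : Word A V W}
    (hz : D.Valid cA z) : D.Valid cB (mapWord e z) := by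
  induction z with
  | base x => trivial
  | push g z ih =>
    refine ⟨ih hz.1, hz.2.1, ?_⟩
    rw [← hz.2.2]
    cases z with
    | base x => exact he x
    | push g z => rfl

theorem wadj_mapWord {e : A → B} (he : Injective e) {v : A}
    (hadj : ∀ x y, x ≠ v → y ≠ v → (P.Adj x y ↔ G.Adj (e x) (e y))) :
    ∀ z y : Word A V W, z ≠ .base v → y ≠ .base v →
      (D.wadj P z y ↔ D.wadj G (mapWord e z) (mapWord e y)) := by
  have hinj : Injective (mapWord (V := V) (W := W) e) := by
    intro z
    induction z with
    | base x =>
      intro y hy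
      cases y with
      | base y => exact congrArg _ (he (Word.base.inj hy))
      | push g y => cases hy
    | push g z ih =>
      intro y hy
      cases y with
      | base y => cases hy
      | push g y =>
        obtain ⟨rfl, h⟩ := Word.push.inj hy
        rw [ih h]
  intro z y hz hy
  cases z with
  | base x =>
    cases y with
    | base y => exact hadj x y (fun h => hz (h ▸ rfl)) (fun h => hy (h ▸ rfl))
    | push g y => exact and_congr_left' (hinj.eq_iff (b := .base x)).symm
  | push g z =>
    cases y with
    | base y => exact and_congr_left' (hinj.eq_iff (b := .base y)).symm
    | push g' y =>
      exact or_congr (and_congr_left' hinj.eq_iff.symm) (or_congr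
        (and_congr_left' (hinj.eq_iff (b := .push g z)).symm)
        (and_congr_left' (hinj.eq_iff (b := .push g' y)).symm))

/-- Gadgets depend only on colours, so changing the base vertex of every address by `e` is a
bijection. The new ports lie in gadgets, whose positions it leaves unchanged. -/
theorem _root_.TreeRecon.Promise.ext {v : A} {e : A ≃ B} (h : Promise P cA G cB v e) :
    ∃ e' : D.Vert cA ≃ D.Vert cB,
      Promise (D.ext P cA) (D.newCol cA) (D.ext G cB) (D.newCol cB) (D.inl cA v) e' ∧
      ∀ x, e' (D.inl cA x) = D.inl cB (e x) := by
  refine ⟨⟨fun z => ⟨mapWord e z.1, valid_mapWord h.col z.2⟩,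
    fun z => ⟨mapWord e.symm z.1, valid_mapWord h.symm.col z.2⟩, fun z => Subtype.ext ?_,
    fun z => Subtype.ext ?_⟩, ⟨?_, ?_⟩, fun x => rfl⟩
  · simp only
    rw [mapWord_mapWord e e.symm id (by simp), mapWord_id]
  · simp only
    rw [mapWord_mapWord e.symm e id (by simp), mapWord_id]
  · rintro ⟨z, hz⟩
    cases z <;> rfl
  · intro x y hx hy
    exact wadj_mapWord e.injective h.adj _ _ (fun h => hx (Subtype.ext h))
      (fun h => hy (Subtype.ext h))

/-! ### The promise for the treated vertex. -/

section Swap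

open Classical in
/-- The isomorphism from the extension of `T` without `v` to the extension of `S` without the copy
of `v` in the gadget at `s`. -/
noncomputable def swap (D : Gadget V W) : Word V V W → Word W V W
  | .base x => .push (.t x) (.base D.s)
  | .push g z => if z = .base D.a then
      match g with
      | .m _ i j => .push (.m false i j) (.base D.s)
      | .s y => .base y
      | .t _ => .base D.s
    else .push g (swap D z)

open Classical in
noncomputable def swapInv (D : Gadget V W) : Word W V W → Word V V W
  | .base y => .push (.s y) (.base D.a)
  | .push g z => if z = .base D.s then
      match g with
      | .m _ i j => .push (.m true i j) (.base D.a)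
      | .s _ => .base D.a
      | .t x => .base x
    else .push g (swapInv D z)

theorem wadj_child (G : SimpleGraph B) {g : Loc V W} (hg : D.isRoot g) (z : Word B V W) :
    D.wadj G z (.push g z) := by
  cases z with
  | base x => exact ⟨rfl, hg⟩
  | push g' z => exact Or.inr (Or.inl ⟨rfl, hg⟩)

theorem swap_push {g : Loc V W} {z : Word V V W} (hz : z ≠ .base D.a) :
    D.swap (.push g z) = .push g (D.swap z) := by simp [swap, hz]

theorem swapInv_push {g : Loc V W} {z : Word W V W} (hz : z ≠ .base D.s) :
    D.swapInv (.push g z) = .push g (D.swapInv z) := by simp [swapInv, hz]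

theorem not_valid_push_s {g : Loc V W} :
    ¬ D.Valid D.c (.push g (.push (.s D.s) (.base D.a))) := by
  intro h
  have := h.2.2
  simp [col, lcol] at this

theorem not_valid_push_t {g : Loc V W} :
    ¬ D.Valid D.d (.push g (.push (.t D.a) (.base D.s))) := by
  intro h
  have := h.2.2
  simp [col, lcol] at this

theorem cases_kind_true (ca : D.c D.a = some true) {g : Loc V W}
    (h : D.Valid D.c (.push g (.base D.a))) : (∃ i j, g = .m true i j) ∨ ∃ y, g = .s y := by
  have := h.2.2
  rw [col, ca] at this
  cases g with
  | m b i j => cases b <;> simp [kind] at this ⊢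
  | s y => simp
  | t x => simp [kind] at this

theorem cases_kind_false (ds : D.d D.s = some false) {g : Loc V W}
    (h : D.Valid D.d (.push g (.base D.s))) : (∃ i j, g = .m false i j) ∨ ∃ x, g = .t x := by
  have := h.2.2
  rw [col, ds] at this
  cases g with
  | m b i j => cases b <;> simp [kind] at this ⊢
  | s y => simp [kind] at this
  | t x => simp

theorem swapInv_swap (ca : D.c D.a = some true) :
    ∀ z : Word V V W, D.Valid D.c z → D.swapInv (D.swap z) = z := by
  intro z
  induction z with
  | base x => simp [swap, swapInv]
  | push g z ih =>
    intro h
    by_cases hz : z = .base D.a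
    · subst hz
      rcases cases_kind_true ca h with ⟨i, j, rfl⟩ | ⟨y, rfl⟩ <;> simp [swap, swapInv]
    · rw [swap_push hz, swapInv_push, ih h.1]
      intro e
      have := ih h.1
      rw [e] at this
      subst this
      exact not_valid_push_s h

theorem swap_swapInv (ds : D.d D.s = some false) :
    ∀ z : Word W V W, D.Valid D.d z → D.swap (D.swapInv z) = z := by
  intro z
  induction z with
  | base x => simp [swap, swapInv]
  | push g z ih =>
    intro h
    by_cases hz : z = .base D.s
    · subst hz
      rcases cases_kind_false ds h with ⟨i, j, rfl⟩ | ⟨y, rfl⟩ <;> simp [swap, swapInv]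
    · rw [swapInv_push hz, swap_push, ih h.1]
      intro e
      have := ih h.1
      rw [e] at this
      subst this
      exact not_valid_push_t h

/-- The exceptions are the two ends of the central comb. The base vertex `a` is coloured and becomes
an uncoloured copy, while the uncoloured copy of `s` becomes the coloured base vertex; the comb
accounts for both. -/
theorem col_swap (ca : D.c D.a = some true) {z : Word V V W} (hz : D.Valid D.c z)
    (h1 : z ≠ .base D.a) (h2 : z ≠ .push (.s D.s) (.base D.a)) :
    D.col D.d (D.swap z) = D.col D.c z := by
  cases z with
  | base x =>
    have : x ≠ D.a := fun h => h1 (h ▸ rfl)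
    simp [swap, col, lcol, this]
  | push g z =>
    by_cases h : z = .base D.a
    · subst h
      rcases cases_kind_true ca hz with ⟨i, j, rfl⟩ | ⟨y, rfl⟩
      · simp [swap, col, lcol]
      · have : y ≠ D.s := fun h => h2 (h ▸ rfl)
        simp [swap, col, lcol, this]
    · rw [swap_push h]
      rfl

theorem col_swapInv (ds : D.d D.s = some false) {z : Word W V W} (hz : D.Valid D.d z)
    (h1 : z ≠ .base D.s) (h2 : z ≠ .push (.t D.a) (.base D.s)) :
    D.col D.c (D.swapInv z) = D.col D.d z := by
  cases z with
  | base x =>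
    have : x ≠ D.s := fun h => h1 (h ▸ rfl)
    simp [swapInv, col, lcol, this]
  | push g z =>
    by_cases h : z = .base D.s
    · subst h
      rcases cases_kind_false ds hz with ⟨i, j, rfl⟩ | ⟨y, rfl⟩
      · simp [swapInv, col, lcol]
      · have : y ≠ D.a := fun h => h2 (h ▸ rfl)
        simp [swapInv, col, lcol, this]
    · rw [swapInv_push h]
      rfl

theorem valid_swap (ca : D.c D.a = some true) (ds : D.d D.s = some false) {z : Word V V W}
    (h : D.Valid D.c z) : D.Valid D.d (D.swap z) := by
  induction z with
  | base x => exact ⟨trivial, trivial, ds⟩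
  | push g z ih =>
    by_cases hz : z = .base D.a
    · subst hz
      rcases cases_kind_true ca h with ⟨i, j, rfl⟩ | ⟨y, rfl⟩
      · simpa [swap] using valid_m (D := D) (cB := D.d) (z := .base D.s) trivial ds h.2.1.1 h.2.1.2
      · simp [swap, Valid]
    · rw [swap_push hz]
      refine ⟨ih h.1, h.2.1, ?_⟩
      rw [col_swap ca h.1 hz, h.2.2]
      rintro rfl
      exact not_valid_push_s h

theorem valid_swapInv (ca : D.c D.a = some true) (ds : D.d D.s = some false) {z : Word W V W}
    (h : D.Valid D.d z) : D.Valid D.c (D.swapInv z) := by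
  induction z with
  | base x => exact ⟨trivial, trivial, ca⟩
  | push g z ih =>
    by_cases hz : z = .base D.s
    · subst hz
      rcases cases_kind_false ds h with ⟨i, j, rfl⟩ | ⟨y, rfl⟩
      · simpa [swapInv] using
          valid_m (D := D) (cB := D.c) (z := .base D.a) trivial ca h.2.1.1 h.2.1.2
      · simp [swapInv, Valid]
    · rw [swapInv_push hz]
      refine ⟨ih h.1, h.2.1, ?_⟩
      rw [col_swapInv ds h.1 hz, h.2.2]
      rintro rfl
      exact not_valid_push_t h

/-- To check that a map preserves adjacency it suffices to consider edges of the base, edges from a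
vertex to the root of the gadget attached at it, and edges inside a gadget. -/
theorem wadj_induction {R : Word B V W → Word B V W → Prop} (hsymm : ∀ x y, R x y → R y x)
    (hbase : ∀ x y, G.Adj x y → R (.base x) (.base y))
    (hchild : ∀ g z, D.isRoot g → D.Valid cB (.push g z) → R z (.push g z))
    (hlocal : ∀ g g' z, D.ladj g g' → D.Valid cB (.push g z) → D.Valid cB (.push g' z) →
      R (.push g z) (.push g' z)) {x y : Word B V W} (hx : D.Valid cB x) (hy : D.Valid cB y)
    (hadj : D.wadj G x y) : R x y := by
  cases x with
  | base x =>
    rcases D.wadj_base.1 hadj with ⟨x', rfl, h⟩ | ⟨g, hg, rfl⟩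
    · exact hbase _ _ h
    · exact hchild _ _ hg hy
  | push g z =>
    rcases D.wadj_push.1 hadj with ⟨g', rfl, hl⟩ | ⟨rfl, hg⟩ | ⟨g', hg, rfl⟩
    · exact hlocal _ _ _ hl hx hy
    · exact hsymm _ _ (hchild _ _ hg hx)
    · exact hchild _ _ hg hy

/-- The only edge of `T` missing in its cut copy is `uv`, and it disappears with `v`. -/
theorem wadj_swap (ca : D.c D.a = some true) {x y : Word V V W} (hx : D.Valid D.c x)
    (hy : D.Valid D.c y) (hxv : x ≠ .base D.v) (hyv : y ≠ .base D.v) (h : D.wadj D.T x y) :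
    D.wadj D.S (D.swap x) (D.swap y) := by
  revert hxv hyv
  refine wadj_induction (D := D) (G := D.T) (cB := D.c) (R := fun x y => x ≠ .base D.v → y ≠ .base D.v →
    D.wadj D.S (D.swap x) (D.swap y)) (fun x y h hy hx => D.wadj_symm _ _ _ (h hx hy))
    (fun x y h hx hy => ?_) (fun g z hg hv _ _ => ?_) (fun g g' z hl hv hv' _ _ => ?_) hx hy h
  · refine wadj_of_ladj D.S (.t x) (.t y) ?_
    exact Ok.cut_adj_of_ne h (fun e => hx (e ▸ rfl)) (fun e => hy (e ▸ rfl))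
  · by_cases hz : z = .base D.a
    · subst hz
      rw [D.eq_of_root hg hv ca]
      simp only [swap, if_true]
      exact wadj_of_ladj D.S (.t D.a) (.m false D.N 0) ⟨rfl, Or.inl ⟨rfl, rfl, rfl⟩⟩
    · rw [swap_push hz]
      exact wadj_child _ hg _
  · by_cases hz : z = .base D.a
    · subst hz
      rcases cases_kind_true ca hv with ⟨i, j, rfl⟩ | ⟨y, rfl⟩ <;>
        rcases cases_kind_true ca hv' with ⟨i', j', rfl⟩ | ⟨y', rfl⟩ <;>
        simp only [swap, if_true]
      · exact wadj_of_ladj D.S _ _ ⟨rfl, hl.2⟩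
      · obtain ⟨-, rfl, rfl, rfl⟩ := hl
        exact ⟨rfl, rfl, rfl⟩
      · obtain ⟨-, rfl, rfl, rfl⟩ := hl
        exact ⟨rfl, rfl, rfl⟩
      · exact hl
    · rw [swap_push hz, swap_push hz]
      exact wadj_of_ladj D.S _ _ hl

/-- The only edge without a counterpart joins the tooth tip to the copy of `v`, and it disappears
with that copy. -/
theorem wadj_swapInv (ds : D.d D.s = some false) {x y : Word W V W} (hx : D.Valid D.d x)
    (hy : D.Valid D.d y) (hxv : x ≠ .push (.t D.v) (.base D.s))
    (hyv : y ≠ .push (.t D.v) (.base D.s)) (h : D.wadj D.S x y) :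
    D.wadj D.T (D.swapInv x) (D.swapInv y) := by
  revert hxv hyv
  refine wadj_induction (D := D) (G := D.S) (cB := D.d)
    (R := fun x y => x ≠ .push (.t D.v) (.base D.s) → y ≠ .push (.t D.v) (.base D.s) →
    D.wadj D.T (D.swapInv x) (D.swapInv y)) (fun x y h hy hx => D.wadj_symm _ _ _ (h hx hy))
    (fun x y h _ _ => ?_) (fun g z hg hv _ _ => ?_) (fun g g' z hl hv hv' h1 h2 => ?_) hx hy h
  · exact wadj_of_ladj D.T (.s x) (.s y) h
  · by_cases hz : z = .base D.s
    · subst hz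
      rw [D.eq_of_root hg hv ds]
      simp only [swapInv, if_true]
      exact wadj_of_ladj D.T (.s D.s) (.m true 0 0) ⟨rfl, rfl, rfl, rfl⟩
    · rw [swapInv_push hz]
      exact wadj_child _ hg _
  · by_cases hz : z = .base D.s
    · subst hz
      rcases cases_kind_false ds hv with ⟨i, j, rfl⟩ | ⟨y, rfl⟩ <;>
        rcases cases_kind_false ds hv' with ⟨i', j', rfl⟩ | ⟨y', rfl⟩ <;>
        simp only [swapInv, if_true]
      · exact wadj_of_ladj D.T _ _ ⟨rfl, hl.2⟩
      · obtain ⟨-, ⟨rfl, rfl, rfl⟩ | ⟨-, -, rfl⟩⟩ := hl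
        · exact ⟨rfl, rfl, rfl⟩
        · exact (h2 rfl).elim
      · obtain ⟨-, ⟨rfl, rfl, rfl⟩ | ⟨-, -, rfl⟩⟩ := hl
        · exact ⟨rfl, rfl, rfl⟩
        · exact (h1 rfl).elim
      · exact (Ok.cut_adj_iff.1 hl).1
    · rw [swapInv_push hz, swapInv_push hz]
      exact wadj_of_ladj D.T _ _ hl

/-- The partner of `v` is its copy in the gadget at `s`. That it lies outside the old `S` makes the
partners of different steps distinct in the limit. -/
theorem exists_promise (ca : D.c D.a = some true) (ds : D.d D.s = some false) :
    ∃ e : D.Vert D.c ≃ D.Vert D.d,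
      Promise (D.ext D.T D.c) (D.newCol D.c) (D.ext D.S D.d) (D.newCol D.d) (D.inl D.c D.v) e ∧
      e (D.inl D.c D.v) ∉ Set.range (D.inl D.d) := by
  refine ⟨⟨fun z => ⟨D.swap z.1, valid_swap ca ds z.2⟩,
    fun z => ⟨D.swapInv z.1, valid_swapInv ca ds z.2⟩,
    fun z => Subtype.ext (swapInv_swap ca z.1 z.2), fun z => Subtype.ext (swap_swapInv ds z.1 z.2)⟩,
    ⟨?_, fun x y hx hy => ⟨fun h => ?_, fun h => ?_⟩⟩, push_notMem_range _⟩
  · rintro ⟨z, hz⟩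
    cases z with
    | base x => rfl
    | push g z =>
      by_cases h : z = .base D.a
      · subst h
        rcases cases_kind_true ca hz with ⟨i, j, rfl⟩ | ⟨y, rfl⟩ <;> simp [newCol, swap, ncol]
      · simp [newCol, swap_push h]
  · exact wadj_swap ca x.2 y.2 (fun e => hx (Subtype.ext e)) (fun e => hy (Subtype.ext e)) h
  · have key : ∀ x : D.Vert D.c, x ≠ D.inl D.c D.v →
        D.swap x.1 ≠ .push (.t D.v) (.base D.s) := by
      intro x hx e
      apply hx
      apply Subtype.ext
      rw [← swapInv_swap ca x.1 x.2, e]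
      simp [swapInv, inl]
    have := wadj_swapInv ds (valid_swap ca ds x.2) (valid_swap ca ds y.2) (key x hx) (key y hy) h
    rwa [swapInv_swap ca _ x.2, swapInv_swap ca _ y.2] at this

end Swap

end Gadget

/-! ### One step of the construction. -/

theorem Good.exists_gadget {V W : Type} {K : ℕ} {T : SimpleGraph V} {c : V → Option Bool}
    {S : SimpleGraph W} {d : W → Option Bool} (h : Good K T c S d) (v : V) :
    ∃ (D : Gadget V W) (π : ℕ → V) (n : ℕ), D.Ok π n ∧ D.T = T ∧ D.c = c ∧ D.S = S ∧ D.d = d ∧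
      D.v = v ∧ D.K = K := by
  obtain ⟨a, ha, hva⟩ := h.left.far v true
  obtain ⟨o⟩ := h.right.tree.connected.nonempty
  obtain ⟨s, hs, -⟩ := h.right.far o false
  obtain ⟨w, hw⟩ := h.left.tree.connected.exists_walk_length_eq_dist v a
  -- The bound that determines `L` involves only the other data, so a provisional value 0 is
  -- harmless.
  let D₀ : Gadget V W := ⟨T, c, S, d, a, w.getVert 1, v, s, K, 0⟩
  refine ⟨{ D₀ with L := 2 * (2 * D₀.N + 2 * D₀.K + D₀.cut.dist D₀.u D₀.a + 2) + 1 }, w.getVert,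
    w.length, ⟨h.left, h.right, h.one_le, le_rfl, ha, hs, hw ▸ hva, w.getVert_zero, rfl,
      w.getVert_length, fun i hi => ?_, fun i hi => w.adj_getVert_succ hi⟩, rfl, rfl, rfl, rfl, rfl,
    rfl⟩
  have h1 : T.dist v (w.getVert i) ≤ i := (dist_le (w.take i)).trans (by simp)
  have h2 : T.dist (w.getVert i) a ≤ w.length - i := (dist_le (w.drop i)).trans (by simp)
  have h3 := h.left.tree.connected.dist_triangle (u := v) (v := w.getVert i) (w := a)
  change T.dist v (w.getVert i) = i
  omega

namespace Gadget

namespace Ok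

variable {B V W : Type} {D : Gadget V W} {π : ℕ → V} {n : ℕ} {G : SimpleGraph B}
  {cB : B → Option Bool}

/-- The copies of `S` are excluded by hypothesis, those of `T` because self-embeddings of `T` are
onto. -/
theorem embed_left (h : D.Ok π n) (hB : PortTree D.K G cB) (hTS : ∀ f, ¬ IsEmb f D.T D.S)
    {f : V → D.Vert cB} (hf : IsEmb f D.T (D.ext G cB)) :
    ∃ σ : V → B, IsEmb σ D.T G ∧ ∀ x, f x = D.inl cB (σ x) := by
  rcases h.embed_cases hB h.hT.tight h.hT.four hf with ⟨σ, hσ, hfσ⟩ | ⟨z, σ, hσ, -⟩ | ⟨τ, hτ, hn⟩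
  · exact ⟨σ, hσ, fun x => Subtype.ext (hfσ x)⟩
  · exact (hTS σ hσ).elim
  · exact (hn (h.hT.surjective hτ)).elim

theorem embed_right (h : D.Ok π n) (hB : PortTree D.K G cB) (hST : ∀ f, ¬ IsEmb f D.S D.T)
    {f : D.Vert D.d → D.Vert cB} (hf : IsEmb f (D.ext D.S D.d) (D.ext G cB)) :
    ∃ σ : W → B, IsEmb σ D.S G ∧ ∀ x, f (D.inl D.d x) = D.inl cB (σ x) := by
  rcases h.embed_cases hB h.hS.tight h.hS.four (hf.comp D.isEmb_inl) with
    ⟨σ, hσ, hfσ⟩ | ⟨z, σ, hσ, hfσ⟩ | ⟨τ, hτ, -⟩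
  · exact ⟨σ, hσ, fun x => Subtype.ext (hfσ x)⟩
  · exact (h.not_into_s hf hσ hfσ).elim
  · exact (hST τ hτ).elim

theorem portTree (h : D.Ok π n) (hB : PortTree D.K G cB) (hr : Rigid (D.ext G cB)) :
    PortTree D.L (D.ext G cB) (D.newCol cB) where
  tree := h.isTree hB
  deg := h.encard_le_three hB
  port_deg x hx y z := h.port_deg x hx y z
  port_far p d hp hd w := port_far p d hp hd w
  tight := h.tight hB
  far := h.far hB
  four := four hB
  rigid := hr
  countable := by
    have := h.hT.countable
    have := h.hS.countable
    have := hB.countable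
    infer_instance

/-- If self-embeddings of the extension restrict to the base, the finite set preserved in the base
is preserved in the extension. -/
theorem rigid_ext (hr : Rigid G) (key : ∀ f, IsEmb f (D.ext G cB) (D.ext G cB) →
    ∃ σ : B → B, IsEmb σ G G ∧ ∀ x, f (D.inl cB x) = D.inl cB (σ x)) : Rigid (D.ext G cB) := by
  obtain ⟨F, hF, hFn, hm⟩ := hr
  refine ⟨D.inl cB '' F, hF.image _, hFn.image _, fun f hf => ?_⟩
  obtain ⟨σ, hσ, hfσ⟩ := key f hf
  rintro _ ⟨x, hx, rfl⟩
  exact ⟨σ x, hm σ hσ hx, (hfσ x).symm⟩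

theorem good (h : D.Ok π n) (hTS : ∀ f, ¬ IsEmb f D.T D.S) (hST : ∀ f, ¬ IsEmb f D.S D.T) :
    Good D.L (D.ext D.T D.c) (D.newCol D.c) (D.ext D.S D.d) (D.newCol D.d) where
  left := h.portTree h.hT (rigid_ext h.hT.rigid fun f hf => by
    obtain ⟨σ, hσ, e⟩ := h.embed_left h.hT hTS (hf.comp D.isEmb_inl)
    exact ⟨σ, hσ, e⟩)
  right := h.portTree h.hS (rigid_ext h.hS.rigid fun f hf => h.embed_right h.hS hST hf)
  one_le := h.one_le_L
  left_right f hf := by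
    obtain ⟨σ, hσ, -⟩ := h.embed_left h.hS hTS (hf.comp D.isEmb_inl)
    exact hTS σ hσ
  right_left f hf := by
    obtain ⟨σ, hσ, -⟩ := h.embed_right h.hT hST hf
    exact hST σ hσ

end Ok

end Gadget

/-- `(T', S')` extends `(T, S)`, and every promise for `(T, S)` extends to `(T', S')`. -/
structure Step {V W V' W' : Type} (T : SimpleGraph V) (c : V → Option Bool) (S : SimpleGraph W)
    (d : W → Option Bool) (T' : SimpleGraph V') (c' : V' → Option Bool) (S' : SimpleGraph W')
    (d' : W' → Option Bool) (ι : V → V') (κ : W → W') : Prop where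
  left : Extends T c T' c' ι
  right : Extends S d S' d' κ
  promise : ∀ v e, Promise T c S d v e →
    ∃ e', Promise T' c' S' d' (ι v) e' ∧ ∀ x, e' (ι x) = κ (e x)

theorem Step.comp {V W V' W' V'' W'' : Type} {T : SimpleGraph V} {c : V → Option Bool}
    {S : SimpleGraph W} {d : W → Option Bool} {T' : SimpleGraph V'} {c' : V' → Option Bool}
    {S' : SimpleGraph W'} {d' : W' → Option Bool} {T'' : SimpleGraph V''}
    {c'' : V'' → Option Bool} {S'' : SimpleGraph W''} {d'' : W'' → Option Bool} {ι : V → V'}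
    {κ : W → W'} {ι' : V' → V''} {κ' : W' → W''}
    (h' : Step T' c' S' d' T'' c'' S'' d'' ι' κ') (h : Step T c S d T' c' S' d' ι κ) :
    Step T c S d T'' c'' S'' d'' (ι' ∘ ι) (κ' ∘ κ) := by
  refine ⟨h'.left.comp h.left, h'.right.comp h.right, fun v e he => ?_⟩
  obtain ⟨e₁, he₁, h₁⟩ := h.promise v e he
  obtain ⟨e₂, he₂, h₂⟩ := h'.promise _ _ he₁
  exact ⟨e₂, he₂, fun x => by simp [h₁, h₂]⟩

theorem Step.symm {V W V' W' : Type} {T : SimpleGraph V} {c : V → Option Bool} {S : SimpleGraph W}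
    {d : W → Option Bool} {T' : SimpleGraph V'} {c' : V' → Option Bool} {S' : SimpleGraph W'}
    {d' : W' → Option Bool} {ι : V → V'} {κ : W → W'} (h : Step T c S d T' c' S' d' ι κ) :
    Step S d T c S' d' T' c' κ ι := by
  refine ⟨h.right, h.left, fun w e he => ?_⟩
  obtain ⟨e', he', h'⟩ := h.promise _ _ he.symm
  refine ⟨e'.symm, ?_, fun x => ?_⟩
  · have := he'.symm
    rwa [h', Equiv.symm_apply_apply] at this
  · rw [Equiv.symm_apply_eq, h', Equiv.symm_apply_apply]

theorem Good.exists_step {V W : Type} {K : ℕ} {T : SimpleGraph V} {c : V → Option Bool}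
    {S : SimpleGraph W} {d : W → Option Bool} (h : Good K T c S d) (v : V) :
    ∃ (V' W' : Type) (K' : ℕ) (T' : SimpleGraph V') (c' : V' → Option Bool) (S' : SimpleGraph W')
      (d' : W' → Option Bool) (ι : V → V') (κ : W → W'), Good K' T' c' S' d' ∧
      Step T c S d T' c' S' d' ι κ ∧
      ∃ e', Promise T' c' S' d' (ι v) e' ∧ e' (ι v) ∉ Set.range κ := by
  obtain ⟨D, π, n, hD, rfl, rfl, rfl, rfl, rfl, rfl⟩ := h.exists_gadget v
  exact ⟨D.Vert D.c, D.Vert D.d, D.L, D.ext D.T D.c, D.newCol D.c, D.ext D.S D.d, D.newCol D.d,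
    D.inl D.c, D.inl D.d, hD.good h.left_right h.right_left,
    ⟨Gadget.extends_inl hD.hT, Gadget.extends_inl hD.hS, fun v e he => he.ext⟩,
    Gadget.exists_promise hD.ca hD.ds⟩

/-- One round of the construction takes care of a vertex of each tree. -/
theorem Good.exists_round {V W : Type} {K : ℕ} {T : SimpleGraph V} {c : V → Option Bool}
    {S : SimpleGraph W} {d : W → Option Bool} (h : Good K T c S d) (v : V) (w : W) :
    ∃ (V' W' : Type) (K' : ℕ) (T' : SimpleGraph V') (c' : V' → Option Bool) (S' : SimpleGraph W')
      (d' : W' → Option Bool) (ι : V → V') (κ : W → W'), Good K' T' c' S' d' ∧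
      Step T c S d T' c' S' d' ι κ ∧
      (∃ e', Promise T' c' S' d' (ι v) e' ∧ e' (ι v) ∉ Set.range κ) ∧
      ∃ v' e', Promise T' c' S' d' v' e' ∧ e' v' = κ w ∧ v' ∉ Set.range ι := by
  obtain ⟨V₁, W₁, K₁, T₁, c₁, S₁, d₁, ι₁, κ₁, h₁, hs₁, e₁, he₁, hr₁⟩ := h.exists_step v
  -- The same step with the roles of the trees exchanged; the promise from the first half is then
  -- carried through it.
  obtain ⟨W₂, V₂, K₂, S₂, d₂, T₂, c₂, κ₂, ι₂, h₂, hs₂, e₂, he₂, hr₂⟩ := h₁.symm.exists_step (κ₁ w)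
  refine ⟨V₂, W₂, K₂, T₂, c₂, S₂, d₂, ι₂ ∘ ι₁, κ₂ ∘ κ₁, h₂.symm, hs₂.symm.comp hs₁, ?_, ?_⟩
  · obtain ⟨e', he', h'⟩ := hs₂.symm.promise _ _ he₁
    refine ⟨e', he', ?_⟩
    rintro ⟨x, hx⟩
    exact hr₁ ⟨x, hs₂.left.inj (hx.trans (h' _))⟩
  · refine ⟨_, e₂.symm, he₂.symm, by simp, ?_⟩
    rintro ⟨x, hx⟩
    exact hr₂ ⟨_, hx⟩

/-! ### Direct limits of vertex sets. -/

/-- `Z` is the union of an increasing sequence of sets `V n`. -/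
structure Cone {V : ℕ → Type} (ι : ∀ n, V n → V (n + 1)) {Z : Type} (J : ∀ n, V n → Z) : Prop where
  inj : ∀ n, Injective (J n)
  succ : ∀ n x, J (n + 1) (ι n x) = J n x
  surj : ∀ z, ∃ n x, J n x = z

theorem exists_cone {V : ℕ → Type} (ι : ∀ n, V n → V (n + 1)) (hι : ∀ n, Injective (ι n)) :
    ∃ (Z : Type) (J : ∀ n, V n → Z), Cone ι J := by
  let f : ∀ i j : ℕ, i ≤ j → V i ↪ V j := fun i j h =>
    ⟨Nat.leRecOn h fun {k} => ι k, Nat.leRecOn_injective h _ fun k => hι k⟩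
  have : DirectedSystem V (f · · ·) :=
    ⟨fun i x => Nat.leRecOn_self x, fun k j i hij hjk x => (Nat.leRecOn_trans hij hjk x).symm⟩
  refine ⟨DirectLimit V f, fun n x => Quotient.mk _ ⟨n, x⟩,
    ⟨DirectLimit.mk_injective f fun i j h => (f i j h).injective, fun n x => ?_, fun z => ?_⟩⟩
  · refine Eq.trans ?_ (DirectLimit.eq_of_le (f := f) ⟨n, x⟩ (n + 1) n.le_succ).symm
    congr 2
    exact (Nat.leRecOn_succ' (next := fun {k} => ι k) x).symm
  · obtain ⟨n, x, h⟩ := DirectLimit.exists_eq_mk f z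
    exact ⟨n, x, h.symm⟩

namespace Cone

variable {V W : ℕ → Type} {ι : ∀ n, V n → V (n + 1)} {κ : ∀ n, W n → W (n + 1)} {Z Z' : Type}
  {J : ∀ n, V n → Z} {J' : ∀ n, W n → Z'}

theorem exists_of_le (h : Cone ι J) {n m : ℕ} (hnm : n ≤ m) (x : V n) : ∃ y, J m y = J n x := by
  induction m, hnm using Nat.le_induction with
  | base => exact ⟨x, rfl⟩
  | succ m _ ih =>
    obtain ⟨y, hy⟩ := ih
    exact ⟨ι m y, (h.succ m y).trans hy⟩

theorem shift (h : Cone ι J) (m : ℕ) : Cone (V := fun k => V (m + k)) (fun k => ι (m + k))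
    (fun k => J (m + k)) := by
  refine ⟨fun n => h.inj _, fun n => h.succ _, fun z => ?_⟩
  obtain ⟨n, x, rfl⟩ := h.surj z
  exact ⟨n, h.exists_of_le (by omega) x⟩

theorem exists_map (h : Cone ι J) {Y : Type} (g : ∀ n, V n → Y)
    (hg : ∀ n x, g (n + 1) (ι n x) = g n x) : ∃ f : Z → Y, ∀ n x, f (J n x) = g n x := by
  have key : ∀ n m, n ≤ m → ∀ x y, J n x = J m y → g n x = g m y := by
    intro n m hnm x
    induction m, hnm using Nat.le_induction with
    | base => exact fun y hy => congrArg _ (h.inj _ hy)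
    | succ m hm ih =>
      intro y hy
      obtain ⟨y', hy'⟩ := h.exists_of_le hm x
      obtain rfl : ι m y' = y := h.inj _ ((h.succ _ _).trans (hy'.trans hy))
      rw [hg]
      exact ih y' hy'.symm
  choose n x hx using h.surj
  refine ⟨fun z => g (n z) (x z), fun m y => ?_⟩
  rcases le_total (n (J m y)) m with hle | hle
  · exact key _ _ hle _ _ (hx _)
  · exact (key _ _ hle _ _ (hx _).symm).symm

theorem exists_equiv (h : Cone ι J) (h' : Cone κ J') (e : ∀ n, V n ≃ W n)
    (he : ∀ n x, e (n + 1) (ι n x) = κ n (e n x)) :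
    ∃ E : Z ≃ Z', ∀ n x, E (J n x) = J' n (e n x) := by
  obtain ⟨f, hf⟩ := h.exists_map (fun n x => J' n (e n x)) fun n x => by rw [he, h'.succ]
  obtain ⟨g, hg⟩ := h'.exists_map (fun n x => J n ((e n).symm x)) fun n x => by
    rw [← h.succ n]
    refine congrArg (J (n + 1)) ?_
    rw [Equiv.symm_apply_eq, he, Equiv.apply_symm_apply]
  refine ⟨⟨f, g, fun z => ?_, fun z => ?_⟩, hf⟩
  · obtain ⟨n, x, rfl⟩ := h.surj z
    rw [hf, hg, Equiv.symm_apply_apply]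
  · obtain ⟨n, x, rfl⟩ := h'.surj z
    rw [hg, hf, Equiv.apply_symm_apply]

/-- The stage at which an element first appears determines its index. -/
theorem injective_of_born (h : Cone ι J) (w : ℕ → Z) (h1 : ∀ n, w n ∈ Set.range (J (n + 1)))
    (h2 : ∀ n, w n ∉ Set.range (J n)) : Injective w := by
  have key : ∀ n m, n < m → w n ≠ w m := by
    intro n m hnm e
    obtain ⟨x, hx⟩ := h1 n
    obtain ⟨y, hy⟩ := h.exists_of_le hnm x
    exact h2 m ⟨y, hy.trans (hx.trans e)⟩
  intro n m e
  rcases lt_trichotomy n m with hlt | rfl | hlt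
  · exact (key _ _ hlt e).elim
  · rfl
  · exact (key _ _ hlt e.symm).elim

end Cone

/-- The union of a sequence of graphs. -/
def limGraph {V : ℕ → Type} {Z : Type} (J : ∀ n, V n → Z) (hJ : ∀ n, Injective (J n))
    (T : ∀ n, SimpleGraph (V n)) : SimpleGraph Z where
  Adj z z' := ∃ n x y, J n x = z ∧ J n y = z' ∧ (T n).Adj x y
  symm := ⟨fun _ _ ⟨n, _, _, hx, hy, h⟩ => ⟨n, _, _, hy, hx, h.symm⟩⟩
  loopless := ⟨fun _ ⟨n, _, _, hx, hy, h⟩ => h.ne (hJ n (hx.trans hy.symm))⟩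

/-! ### Limits of trees, of non-embeddability and of promises. -/

section Limit

variable {V : ℕ → Type} {ι : ∀ n, V n → V (n + 1)} {Z : Type} {J : ∀ n, V n → Z}
  {T : ∀ n, SimpleGraph (V n)} {c : ∀ n, V n → Option Bool}

theorem isEmb_lim (h : Cone ι J) (n : ℕ) : IsEmb (J n) (T n) (limGraph J h.inj T) :=
  ⟨h.inj n, fun x y hxy => ⟨n, x, y, rfl, rfl, hxy⟩⟩

variable (h : Cone ι J) (hT : ∀ n, Extends (T n) (c n) (T (n + 1)) (c (n + 1)) (ι n))
include h hT

theorem exists_extends (n k : ℕ) : ∃ φ : V n → V (n + k + 1),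
    Extends (T n) (c n) (T (n + k + 1)) (c (n + k + 1)) φ ∧ ∀ x, J _ (φ x) = J n x := by
  induction k with
  | zero => exact ⟨ι n, hT n, h.succ n⟩
  | succ k ih =>
    obtain ⟨φ, h1, h2⟩ := ih
    exact ⟨ι _ ∘ φ, (hT _).comp h1, fun x => (h.succ _ _).trans (h2 x)⟩

theorem exists_extends_of_lt {n m : ℕ} (hnm : n < m) : ∃ φ : V n → V m,
    Extends (T n) (c n) (T m) (c m) φ ∧ ∀ x, J m (φ x) = J n x := by
  obtain ⟨k, rfl⟩ := Nat.exists_eq_add_of_lt hnm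
  exact exists_extends h hT n k

/-- Each stage is an induced subgraph of the next, so no edge between old vertices appears later. -/
theorem lim_adj_iff {n : ℕ} {x y : V n} :
    (limGraph J h.inj T).Adj (J n x) (J n y) ↔ (T n).Adj x y := by
  refine ⟨?_, fun hxy => ⟨n, x, y, rfl, rfl, hxy⟩⟩
  rintro ⟨m, x', y', hx, hy, hadj⟩
  obtain ⟨φ, hφ, hφJ⟩ := exists_extends_of_lt h hT (show n < n + m + 1 by omega)
  obtain ⟨ψ, hψ, hψJ⟩ := exists_extends_of_lt h hT (show m < n + m + 1 by omega)
  rw [← hφ.adj, ← h.inj _ ((hψJ x').trans (hx.trans (hφJ x).symm)),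
    ← h.inj _ ((hψJ y').trans (hy.trans (hφJ y).symm)), hψ.adj]
  exact hadj

theorem lim_closed {n : ℕ} {x : V n} (hx : c n x = none) {z : Z}
    (hz : (limGraph J h.inj T).Adj (J n x) z) : ∃ y, J n y = z ∧ (T n).Adj x y := by
  suffices ∃ y, J n y = z by
    obtain ⟨y, rfl⟩ := this
    exact ⟨y, rfl, (lim_adj_iff h hT).1 hz⟩
  obtain ⟨m, y, rfl⟩ := h.surj z
  obtain ⟨φ, hφ, hφJ⟩ := exists_extends_of_lt h hT (show n < n + m + 1 by omega)
  obtain ⟨y', hy'⟩ := h.exists_of_le (show m ≤ n + m + 1 by omega) y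
  rw [← hφJ, ← hy', lim_adj_iff h hT] at hz
  obtain ⟨y'', rfl⟩ := hφ.closed x hx _ hz
  exact ⟨y'', (hφJ _).symm.trans hy'⟩

/-- Old vertices are uncoloured at the next stage, so from there on their neighbourhoods are final.
-/
theorem lim_closed_succ {n : ℕ} {x : V n} {z : Z}
    (hz : (limGraph J h.inj T).Adj (J n x) z) :
    ∃ y, J (n + 1) y = z ∧ (T (n + 1)).Adj (ι n x) y := by
  rw [← h.succ] at hz
  exact lim_closed h hT ((hT n).col x) hz

theorem lim_branch {n : ℕ} {x : V n} (hx : IsBranch (limGraph J h.inj T) (J n x)) :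
    IsBranch (T n) x := by
  refine (hT n).branch x ?_
  obtain ⟨p, q, r, h1, h2, h3, h4, h5, h6⟩ := hx
  obtain ⟨p, rfl, k4⟩ := lim_closed_succ h hT h4
  obtain ⟨q, rfl, k5⟩ := lim_closed_succ h hT h5
  obtain ⟨r, rfl, k6⟩ := lim_closed_succ h hT h6
  exact ⟨p, q, r, fun e => h1 (e ▸ rfl), fun e => h2 (e ▸ rfl), fun e => h3 (e ▸ rfl), k4, k5, k6⟩

theorem lim_encard_le (hd : ∀ n x, ((T n).neighborSet x).encard ≤ 3) (z : Z) :
    ((limGraph J h.inj T).neighborSet z).encard ≤ 3 := by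
  obtain ⟨n, x, rfl⟩ := h.surj z
  refine le_trans (Set.encard_le_encard (t := J (n + 1) '' (T (n + 1)).neighborSet (ι n x)) ?_) ?_
  · intro z hz
    obtain ⟨y, hy, hadj⟩ := lim_closed_succ h hT hz
    exact ⟨y, hadj, hy⟩
  · rw [(h.inj _).encard_image]
    exact hd _ _

theorem lim_isTree (ht : ∀ n, (T n).IsTree) : (limGraph J h.inj T).IsTree := by
  refine ⟨?_, isAcyclic_iff_free_cycleGraph.2 fun n hn hcon => ?_⟩
  · obtain ⟨o⟩ := (ht 0).connected.nonempty
    refine (connected_iff _).2 ⟨fun z z' => ?_, ⟨J 0 o⟩⟩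
    obtain ⟨n, x, rfl⟩ := h.surj z
    obtain ⟨m, y, rfl⟩ := h.surj z'
    obtain ⟨x', hx'⟩ := h.exists_of_le (Nat.le_add_right n m) x
    obtain ⟨y', hy'⟩ := h.exists_of_le (Nat.le_add_left m n) y
    rw [← hx', ← hy']
    obtain ⟨w⟩ := (ht (n + m)).connected.preconnected x' y'
    exact ⟨w.map ⟨J (n + m), fun hxy => (isEmb_lim h _).adj _ _ hxy⟩⟩
  · obtain ⟨f, hf⟩ := exists_isEmb hcon
    choose k x hx using fun i => h.surj (f i)
    obtain ⟨N, hN⟩ : ∃ N, ∀ i, k i ≤ N :=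
      ⟨Finset.univ.sup k, fun i => Finset.le_sup (Finset.mem_univ i)⟩
    choose y hy using fun i => h.exists_of_le (hN i) (x i)
    have hfy : IsEmb y (cycleGraph n) (T N) := by
      refine ⟨fun i j e => hf.inj ?_, fun i j hij => ?_⟩
      · rw [← hx, ← hx, ← hy, ← hy, e]
      · rw [← lim_adj_iff h hT, hy, hy, hx, hx]
        exact hf.adj _ _ hij
    exact isAcyclic_iff_free_cycleGraph.1 (ht N).isAcyclic n hn hfy.isContained

theorem lim_isolated {n K : ℕ} (hP : PortTree K (T n) (c n)) :
    Isolated (limGraph J h.inj T) K (Set.range (J n)) := by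
  obtain ⟨o⟩ := hP.tree.connected.nonempty
  have : Nonempty (V n) := ⟨o⟩
  have hinv : ∀ x, invFun (J n) (J n x) = x := leftInverse_invFun (h.inj n)
  refine isolated_of (H := T n) (invFun (J n)) {x | c n x ≠ none} ?_ ?_
  · rintro _ ⟨x, rfl⟩ z hz
    rw [hinv]
    by_cases hx : c n x = none
    · obtain ⟨y, rfl, hy⟩ := lim_closed h hT hx hz
      exact Or.inl ⟨⟨y, rfl⟩, by rwa [hinv]⟩
    · exact Or.inr hx
  · rintro _ ⟨x, rfl⟩ hb e he
    rw [hinv]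
    exact hP.port_far e x he (lim_branch h hT hb)

/-- Take a stage so late that it contains the image of some branch vertex. Its copy in the limit is
isolated, so tightness sends the whole tree of that stage into its partner. -/
theorem lim_not_isEmb {W : ℕ → Type} {κ : ∀ n, W n → W (n + 1)} {Z' : Type} {J' : ∀ n, W n → Z'}
    {S : ∀ n, SimpleGraph (W n)} {d : ∀ n, W n → Option Bool} {K : ℕ → ℕ} (h' : Cone κ J')
    (hS : ∀ n, Extends (S n) (d n) (S (n + 1)) (d (n + 1)) (κ n))
    (hP : ∀ n, PortTree (K n) (T n) (c n)) (hQ : ∀ n, PortTree (K n) (S n) (d n))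
    (hne : ∀ n f, ¬ IsEmb f (T n) (S n)) (f : Z → Z') :
    ¬ IsEmb f (limGraph J h.inj T) (limGraph J' h'.inj S) := by
  intro hf
  obtain ⟨b, -, hb⟩ := (hP 0).four
  obtain ⟨n, y, hy⟩ := h'.surj (f (J 0 (b 0)))
  obtain ⟨x, hx⟩ := h.exists_of_le (Nat.zero_le n) (b 0)
  have hxb : IsBranch (T n) x := lim_branch h hT (by
    rw [hx]
    exact (hb 0).map (isEmb_lim h 0))
  have hfn := hf.comp (isEmb_lim (T := T) h n)
  have hmem := (hP n).tight.mem_of_isEmb hfn (lim_isolated h' hS (hQ n)) hxb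
    ⟨y, by simp [hx, hy]⟩
  choose g hg using hmem
  refine hne n g ⟨fun p q e => hfn.inj (by rw [← hg, ← hg, e]), fun p q hpq => ?_⟩
  rw [← lim_adj_iff h' hS, hg, hg]
  exact hfn.adj _ _ hpq

/-- Extending the promise through all later stages gives compatible bijections, and their limit is
an isomorphism away from `v`. -/
theorem lim_promise {W : ℕ → Type} {κ : ∀ n, W n → W (n + 1)} {Z' : Type} {J' : ∀ n, W n → Z'}
    {S : ∀ n, SimpleGraph (W n)} {d : ∀ n, W n → Option Bool} (h' : Cone κ J')
    (hS : ∀ n, Step (T n) (c n) (S n) (d n) (T (n + 1)) (c (n + 1)) (S (n + 1)) (d (n + 1))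
      (ι n) (κ n)) {n : ℕ} {v : V n} {e : V n ≃ W n} (he : Promise (T n) (c n) (S n) (d n) v e) :
    Nonempty ((limGraph J h.inj T).induce {J n v}ᶜ ≃g
      (limGraph J' h'.inj S).induce {J' n (e v)}ᶜ) := by
  choose E hE hEι using fun n => (hS n).promise
  -- Vertex and bijection are carried together, since each promise refers to the current image of
  -- `v`.
  let s : ∀ k, {p : V (n + k) × (V (n + k) ≃ W (n + k)) //
      Promise (T (n + k)) (c (n + k)) (S (n + k)) (d (n + k)) p.1 p.2} := fun k =>
    Nat.rec ⟨(v, e), he⟩ (fun k s => ⟨(ι (n + k) s.1.1, E _ _ _ s.2), hE _ _ _ s.2⟩) k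
  let v' : ∀ k, V (n + k) := fun k => (s k).1.1
  let e' : ∀ k, V (n + k) ≃ W (n + k) := fun k => (s k).1.2
  have he' : ∀ k, Promise (T (n + k)) (c (n + k)) (S (n + k)) (d (n + k)) (v' k) (e' k) :=
    fun k => (s k).2
  obtain ⟨F, hF⟩ := (h.shift n).exists_equiv (h'.shift n) e' fun k x => hEι _ _ _ (he' k) x
  have hv : ∀ k, J (n + k) (v' k) = J n v := by
    intro k
    induction k with
    | zero => rfl
    | succ k ih => exact (h.succ _ _).trans ih
  -- No ports are left in the limit, so the constant colouring `none` is used.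
  have hP : Promise (limGraph J h.inj T) (fun _ => none) (limGraph J' h'.inj S) (fun _ => none)
      (J n v) F := by
    refine ⟨fun _ => rfl, fun z z' hz hz' => ?_⟩
    obtain ⟨k, x, rfl⟩ := (h.shift n).surj z
    obtain ⟨l, y, rfl⟩ := (h.shift n).surj z'
    obtain ⟨x', hx'⟩ := h.exists_of_le (show n + k ≤ n + (k + l) by omega) x
    obtain ⟨y', hy'⟩ := h.exists_of_le (show n + l ≤ n + (k + l) by omega) y
    rw [← hx'] at hz ⊢
    rw [← hy'] at hz' ⊢
    rw [lim_adj_iff h hT, hF (k + l), hF (k + l), lim_adj_iff h' fun n => (hS n).right]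
    refine (he' (k + l)).adj x' y' ?_ ?_
    · rintro rfl
      exact hz (hv _)
    · rintro rfl
      exact hz' (hv _)
  have := hP.nonempty_iso
  have hFv : F (J n v) = J' n (e v) := hF 0 v
  rwa [hFv] at this

end Limit

/-! ### Scheduling and the hypomorphism. -/

/-- A stage of the construction, with sequences of vertices that wait to be processed. -/
structure Stage where
  V : Type
  W : Type
  K : ℕ
  T : SimpleGraph V
  c : V → Option Bool
  S : SimpleGraph W
  d : W → Option Bool
  good : Good K T c S d
  p : ℕ → ℕ → V
  q : ℕ → ℕ → W

/-- The relation between the stages with numbers `n` and `n + 1`. -/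
structure Stage.Next (n : ℕ) (s s' : Stage) where
  ι : s.V → s'.V
  κ : s.W → s'.W
  step : Step s.T s.c s.S s.d s'.T s'.c s'.S s'.d ι κ
  p_old : ∀ i ≤ n, ∀ j, s'.p i j = ι (s.p i j)
  q_old : ∀ i ≤ n, ∀ j, s'.q i j = κ (s.q i j)
  p_new : Surjective (s'.p (n + 1))
  q_new : Surjective (s'.q (n + 1))
  left : ∃ e', Promise s'.T s'.c s'.S s'.d (ι (s.p n.unpair.1 n.unpair.2)) e' ∧
    e' (ι (s.p n.unpair.1 n.unpair.2)) ∉ Set.range κ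
  right : ∃ v' e', Promise s'.T s'.c s'.S s'.d v' e' ∧ e' v' = κ (s.q n.unpair.1 n.unpair.2) ∧
    v' ∉ Set.range ι

theorem Stage.exists_next (n : ℕ) (s : Stage) : ∃ s', Nonempty (Stage.Next n s s') := by
  obtain ⟨V', W', K', T', c', S', d', ι, κ, hg, hs, hl, hr⟩ :=
    s.good.exists_round (s.p n.unpair.1 n.unpair.2) (s.q n.unpair.1 n.unpair.2)
  have := hg.left.countable
  have := hg.right.countable
  have := hg.left.tree.connected.nonempty
  have := hg.right.tree.connected.nonempty
  obtain ⟨p, hp⟩ := exists_surjective_nat V'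
  obtain ⟨q, hq⟩ := exists_surjective_nat W'
  refine ⟨⟨V', W', K', T', c', S', d', hg, fun i j => if i ≤ n then ι (s.p i j) else p j,
    fun i j => if i ≤ n then κ (s.q i j) else q j⟩, ⟨⟨ι, κ, hs, ?_, ?_, ?_, ?_, hl, hr⟩⟩⟩
  · intro i hi j; simp [hi]
  · intro i hi j; simp [hi]
  · simpa using hp
  · simpa using hq

/-- The sequence of processed vertices exhausts the limit. -/
theorem Cone.surj_of_schedule {V : ℕ → Type} {ι : ∀ n, V n → V (n + 1)} {Z : Type}
    {J : ∀ n, V n → Z} (h : Cone ι J) (p : ∀ n, ℕ → ℕ → V n)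
    (hold : ∀ n, ∀ i ≤ n, ∀ j, p (n + 1) i j = ι n (p n i j)) (hnew : ∀ n, Surjective (p n n))
    (z : Z) : ∃ n, J n (p n n.unpair.1 n.unpair.2) = z := by
  obtain ⟨i, x, rfl⟩ := h.surj z
  obtain ⟨j, rfl⟩ := hnew i x
  have key : ∀ n, i ≤ n → J n (p n i j) = J i (p i i j) := by
    intro n hn
    induction n, hn using Nat.le_induction with
    | base => rfl
    | succ n hn ih => rw [hold n i hn, h.succ, ih]
  -- Row `i` enumerates the vertices of stage `i`; it is already in place when its entry `j` is
  -- treated, because `i ≤ Nat.pair i j`.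
  exact ⟨Nat.pair i j, by simpa using key _ (Nat.left_le_pair i j)⟩

theorem exists_hypomorphic_of_good {V W : Type} {K : ℕ} {T : SimpleGraph V} {c : V → Option Bool}
    {S : SimpleGraph W} {d : W → Option Bool} (hg : Good K T c S d) :
    ∃ (Z Z' : Type) (T' : SimpleGraph Z) (S' : SimpleGraph Z'), Infinite Z ∧ Infinite Z' ∧
      T'.IsTree ∧ S'.IsTree ∧ T'.HasMaxDegree 3 ∧ S'.HasMaxDegree 3 ∧ T'.Hypomorphic S' ∧
      ¬ T'.IsContained S' ∧ ¬ S'.IsContained T' := by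
  have := hg.left.countable
  have := hg.right.countable
  have := hg.left.tree.connected.nonempty
  have := hg.right.tree.connected.nonempty
  obtain ⟨p, hp⟩ := exists_surjective_nat V
  obtain ⟨q, hq⟩ := exists_surjective_nat W
  choose next hnext using Stage.exists_next
  let s : ℕ → Stage := fun n =>
    Nat.rec ⟨V, W, K, T, c, S, d, hg, fun _ => p, fun _ => q⟩ (fun n s => next n s) n
  have N : ∀ n, Stage.Next n (s n) (s (n + 1)) := fun n => (hnext n (s n)).some
  obtain ⟨Z, J, hJ⟩ := exists_cone (V := fun n => (s n).V) (fun n => (N n).ι)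
    fun n => (N n).step.left.inj
  obtain ⟨Z', J', hJ'⟩ := exists_cone (V := fun n => (s n).W) (fun n => (N n).κ)
    fun n => (N n).step.right.inj
  have hT := fun n => (N n).step.left
  have hS := fun n => (N n).step.right
  have hstep := fun n => (N n).step
  have hPT := fun n => (s n).good.left
  have hPS := fun n => (s n).good.right
  let T' := limGraph J hJ.inj fun n => (s n).T
  let S' := limGraph J' hJ'.inj fun n => (s n).S
  let R : Z → Z' → Prop := fun z z' => Nonempty (T'.induce {z}ᶜ ≃g S'.induce {z'}ᶜ)
  have hl : ∀ n, ∃ w, w ∈ Set.range (J' (n + 1)) ∧ w ∉ Set.range (J' n) ∧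
      R (J n ((s n).p n.unpair.1 n.unpair.2)) w := by
    intro n
    obtain ⟨e, he, hn⟩ := (N n).left
    refine ⟨_, ⟨_, rfl⟩, ?_, hJ.succ n _ ▸ lim_promise hJ hT hJ' hstep he⟩
    rintro ⟨x, hx⟩
    exact hn ⟨x, hJ'.inj _ ((hJ'.succ n x).trans hx)⟩
  have hr : ∀ n, ∃ v, v ∈ Set.range (J (n + 1)) ∧ v ∉ Set.range (J n) ∧
      R v (J' n ((s n).q n.unpair.1 n.unpair.2)) := by
    intro n
    obtain ⟨v, e, he, hev, hn⟩ := (N n).right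
    refine ⟨_, ⟨v, rfl⟩, ?_, hJ'.succ n _ ▸ hev ▸ lim_promise hJ hT hJ' hstep he⟩
    rintro ⟨x, hx⟩
    exact hn ⟨x, hJ.inj _ ((hJ.succ n x).trans hx)⟩
  choose w hw1 hw2 hw3 using hl
  choose v hv1 hv2 hv3 using hr
  -- Each partner first appears at the stage following its treatment.
  have hw := hJ'.injective_of_born w hw1 hw2
  have hv := hJ.injective_of_born v hv1 hv2
  choose k hk using hJ.surj_of_schedule (fun n => (s n).p) (fun n => (N n).p_old) (by
    rintro (_ | n)
    · exact hp
    · exact (N n).p_new)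
  choose l hl using hJ'.surj_of_schedule (fun n => (s n).q) (fun n => (N n).q_old) (by
    rintro (_ | n)
    · exact hq
    · exact (N n).q_new)
  -- Neither injection need be onto. The relational Schröder–Bernstein theorem yields a bijection
  -- all of whose pairs satisfy `R`, which is the required hypomorphism.
  obtain ⟨φ, hφ, hφR⟩ := Embedding.schroeder_bernstein_of_rel (f := w ∘ k) (g := v ∘ l)
    (hw.comp fun x y e => by rw [← hk x, ← hk y, e])
    (hv.comp fun x y e => by rw [← hl x, ← hl y, e]) R
    (fun z => by have := hw3 (k z); rwa [hk] at this)
    (fun z => by have := hv3 (l z); rwa [hl] at this)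
  refine ⟨Z, Z', T', S', Infinite.of_injective v hv, Infinite.of_injective w hw,
    lim_isTree hJ hT fun n => (hPT n).tree, lim_isTree hJ' hS fun n => (hPS n).tree,
    ⟨lim_encard_le hJ hT fun n => (hPT n).deg, ?_⟩, ⟨lim_encard_le hJ' hS fun n => (hPS n).deg, ?_⟩,
    ⟨Equiv.ofBijective φ hφ, fun z => hφR z⟩, fun hcon => ?_, fun hcon => ?_⟩
  · obtain ⟨b, -, hb⟩ := (hPT 0).four
    exact ⟨J 0 (b 0), le_antisymm (lim_encard_le hJ hT (fun n => (hPT n).deg) _)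
      ((hb 0).map (isEmb_lim hJ 0)).three_le_encard⟩
  · obtain ⟨b, -, hb⟩ := (hPS 0).four
    exact ⟨J' 0 (b 0), le_antisymm (lim_encard_le hJ' hS (fun n => (hPS n).deg) _)
      ((hb 0).map (isEmb_lim hJ' 0)).three_le_encard⟩
  · obtain ⟨f, hf⟩ := exists_isEmb hcon
    exact lim_not_isEmb hJ hT hJ' hS hPT hPS (fun n => (s n).good.left_right) f hf
  · obtain ⟨f, hf⟩ := exists_isEmb hcon
    exact lim_not_isEmb hJ' hS hJ hT hPS hPT (fun n => (s n).good.right_left) f hf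

/-! ### The finite seed trees. -/

/-- The tree in which every vertex `x ≠ 0` has the parent `par x`. -/
def parentGraph (par : Fin 10 → Fin 10) : SimpleGraph (Fin 10) where
  Adj x y := x ≠ y ∧ (par x = y ∨ par y = x)
  symm := ⟨fun _ _ h => ⟨h.1.symm, h.2.symm⟩⟩
  loopless := ⟨fun _ h => h.1 rfl⟩

instance (par : Fin 10 → Fin 10) : DecidableRel (parentGraph par).Adj := fun x y =>
  inferInstanceAs (Decidable (x ≠ y ∧ (par x = y ∨ par y = x)))

/-- Each colour occurs twice, so that for every vertex there is a port of that colour neither equal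
nor adjacent to it. -/
def seedCol : Fin 10 → Option Bool :=
  ![none, none, none, none, some true, some false, some true, some false, none, none]

section

variable {par : Fin 10 → Fin 10} (h0 : par 0 = 0) (hlt : ∀ y, y ≠ 0 → par y < y)
  (h4 : ∀ y, par y < 4)
include h4

theorem eq_par_of_adj {x y : Fin 10} (hx : ¬ x < 4) (h : (parentGraph par).Adj x y) :
    y = par x := by
  rcases h.2 with h | h
  · exact h.symm
  · exact (hx (h ▸ h4 y)).elim

theorem lt_of_isBranch {x : Fin 10} (h : IsBranch (parentGraph par) x) : x < 4 := by
  by_contra hx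
  obtain ⟨a, b, c, h1, -, -, h2, h3, -⟩ := h
  exact h1 ((eq_par_of_adj h4 hx h2).trans (eq_par_of_adj h4 hx h3).symm)

include h0 hlt

omit h4 in
theorem parentGraph_isTree : (parentGraph par).IsTree := by
  refine ⟨connected_of_height 0 Fin.val fun x hx => ⟨par x, ⟨(hlt x hx).ne', Or.inl rfl⟩, hlt x hx⟩,
    isAcyclic_of_height Fin.val fun x y z hy hz hyx hzx => ?_⟩
  have key : ∀ y, (parentGraph par).Adj x y → y.val ≤ x.val → y = par x := by
    rintro y ⟨hne, rfl | rfl⟩ hle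
    · rfl
    · by_cases hy : y = 0
      · subst hy
        exact (hne h0).elim
      · exact absurd (hlt y hy) (not_lt.2 hle)
  rw [key y hy hyx, key z hz hzx]

theorem parentGraph_portTree {a b e : Fin 10 → Fin 10}
    (hbr : ∀ x, x < 4 → a x ≠ b x ∧ a x ≠ e x ∧ b x ≠ e x ∧ (parentGraph par).Adj x (a x) ∧
      (parentGraph par).Adj x (b x) ∧ (parentGraph par).Adj x (e x))
    (hnb : ∀ x y, x < 4 → (parentGraph par).Adj x y → y = a x ∨ y = b x ∨ y = e x)
    (hfar : ∀ x k, ∃ p, seedCol p = some k ∧ x ≠ p ∧ ¬ (parentGraph par).Adj x p) :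
    PortTree 1 (parentGraph par) seedCol := by
  have htree := parentGraph_isTree h0 hlt
  have hb : ∀ x, x < 4 → IsBranch (parentGraph par) x := fun x hx => ⟨_, _, _, hbr x hx⟩
  have hport : ∀ x, seedCol x ≠ none → ¬ x < 4 := by decide
  have h410 : 4 ≤ 10 := by omega
  refine ⟨htree, fun x => ?_, fun x hx y z hy hz => ?_, fun p d hp hd w => ?_, ?_, fun x k => ?_,
    ⟨fun i => i.castLE h410, Fin.castLE_injective h410, fun i => hb _ ?_⟩,
    ⟨Set.univ, Set.finite_univ, Set.univ_nonempty, fun f _ => Set.mapsTo_univ _ _⟩, inferInstance⟩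
  · by_cases hx : x < 4
    · exact encard_neighborSet_le_three injective_id _ _ _ fun y hy => hnb x y hx hy
    · exact encard_neighborSet_le_three injective_id (par x) (par x) (par x) fun y hy =>
        Or.inl (eq_par_of_adj h4 hx hy)
  · rw [eq_par_of_adj h4 (hport x hx) hy, eq_par_of_adj h4 (hport x hx) hz]
  · cases w with
    | nil => exact (hport _ hp (lt_of_isBranch h4 hd)).elim
    | cons h w => simp
  · rintro U ⟨d, hdU, hd⟩ hU
    have hstep : ∀ x, x < 4 → x ∈ U → ∀ y, (parentGraph par).Adj x y → y ∈ U :=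
      fun x hx hxU y hxy => hU x hxU (hb x hx) y hxy.toWalk (by simp)
    have hpar : ∀ x, x ≠ 0 → (parentGraph par).Adj x (par x) :=
      fun x hx => ⟨(hlt x hx).ne', Or.inl rfl⟩
    -- All parents are branch vertices, so at scale 1 membership passes down to the root and from
    -- there up to every vertex.
    have hzero : ∀ x : Fin 10, x < 4 → x ∈ U → (0 : Fin 10) ∈ U := by
      intro x
      induction x using WellFoundedLT.induction with
      | _ x ih =>
        intro hx hxU
        by_cases hx0 : x = 0
        · exact hx0 ▸ hxU
        · exact ih _ (hlt x hx0) (h4 x) (hstep x hx hxU _ (hpar x hx0))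
    intro y
    induction y using WellFoundedLT.induction with
    | _ y ih =>
      by_cases hy0 : y = 0
      · exact hy0 ▸ hzero d (lt_of_isBranch h4 hd) hdU
      · exact hstep _ (h4 y) (ih _ (hlt y hy0)) _ (hpar y hy0).symm
  · obtain ⟨p, hp, hxp, hadj⟩ := hfar x k
    refine ⟨p, hp, ?_⟩
    have h1 : (parentGraph par).dist x p ≠ 0 := fun h =>
      hxp ((htree.connected.preconnected x p).dist_eq_zero_iff.1 h)
    have h2 : (parentGraph par).dist x p ≠ 1 := fun h => hadj (dist_eq_one_iff_adj.1 h)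
    omega
  · exact Fin.lt_def.2 i.2

end

/-- A vertex with three branch neighbours. -/
def clawPar : Fin 10 → Fin 10 := ![0, 0, 0, 0, 1, 1, 2, 2, 3, 3]

/-- A path of four branch vertices. -/
def pathPar : Fin 10 → Fin 10 := ![0, 0, 1, 2, 0, 0, 3, 3, 1, 2]

theorem portTree_claw : PortTree 1 (parentGraph clawPar) seedCol :=
  parentGraph_portTree (a := ![1, 0, 0, 0, 0, 0, 0, 0, 0, 0]) (b := ![2, 4, 6, 8, 0, 0, 0, 0, 0, 0])
    (e := ![3, 5, 7, 9, 0, 0, 0, 0, 0, 0]) (by decide) (by decide) (by decide) (by decide) (by decide)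
    (by decide)

theorem portTree_path : PortTree 1 (parentGraph pathPar) seedCol :=
  parentGraph_portTree (a := ![1, 0, 1, 2, 0, 0, 0, 0, 0, 0]) (b := ![4, 2, 3, 6, 0, 0, 0, 0, 0, 0])
    (e := ![5, 8, 9, 7, 0, 0, 0, 0, 0, 0]) (by decide) (by decide) (by decide) (by decide) (by decide)
    (by decide)

/-- Embeddings preserve branch vertices, which induce a claw in one tree and a path on four vertices
in the other; neither of these embeds into the other. -/
theorem good_seed : Good 1 (parentGraph clawPar) seedCol (parentGraph pathPar) seedCol := by
  refine ⟨portTree_claw, portTree_path, le_rfl, fun f hf => ?_, fun f hf => ?_⟩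
  · have hb : ∀ x : Fin 10, x < 4 → f x < 4 := fun x hx =>
      lt_of_isBranch (by decide) (IsBranch.map hf (by
        revert x
        unfold IsBranch
        decide))
    have hp : ∀ x y : Fin 10, x < 4 → y < 4 → (parentGraph pathPar).Adj x y →
        y.val = x.val + 1 ∨ x.val = y.val + 1 := by decide
    have h1 := hp _ _ (hb 0 (by decide)) (hb 1 (by decide)) (hf.adj 0 1 (by decide))
    have h2 := hp _ _ (hb 0 (by decide)) (hb 2 (by decide)) (hf.adj 0 2 (by decide))
    have h3 := hp _ _ (hb 0 (by decide)) (hb 3 (by decide)) (hf.adj 0 3 (by decide))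
    have h12 := Fin.val_ne_of_ne (hf.inj.ne (show (1 : Fin 10) ≠ 2 by decide))
    have h13 := Fin.val_ne_of_ne (hf.inj.ne (show (1 : Fin 10) ≠ 3 by decide))
    have h23 := Fin.val_ne_of_ne (hf.inj.ne (show (2 : Fin 10) ≠ 3 by decide))
    omega
  · have hb : ∀ x : Fin 10, x < 4 → f x < 4 := fun x hx =>
      lt_of_isBranch (by decide) (IsBranch.map hf (by
        revert x
        unfold IsBranch
        decide))
    have hp : ∀ x y : Fin 10, x < 4 → y < 4 → (parentGraph clawPar).Adj x y →
        x = 0 ∨ y = 0 := by decide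
    have h1 := hp _ _ (hb 0 (by decide)) (hb 1 (by decide)) (hf.adj 0 1 (by decide))
    have h2 := hp _ _ (hb 1 (by decide)) (hb 2 (by decide)) (hf.adj 1 2 (by decide))
    have h3 := hp _ _ (hb 2 (by decide)) (hb 3 (by decide)) (hf.adj 2 3 (by decide))
    have h02 := hf.inj.ne (show (0 : Fin 10) ≠ 2 by decide)
    have h12 := hf.inj.ne (show (1 : Fin 10) ≠ 2 by decide)
    have h13 := hf.inj.ne (show (1 : Fin 10) ≠ 3 by decide)
    grind

end TreeRecon

theorem theorem1 :
    (∃ (V W : Type) (T : SimpleGraph V) (S : SimpleGraph W),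
      Infinite V ∧ Infinite W ∧
      T.IsTree ∧ S.IsTree ∧
      T.HasMaxDegree 3 ∧ S.HasMaxDegree 3 ∧
      T.Hypomorphic S ∧
      ¬ T.IsContained S ∧ ¬ S.IsContained T ∧
      IsEmpty (T ≃g S)) ∧
    ¬ SimpleGraph.HararySchwenkScottConjecture ∧
    ¬ SimpleGraph.NashWilliamsConnectedQuestion ∧
    ¬ SimpleGraph.NashWilliamsTreeQuestion ∧
    ¬ SimpleGraph.HalinQuestion := by
  obtain ⟨V, W, T, S, hV, hW, hT, hS, hTd, hSd, hTS, h1, h2⟩ :=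
    TreeRecon.exists_hypomorphic_of_good TreeRecon.good_seed
  have hfin : T.HasFiniteDegrees := fun v => Set.finite_of_encard_le_coe (hTd.1 v)
  refine ⟨⟨V, W, T, S, hV, hW, hT, hS, hTd, hSd, hTS, h1, h2, ⟨fun e => h1 ⟨e.toCopy⟩⟩⟩,
    fun h => ?_, fun h => ?_, fun h => ?_, fun h => ?_⟩
  · obtain ⟨e⟩ := h V T hT hfin W S hTS
    exact h2 ⟨e.toCopy⟩
  · obtain ⟨e⟩ := h V T hT.connected hfin W S hTS
    exact h2 ⟨e.toCopy⟩
  · obtain ⟨e⟩ := h V W T S hT hS hTS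
    exact h1 ⟨e.toCopy⟩
  · exact h1 (h V W T S hTS).1
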